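/- Let $R=\bigoplus_{i\in\mathbb Z}R_i$ be a commutative $\mathbb{Z}$-graded ring concentrated in even degrees and let $d$ be an even integer. All $A_\infty$-algebras and $A_\infty$-morphisms are over $R$ and strictly unital; the underlying complexes are cell $R$-modules (free graded modules with an exhaustive filtration whose successive stages are mapping cones of maps from direct sums of free modules on one generator with zero differential). A weak equivalence is an $A_\infty$-morphism $f=(f_1,f_2,\dots)$ such that $f_1$ is a quasi-isomorphism, and two $A_\infty$-algebras are weakly equivalent if they are joined by a finite chain $A\to A_1\leftarrow A_2\to\cdots\leftarrow A_n=C$ of weak equivalences. For a graded module $A$ with a distinguished element $1$ of degree $0$, $T\Sigma A$ is the tensor coalgebra on the suspension, an $A_\infty$-structure is a coderivation $m=(m_1,m_2,\dots)$ of $T\Sigma A$ of degree $-1$ with $m^2=0$ and $m(T^0)=0$, and $\overline{Aut}(T\Sigma A)$ denotes the group, under composition, of degree-zero coalgebra automorphisms $f=(f_1,f_2,\dots)$ with $f_1[1]=[1]$ and $f_i[a_1|\dots|a_i]=0$ for $i\ge 2$ whenever some $a_j=1$. A Moore algebra of degree $d$ over $R$ is an $A_\infty$-structure on the two-cell complex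 $A=\{\Sigma^dR\xrightarrow{\partial}R\}$ (with arbitrary differential $\partial$), that is, on the free graded module with generators $1$ in degree $0$ (the unit) and $y$ in degree $d+1$. Give $t$ the degree $-(d+2)$. Theorem. (1) For every Moore algebra $A$ of degree $d$ one has $m_n[y|\dots|y]=u^A_n[1]$ with $u^A_n\in R_{n(d+2)-2}$ for $n\ge1$, and $A\mapsto u^A(t)=\sum_{n\ge1}u^A_nt^n$ is a bijection from the set of Moore algebras of degree $d$ to the set of formal power series over $R$ of degree $-2$ without constant term. (2) Every $f\in\overline{Aut}(T\Sigma A)$ satisfies $f_n[y|\dots|y]=\varphi_n[y]$ with $\varphi_n\in R_{(n-1)(d+2)}$, and $f\mapsto\varphi(t)=\sum_{n\ge1}\varphi_nt^n$ is an isomorphism from $\overline{Aut}(T\Sigma A)$ onto the group, under composition, of power series $\varphi(t)=\varphi_1t+\varphi_2t^2+\cdots$ of degree $-(d+2)$ with $\varphi_1$ invertible. For Moore algebras $A,B$ of degree $d$, such an $f$ is an $A_\infty$-morphism $B\to A$ if and only if $u^B(t)=u^A(\varphi(t))$. (3) This group acts (on the right) on the set of power series $u(t)$ of degree $-2$ without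 constant term by substitution, $u(t)\mapsto u(\varphi(t))$, and $A\mapsto u^A(t)$ induces a bijection from the set of weak equivalence classes of Moore algebras of degree $d$ over $R$ to the set of orbits of this action. -/

import Mathlib

universe u

namespace MooreAInf

/-! ### Homogeneous formal power series and their substitution -/

section Series

variable {R : Type u} [CommRing R]

/-- `u(t)` is homogeneous of degree `c` when `t` has degree `-e`: the coefficient of `t ^ n` lies in
degree `n * e + c`. -/
def SeriesHasDegree (𝒜 : ℤ → AddSubgroup R) (e c : ℤ) (u : PowerSeries R) : Prop :=
  ∀ n : ℕ, PowerSeries.coeff n u ∈ 𝒜 (n * e + c)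

/-- Formal power series `u(t) = u₁ t + u₂ t² + ⋯` of degree `-2`, where `|t| = -(d + 2)`. -/
def CharSeries (𝒜 : ℤ → AddSubgroup R) (d : ℤ) : Type u :=
  {u : PowerSeries R // PowerSeries.constantCoeff u = 0 ∧ SeriesHasDegree 𝒜 (d + 2) (-2) u}

/-- Formal power series `f(t) = f₁ t + f₂ t² + ⋯` with `f₁` invertible and
`|fᵢ| = (i - 1)(d + 2)`, i.e. `f(t)` has the same degree `-(d + 2)` as `t`. -/
def SeriesGroup (𝒜 : ℤ → AddSubgroup R) (d : ℤ) : Type u :=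
  {f : PowerSeries R // PowerSeries.constantCoeff f = 0 ∧ IsUnit (PowerSeries.coeff 1 f) ∧
    SeriesHasDegree 𝒜 (d + 2) (-(d + 2)) f}

variable {𝒜 : ℤ → AddSubgroup R} [GradedRing 𝒜]

theorem SeriesHasDegree.pow {e : ℤ} {f : PowerSeries R} (hf : SeriesHasDegree 𝒜 e (-e) f) (k : ℕ) :
    SeriesHasDegree 𝒜 e (-(k * e)) (f ^ k) := by
  induction k with
  | zero =>
    intro n
    rw [pow_zero, PowerSeries.coeff_one]
    split_ifs with h
    · subst h
      simpa using SetLike.GradedOne.one_mem (A := 𝒜)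
    · exact zero_mem _
  | succ k ih =>
    intro n
    rw [pow_succ, PowerSeries.coeff_mul]
    refine sum_mem fun p hp => ?_
    have h := SetLike.GradedMul.mul_mem (ih p.1) (hf p.2)
    have hp' : p.1 + p.2 = n := Finset.HasAntidiagonal.mem_antidiagonal.1 hp
    convert h using 2
    rw [← hp']
    push_cast
    ring

theorem SeriesHasDegree.subst {e c : ℤ} {u f : PowerSeries R} (hu : SeriesHasDegree 𝒜 e c u)
    (hf : SeriesHasDegree 𝒜 e (-e) f) (hf0 : PowerSeries.constantCoeff f = 0) :
    SeriesHasDegree 𝒜 e c (u.subst f) := by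
  intro n
  rw [PowerSeries.coeff_subst' (PowerSeries.HasSubst.of_constantCoeff_zero' hf0)]
  refine finsum_induction (· ∈ 𝒜 (n * e + c)) (zero_mem _) (fun _ _ => add_mem) fun k => ?_
  have h := SetLike.GradedMul.mul_mem (hu k) (hf.pow k n)
  rw [smul_eq_mul]
  convert h using 2
  ring

theorem coeff_one_subst {u f : PowerSeries R} (hu : PowerSeries.constantCoeff u = 0)
    (hf : PowerSeries.constantCoeff f = 0) :
    PowerSeries.coeff 1 (u.subst f) = PowerSeries.coeff 1 u * PowerSeries.coeff 1 f := by
  rw [PowerSeries.coeff_subst' (PowerSeries.HasSubst.of_constantCoeff_zero' hf),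
    finsum_eq_single _ 1]
  · simp
  · intro k hk
    rcases Nat.lt_or_gt_of_ne hk with h | h
    · obtain rfl : k = 0 := by omega
      simp [hu]
    · rw [PowerSeries.coeff_of_lt_order (φ := f ^ k), smul_zero]
      refine lt_of_lt_of_le ?_ (PowerSeries.le_order_pow_of_constantCoeff_eq_zero k hf)
      exact_mod_cast h

theorem constantCoeff_subst' {u f : PowerSeries R} (hu : PowerSeries.constantCoeff u = 0)
    (hf : PowerSeries.constantCoeff f = 0) : PowerSeries.constantCoeff (u.subst f) = 0 :=
  PowerSeries.constantCoeff_subst_eq_zero hf u hu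

theorem exists_inv_mem_zero {a : R} (ha : a ∈ 𝒜 0) (hu : IsUnit a) : ∃ v ∈ 𝒜 0, v * a = 1 := by
  obtain ⟨w, hw⟩ := hu.exists_right_inv
  refine ⟨DirectSum.decompose 𝒜 w 0, SetLike.coe_mem _, ?_⟩
  have h := DirectSum.coe_decompose_mul_of_left_mem_zero 𝒜 (j := 0) (b := w) ha
  rw [hw, DirectSum.decompose_of_mem_same 𝒜 (SetLike.GradedOne.one_mem (A := 𝒜))] at h
  rw [mul_comm, ← h]

theorem coeff_self_pow {f : PowerSeries R} (hf : PowerSeries.constantCoeff f = 0) (n : ℕ) :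
    PowerSeries.coeff n (f ^ n) = PowerSeries.coeff 1 f ^ n := by
  obtain ⟨g, rfl⟩ := PowerSeries.X_dvd_iff.2 hf
  have h1 : PowerSeries.coeff 1 (PowerSeries.X * g) = PowerSeries.constantCoeff g := by
    simp
  rw [h1, mul_pow, PowerSeries.coeff_X_pow_mul', if_pos le_rfl, Nat.sub_self]
  simp

theorem SeriesHasDegree.of_leftInv {e : ℤ} {f h : PowerSeries R}
    (hf : SeriesHasDegree 𝒜 e (-e) f) (hf0 : PowerSeries.constantCoeff f = 0)
    (hf1 : IsUnit (PowerSeries.coeff 1 f)) (hh : h.subst f = PowerSeries.X) :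
    SeriesHasDegree 𝒜 e (-e) h := by
  intro n
  induction n using Nat.strong_induction_on with
  | _ n ih =>
  have h1 := congrArg (PowerSeries.coeff n) hh
  rw [PowerSeries.coeff_subst' (PowerSeries.HasSubst.of_constantCoeff_zero' hf0),
    finsum_eq_sum_of_support_subset (s := Finset.range (n + 1)), Finset.sum_range_succ,
    coeff_self_pow hf0] at h1
  · have hX : PowerSeries.coeff n (PowerSeries.X : PowerSeries R) ∈ 𝒜 (n * e + -e) := by
      rw [PowerSeries.coeff_X]
      split_ifs with hn
      · subst hn
        simpa using SetLike.GradedOne.one_mem (A := 𝒜)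
      · exact zero_mem _
    have hS : ∑ k ∈ Finset.range n, PowerSeries.coeff k h • PowerSeries.coeff n (f ^ k) ∈
        𝒜 (n * e + -e) := by
      refine sum_mem fun k hk => ?_
      have h2 := SetLike.GradedMul.mul_mem (ih k (Finset.mem_range.1 hk)) (hf.pow k n)
      rw [smul_eq_mul]
      convert h2 using 2
      ring
    have h0 : PowerSeries.coeff 1 f ^ n ∈ 𝒜 0 := by
      rw [← coeff_self_pow hf0]
      simpa using hf.pow n n
    obtain ⟨v, hv, hv1⟩ := exists_inv_mem_zero h0 (hf1.pow n)
    have h3 : PowerSeries.coeff n h = v * (PowerSeries.coeff n (PowerSeries.X : PowerSeries R) -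
        ∑ k ∈ Finset.range n, PowerSeries.coeff k h • PowerSeries.coeff n (f ^ k)) := by
      rw [← h1, add_sub_cancel_left, smul_eq_mul, mul_left_comm, hv1, mul_one]
    rw [h3]
    simpa using SetLike.GradedMul.mul_mem hv (sub_mem hX hS)
  · intro k hk
    by_contra hkn
    refine hk ?_
    have hkn' : n < k := by simpa using hkn
    change PowerSeries.coeff k h • PowerSeries.coeff n (f ^ k) = 0
    rw [PowerSeries.coeff_of_lt_order (φ := f ^ k), smul_zero]
    refine lt_of_lt_of_le ?_ (PowerSeries.le_order_pow_of_constantCoeff_eq_zero k hf0)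
    exact_mod_cast hkn'

variable {d : ℤ}

/-- The group operation is composition: `(f * g)(t) = f(g(t))`. -/
noncomputable instance : Mul (SeriesGroup 𝒜 d) :=
  ⟨fun f g => ⟨f.1.subst g.1, constantCoeff_subst' f.2.1 g.2.1, by
    rw [coeff_one_subst f.2.1 g.2.1]
    exact f.2.2.1.mul g.2.2.1, f.2.2.2.subst g.2.2.2 g.2.1⟩⟩

noncomputable instance : One (SeriesGroup 𝒜 d) :=
  ⟨⟨PowerSeries.X, by simp, by simp, fun n => by
    rw [PowerSeries.coeff_X]
    split_ifs with hn
    · subst hn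
      simpa using SetLike.GradedOne.one_mem (A := 𝒜)
    · exact zero_mem _⟩⟩

noncomputable instance : Inv (SeriesGroup 𝒜 d) :=
  ⟨fun f => ⟨f.1.substInvOfIsUnit f.2.2.1, by simp, by
    rw [PowerSeries.coeff_one_substInvOfIsUnit]
    exact Units.isUnit _,
    f.2.2.2.of_leftInv f.2.1 f.2.2.1 (PowerSeries.subst_substInvOfIsUnit_left _ f.2.1 f.2.2.1)⟩⟩

noncomputable instance : Group (SeriesGroup 𝒜 d) :=
  Group.ofLeftAxioms
    (fun f g h => Subtype.ext (PowerSeries.subst_comp_subst_apply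
      (PowerSeries.HasSubst.of_constantCoeff_zero' g.2.1)
      (PowerSeries.HasSubst.of_constantCoeff_zero' h.2.1) f.1))
    (fun f => Subtype.ext (PowerSeries.subst_X
      (PowerSeries.HasSubst.of_constantCoeff_zero' f.2.1)))
    (fun f => Subtype.ext (PowerSeries.subst_substInvOfIsUnit_left _ f.2.1 f.2.2.1))

/-- The right action of the group of power series by substitution, `u(t) ↦ u(f(t))`. -/
noncomputable instance : MulAction (SeriesGroup 𝒜 d)ᵐᵒᵖ (CharSeries 𝒜 d) where
  smul f u := ⟨u.1.subst f.unop.1, constantCoeff_subst' u.2.1 f.unop.2.1,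
    u.2.2.subst f.unop.2.2.2 f.unop.2.1⟩
  one_smul u := Subtype.ext (PowerSeries.X_subst u.1)
  mul_smul f g u := Subtype.ext (PowerSeries.subst_comp_subst_apply
    (PowerSeries.HasSubst.of_constantCoeff_zero' g.unop.2.1)
    (PowerSeries.HasSubst.of_constantCoeff_zero' f.unop.2.1) u.1).symm

end Series

/-! ### Maps of tensor coalgebras, through their components -/

section Bar

/-- The components `fₙ : (ΣM)^{⊗ n} → ΣN`, `n ≥ 1`, of a map of tensor coalgebras `TΣM → TΣN` that
sends `T⁰` to `T⁰` identically, or of a coderivation (for `M = N`) that vanishes on `T⁰`. The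
suspension is suppressed: `f n a` stands for `fₙ[a₁|…|aₙ]`. -/
@[ext]
structure BarMap (R M N : Type*) [CommRing R] [AddCommGroup M] [Module R M] [AddCommGroup N]
    [Module R N] where
  comps : (n : ℕ) → MultilinearMap R (fun _ : Fin n => M) N
  comps_zero : comps 0 = 0

variable {R M N P : Type*} [CommRing R] [AddCommGroup M] [Module R M] [AddCommGroup N] [Module R N]
  [AddCommGroup P] [Module R P]

instance : CoeFun (BarMap R M N) fun _ => (n : ℕ) → MultilinearMap R (fun _ : Fin n => M) N :=
  ⟨BarMap.comps⟩

namespace BarMap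

/-- Components of the composite of two coalgebra maps:
`(g ∘ f)[a₁|…|aₙ] = ∑ g[f[a₁|…|a_{i₁}]|…|f[…|aₙ]]`, over all compositions
`n = i₁ + ⋯ + iₖ` with `iⱼ ≥ 1`. -/
def comp (g : BarMap R N P) (f : BarMap R M N) : BarMap R M P where
  comps n := ∑ c : Composition n,
    ((g c.length).compMultilinearMap fun i => f (c.blocksFun i)).domDomCongr c.blocksFinEquiv
  comps_zero := by
    refine MultilinearMap.ext fun a => ?_
    rw [sum_apply]
    refine Finset.sum_eq_zero fun c _ => ?_
    have hc : c.length = 0 := c.length_eq_zero.2 rfl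
    have h : ∀ k, k = 0 → g k = 0 := by
      rintro _ rfl
      exact g.comps_zero
    simp [h _ hc]

theorem comp_apply (g : BarMap R N P) (f : BarMap R M N) (n : ℕ) (a : Fin n → M) :
    g.comp f n a = ∑ c : Composition n,
      g c.length fun i => f (c.blocksFun i) fun j => a (c.embedding i j) := by
  simp only [comp, sum_apply]
  rfl

theorem congr (f : BarMap R M N) {m n : ℕ} (h : m = n) {v : Fin m → M} {w : Fin n → M}
    (hvw : ∀ (i : ℕ) (him : i < m) (hin : i < n), v ⟨i, him⟩ = w ⟨i, hin⟩) : f m v = f n w := by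
  subst h
  congr 1
  funext i
  exact hvw i i.2 i.2

/-- The identity of `TΣM`. -/
def id (R M : Type*) [CommRing R] [AddCommGroup M] [Module R M] : BarMap R M M where
  comps
    | 1 => MultilinearMap.ofSubsingleton R M M (0 : Fin 1) LinearMap.id
    | _ => 0
  comps_zero := rfl

theorem id_one (a : Fin 1 → M) : id R M 1 a = a 0 := rfl

theorem id_of_one_lt {n : ℕ} (h : 1 < n) (a : Fin n → M) : id R M n a = 0 := by
  match n, h with
  | n + 2, _ => rfl

theorem id_of_eq_one {n : ℕ} (h : n = 1) (a : Fin n → M) : id R M n a = a ⟨0, by omega⟩ := by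
  subst h
  rfl

theorem comp_assoc {Q : Type*} [AddCommGroup Q] [Module R Q] (r : BarMap R P Q) (q : BarMap R N P)
    (p : BarMap R M N) : (r.comp q).comp p = r.comp (q.comp p) := by
  ext n v
  let f : (Σ a : Composition n, Composition a.length) → Q := fun c =>
    r c.2.length fun i => q (c.2.blocksFun i) fun j =>
      p (c.1.blocksFun (c.2.embedding i j)) fun k => v (c.1.embedding (c.2.embedding i j) k)
  let g : (Σ c : Composition n, ∀ i : Fin c.length, Composition (c.blocksFun i)) → Q := fun c =>
    r c.1.length fun i : Fin c.1.length => q (c.2 i).length fun j =>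
      p ((c.2 i).blocksFun j) fun k => v (c.1.embedding i ((c.2 i).embedding j k))
  suffices ∑ c, f c = ∑ c, g c by
    simpa +unfoldPartialApp only [comp_apply, Finset.sum_sigma', MultilinearMap.map_sum,
      Finset.univ_sigma_univ] using this
  rw [← (Composition.sigmaEquivSigmaPi n).sum_comp]
  apply Finset.sum_congr rfl
  rintro ⟨a, b⟩ _
  refine r.congr (Composition.length_gather a b).symm fun i hi1 hi2 => ?_
  refine q.congr (Composition.length_sigmaCompositionAux a b _).symm fun j hj1 hj2 => ?_
  refine p.congr (Composition.blocksFun_sigmaCompositionAux a b _ _).symm fun k hk1 hk2 => ?_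
  refine congrArg v (Fin.ext ?_)
  change a.sizeUpTo (b.sizeUpTo i + j) + k =
    (a.gather b).sizeUpTo i + ((a.sigmaCompositionAux b ⟨i, hi2⟩).sizeUpTo j + k)
  rw [← add_assoc]
  exact congrArg (· + k) (Composition.sizeUpTo_sizeUpTo_add a b hi1 hj1)

theorem comp_id (p : BarMap R M N) : p.comp (id R M) = p := by
  ext n v
  rw [comp_apply, Finset.sum_eq_single (Composition.ones n)]
  · apply p.congr (Composition.ones_length n)
    intro i h1 h2
    rw [id_of_eq_one (Composition.ones_blocksFun _ _)]
    refine congrArg v ?_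
    rw [Composition.ones_embedding]
  · intro b _ hb
    obtain ⟨k, hk, lt_k⟩ := Composition.ne_ones_iff.1 hb
    obtain ⟨i, hi⟩ := List.get_of_mem hk
    refine (p b.length).map_coord_zero ⟨i.1, i.2⟩ (id_of_one_lt ?_ _)
    rw [← hi] at lt_k
    exact lt_k
  · simp

theorem id_comp (p : BarMap R M N) : (id R N).comp p = p := by
  ext n v
  obtain rfl | hn := n.eq_zero_or_pos
  · rw [comps_zero, comps_zero]
  rw [comp_apply, Finset.sum_eq_single (Composition.single n hn)]
  · rw [id_of_eq_one (Composition.single_length hn)]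
    refine p.congr (Composition.single_blocksFun hn _) fun i h1 h2 => congrArg v ?_
    exact Composition.single_embedding hn ⟨i, h2⟩
  · intro b _ hb
    have h1 : b.length ≠ 1 := by simpa [Composition.eq_single_iff_length] using hb
    have h2 : 0 < b.length := b.length_pos_iff.2 hn
    exact id_of_one_lt (by omega) _
  · simp

instance : Monoid (BarMap R M M) where
  mul g f := g.comp f
  one := id R M
  mul_assoc := comp_assoc
  one_mul := id_comp
  mul_one := comp_id

theorem mul_apply (g f : BarMap R M M) (n : ℕ) (a : Fin n → M) :
    (g * f) n a = ∑ c : Composition n,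
      g c.length fun i => f (c.blocksFun i) fun j => a (c.embedding i j) :=
  comp_apply g f n a

/-- `f` has degree `p` as a family of maps `(ΣM)^{⊗ n} → ΣN`. An element of degree `j` in `M` has
degree `j + 1` in `ΣM`. -/
def HasDegree (ℳ : ℤ → AddSubgroup M) (𝒩 : ℤ → AddSubgroup N) (p : ℤ) (f : BarMap R M N) : Prop :=
  ∀ (n : ℕ) (a : Fin n → M) (δ : Fin n → ℤ), (∀ i, a i ∈ ℳ (δ i)) →
    f n a ∈ 𝒩 (∑ i, (δ i + 1) + p - 1)

/-- `f₁[1] = [1]`, and `fₙ[a₁|…|aₙ] = 0` for `n ≥ 2` if some `aᵢ` is `1`. -/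
def IsNormalized (oneM : M) (oneN : N) (f : BarMap R M N) : Prop :=
  f 1 (fun _ => oneM) = oneN ∧ ∀ n, 2 ≤ n → ∀ a : Fin n → M, (∃ i, a i = oneM) → f n a = 0

theorem HasDegree.mul {ℳ : ℤ → AddSubgroup M} {f g : BarMap R M M} (hg : g.HasDegree ℳ ℳ 0)
    (hf : f.HasDegree ℳ ℳ 0) : (g * f).HasDegree ℳ ℳ 0 := by
  intro n a δ ha
  rw [mul_apply]
  refine sum_mem fun c _ => ?_
  have h := hg c.length (fun i => f (c.blocksFun i) fun j => a (c.embedding i j))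
    (fun i => ∑ j, (δ (c.embedding i j) + 1) + 0 - 1) fun i => hf _ _ _ fun j => ha _
  convert h using 2
  simp only [add_zero, sub_add_cancel]
  congr 1
  rw [← c.blocksFinEquiv.sum_comp, Fintype.sum_sigma]
  rfl

theorem HasDegree.one {ℳ : ℤ → AddSubgroup M} : (1 : BarMap R M M).HasDegree ℳ ℳ 0 := by
  intro n a δ ha
  match n with
  | 0 => exact zero_mem _
  | 1 =>
    change a 0 ∈ _
    convert ha 0 using 2
    simp
  | n + 2 => exact zero_mem _

theorem IsNormalized.term_eq_zero {oneM : M} {f g : BarMap R M M} (hf : f.IsNormalized oneM oneM)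
    {n : ℕ} (hn : 2 ≤ n) (c : Composition n)
    (hg : 2 ≤ c.length → ∀ b : Fin c.length → M, (∃ i, b i = oneM) → g c.length b = 0)
    (a : Fin n → M) (ha : ∃ i, a i = oneM) :
    (g c.length fun i => f (c.blocksFun i) fun j => a (c.embedding i j)) = 0 := by
  obtain ⟨i, hi⟩ := ha
  have hi' : a (c.embedding (c.index i) (c.invEmbedding i)) = oneM := by
    rw [c.embedding_comp_inv, hi]
  rcases Nat.lt_or_ge (c.blocksFun (c.index i)) 2 with h | h
  · have h1 : c.blocksFun (c.index i) = 1 := by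
      have := c.one_le_blocksFun (c.index i)
      omega
    refine hg ?_ _ ⟨c.index i, ?_⟩
    · by_contra hlen
      have hl : c.length = 1 := by
        have := c.length_pos_iff.2 (show 0 < n by omega)
        omega
      have hc : c = Composition.single n (by omega) := (Composition.eq_single_iff_length _).2 hl
      have hs := c.sum_blocksFun
      have hsum : ∑ k, c.blocksFun k = c.blocksFun (c.index i) := by
        refine Fintype.sum_eq_single _ fun k hk => (hk (Fin.ext ?_)).elim
        omega
      omega
    · rw [← hf.1]
      refine f.congr h1 fun k hk1 hk2 => ?_
      rw [← hi']
      refine congrArg (fun z => a (c.embedding (c.index i) z)) (Fin.ext ?_)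
      have := (c.invEmbedding i).2
      simp only
      omega
  · exact (g c.length).map_coord_zero (c.index i) (hf.2 _ h _ ⟨c.invEmbedding i, hi'⟩)

theorem mul_one_apply (g f : BarMap R M M) (x : M) :
    (g * f) 1 (fun _ => x) = g 1 fun _ => f 1 fun _ => x := by
  rw [mul_apply, Fintype.sum_eq_single (Composition.single 1 one_pos)]
  · refine g.congr (Composition.single_length _) fun i _ _ => ?_
    exact f.congr (Composition.single_blocksFun _ _) fun _ _ _ => rfl
  · intro c hc
    have h1 : c.length ≤ 1 := c.length_le
    have h2 := c.length_pos_iff.2 one_pos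
    exact (hc ((Composition.eq_single_iff_length _).2 (by omega))).elim

theorem IsNormalized.mul {oneM : M} {f g : BarMap R M M} (hg : g.IsNormalized oneM oneM)
    (hf : f.IsNormalized oneM oneM) : (g * f).IsNormalized oneM oneM := by
  refine ⟨by rw [mul_one_apply, hf.1, hg.1], fun n hn a ha => ?_⟩
  rw [mul_apply]
  exact Finset.sum_eq_zero fun c _ => hf.term_eq_zero hn c (hg.2 _) a ha

theorem IsNormalized.inv {oneM : M} {f g : BarMap R M M} (hf : f.IsNormalized oneM oneM)
    (hgf : g * f = 1) (hfg : f * g = 1) : g.IsNormalized oneM oneM := by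
  have h1 : g 1 (fun _ => oneM) = oneM := by
    have h := mul_one_apply g f oneM
    rw [hgf, hf.1] at h
    exact h.symm
  refine ⟨h1, fun n => ?_⟩
  induction n using Nat.strong_induction_on with
  | _ n ih =>
  intro hn a ha
  obtain ⟨i, hi⟩ := ha
  let b : Fin n → M := fun j => g 1 fun _ => a j
  have hb : ∀ j, f 1 (fun _ => b j) = a j := fun j => by
    have h := mul_one_apply f g (a j)
    rw [hfg] at h
    exact h.symm
  have hbi : ∃ i, b i = oneM := ⟨i, by simp only [b, hi, h1]⟩
  have h := mul_apply g f n b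
  rw [hgf, Finset.sum_eq_single (Composition.ones n)] at h
  · refine Eq.trans ?_ (h.symm.trans (id_of_one_lt hn b))
    refine g.congr (Composition.ones_length n).symm fun k hk1 hk2 => ?_
    rw [← hb]
    refine f.congr (Composition.ones_blocksFun _ _).symm fun l hl1 hl2 => congrArg b ?_
    obtain rfl : l = 0 := by omega
    rw [Composition.ones_embedding]
  · intro c _ hc
    refine hf.term_eq_zero hn c (fun h2 => ih _ ?_ h2) b hbi
    exact lt_of_le_of_ne c.length_le fun h3 => hc (Composition.eq_ones_iff_length.2 h3)
  · simp

variable (R) in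
/-- Coalgebra endomorphisms of `TΣM` of degree zero. -/
def degreeZeroEnd (ℳ : ℤ → AddSubgroup M) : Submonoid (BarMap R M M) where
  carrier := {f | f.HasDegree ℳ ℳ 0}
  mul_mem' := HasDegree.mul
  one_mem' := HasDegree.one

variable (R) in
/-- The group of normalized automorphisms of the coalgebra `TΣM`, where `oneM` is the distinguished
element: the invertible coalgebra endomorphisms of degree zero that are normalized. The group
operation is composition. -/
def normalizedAut (ℳ : ℤ → AddSubgroup M) (oneM : M) : Subgroup (degreeZeroEnd R ℳ)ˣ where
  carrier := {f | f.val.val.IsNormalized oneM oneM}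
  mul_mem' hf hg := IsNormalized.mul hf hg
  one_mem' := ⟨rfl, fun _ hn a _ => id_of_one_lt hn a⟩
  inv_mem' {f} hf := IsNormalized.inv hf (congrArg Subtype.val f.inv_mul)
    (congrArg Subtype.val f.mul_inv)

/-- For `m` the components of a coderivation of degree `-1`, the components of `f ∘ m` on
`[a₁|…|aₙ]`:
`∑ (-1)^{|a₁| + ⋯ + |aᵢ| + i} f[a₁|…|aᵢ|mₖ[a_{i+1}|…|a_{i+k}]|a_{i+k+1}|…|aₙ]`,
where `a` is indexed from `0`, only `a 0, …, a (n - 1)` are used, and `δ i` is the degree of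
`a i`. -/
def compCoder (f : BarMap R M N) (m : BarMap R M M) (n : ℕ) (a : ℕ → M) (δ : ℕ → ℤ) : N :=
  ∑ k ∈ Finset.Icc 1 n, ∑ i ∈ Finset.range (n - k + 1),
    (∑ l ∈ Finset.range i, (δ l + 1)).negOnePow •
      f (n - k + 1) fun j =>
        if (j : ℕ) < i then a j
        else if (j : ℕ) = i then m k fun l => a (i + l)
        else a (j + k - 1)

end BarMap
end Bar

/-! ### Unital `A_∞`-algebras -/

section AInf

/-- A (strictly) unital `A_∞`-structure on a graded module `M`. The differential of the underlying
complex is `m₁`. -/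
@[ext]
structure UnitalAInf (R : Type*) {M : Type*} [CommRing R] [AddCommGroup M] [Module R M]
    (ℳ : ℤ → AddSubgroup M) where
  /-- components of the coderivation `m` of `TΣM`, with `m(T⁰) = 0` -/
  m : BarMap R M M
  degree : m.HasDegree ℳ ℳ (-1)
  /-- `m ∘ m = 0` -/
  sq_zero : ∀ (n : ℕ) (a : ℕ → M) (δ : ℕ → ℤ), (∀ i, a i ∈ ℳ (δ i)) → m.compCoder m n a δ = 0
  /-- the unit -/
  one : M
  one_mem : one ∈ ℳ 0
  one_left : ∀ a, m 2 ![one, a] = a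
  one_right : ∀ (j : ℤ), ∀ a ∈ ℳ j, j.negOnePow • m 2 ![a, one] = a
  map_one : ∀ (n : ℕ), n ≠ 2 → ∀ a : Fin n → M, (∃ i, a i = one) → m n a = 0

variable {R : Type u} [CommRing R]

section
variable {M N : Type*} [AddCommGroup M] [Module R M] [AddCommGroup N] [Module R N]
  {ℳ : ℤ → AddSubgroup M} {𝒩 : ℤ → AddSubgroup N}

/-- The differential of the underlying complex. -/
def UnitalAInf.d (A : UnitalAInf R ℳ) (x : M) : M := A.m 1 fun _ => x

/-- Unital `A_∞`-morphisms: coalgebra maps `f : TΣM → TΣN` of degree zero with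
`m_C ∘ f = f ∘ m_A` that are normalized. -/
structure IsAInfMorphism (A : UnitalAInf R ℳ) (C : UnitalAInf R 𝒩) (f : BarMap R M N) : Prop where
  degree : f.HasDegree ℳ 𝒩 0
  comm : ∀ (n : ℕ) (a : ℕ → M) (δ : ℕ → ℤ), (∀ i, a i ∈ ℳ (δ i)) →
    C.m.comp f n (fun i => a i) = f.compCoder A.m n a δ
  unital : f.IsNormalized A.one C.one

/-- A weak equivalence: an `A_∞`-morphism `f` such that `f₁` is injective and surjective on
homology. -/
structure IsWeakEquivalence (A : UnitalAInf R ℳ) (C : UnitalAInf R 𝒩) (f : BarMap R M N) : Prop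
    extends IsAInfMorphism A C f where
  injective : ∀ x, A.d x = 0 → (∃ y, C.d y = f 1 fun _ => x) → ∃ z, A.d z = x
  surjective : ∀ y, C.d y = 0 → ∃ x, A.d x = 0 ∧ ∃ w, C.d w = (f 1 fun _ => x) - y

end

/-- An `A_∞`-algebra over the graded ring `(R, 𝒜)`: a graded module with a unital
`A_∞`-structure, whose underlying complex is a cell module. The latter means that there is a
homogeneous basis, filtered by `rank`, such that the differential of a basis element is a
combination of basis elements of smaller rank; then the basis elements of rank `< n` span the
`n`-th stage, and the next stage is the cone of a map from a sum of sphere modules. -/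
structure AInfAlgebra (𝒜 : ℤ → AddSubgroup R) : Type (u + 1) where
  carrier : Type u
  [addCommGroup : AddCommGroup carrier]
  [module : Module R carrier]
  grading : ℤ → AddSubgroup carrier
  isInternal : DirectSum.IsInternal grading
  smul_mem : ∀ (i j : ℤ), ∀ r ∈ 𝒜 i, ∀ x ∈ grading j, r • x ∈ grading (i + j)
  str : UnitalAInf R grading
  cell : ∃ (ι : Type u) (b : Module.Basis ι R carrier) (deg : ι → ℤ) (rank : ι → ℕ),
    (∀ i, b i ∈ grading (deg i)) ∧
      ∀ i, str.d (b i) ∈ Submodule.span R (b '' {j | rank j < rank i})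

attribute [instance] AInfAlgebra.addCommGroup AInfAlgebra.module

/-- Weak equivalence of `A_∞`-algebras: there is a chain of weak equivalences
`A → A₁ ← A₂ → ⋯ ← Aₙ = C`. -/
def WeaklyEquivalent {𝒜 : ℤ → AddSubgroup R} (A C : AInfAlgebra 𝒜) : Prop :=
  Relation.EqvGen (fun X Y : AInfAlgebra 𝒜 =>
    ∃ f : BarMap R X.carrier Y.carrier, IsWeakEquivalence X.str Y.str f) A C

end AInf

/-! ### Moore algebras -/

section Moore

variable {R : Type u} [CommRing R]

/-- The grading of `R ⊕ Σ^{d+1} R`, the free graded module on the generators `1 = (1, 0)` of degree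
`0` and `y = (0, 1)` of degree `d + 1`. -/
def mooreGrading (𝒜 : ℤ → AddSubgroup R) (d : ℤ) (n : ℤ) : AddSubgroup (R × R) :=
  (𝒜 n).prod (𝒜 (n - (d + 1)))

/-- Moore algebras of degree `d`: unital `A_∞`-structures, with unit the generator `1 = (1, 0)`, on
the two-cell complex with generators `1` and `y`, with any differential. -/
def MooreAlgebra (𝒜 : ℤ → AddSubgroup R) (d : ℤ) : Type u :=
  {A : UnitalAInf R (mooreGrading 𝒜 d) // A.one = (1, 0)}

/-- The generator `y` of degree `d + 1`. -/
def mooreY : R × R := (0, 1)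

variable {𝒜 : ℤ → AddSubgroup R} [GradedRing 𝒜] {d : ℤ}

theorem mooreY_mem : (mooreY : R × R) ∈ mooreGrading 𝒜 d (d + 1) := by
  refine ⟨zero_mem _, ?_⟩
  rw [sub_self]
  exact SetLike.GradedOne.one_mem (A := 𝒜)

theorem moore_isInternal (𝒜 : ℤ → AddSubgroup R) [GradedRing 𝒜] (d : ℤ) :
    DirectSum.IsInternal (mooreGrading 𝒜 d) := by
  have key : ∀ x : DirectSum ℤ fun n => mooreGrading 𝒜 d n, ∀ n : ℤ,
      (DirectSum.decompose 𝒜 (DirectSum.coeAddMonoidHom (mooreGrading 𝒜 d) x).1 n : R) =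
        (x n).1.1 ∧
      (DirectSum.decompose 𝒜 (DirectSum.coeAddMonoidHom (mooreGrading 𝒜 d) x).2 (n - (d + 1)) : R) =
        (x n).1.2 := by
    intro x
    induction x using DirectSum.induction_on with
    | zero => intro n; simp
    | of i x =>
      intro n
      rw [DirectSum.coeAddMonoidHom_of]
      by_cases h : i = n
      · subst h
        rw [DirectSum.of_eq_same, DirectSum.decompose_of_mem_same 𝒜 x.2.1,
          DirectSum.decompose_of_mem_same 𝒜 x.2.2]
        exact ⟨rfl, rfl⟩
      · rw [DirectSum.of_eq_of_ne _ _ _ (Ne.symm h), DirectSum.decompose_of_mem_ne 𝒜 x.2.1 h,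
          DirectSum.decompose_of_mem_ne 𝒜 x.2.2 (by omega)]
        exact ⟨rfl, rfl⟩
    | add x y hx hy =>
      intro n
      simp [DirectSum.decompose_add, (hx n).1, (hx n).2, (hy n).1, (hy n).2]
  constructor
  · rw [injective_iff_map_eq_zero]
    intro x hx
    refine DFinsupp.ext fun n => Subtype.ext (Prod.ext ?_ ?_)
    · have := (key x n).1
      rw [hx] at this
      simpa using this.symm
    · have := (key x n).2
      rw [hx] at this
      simpa using this.symm
  · have h1 : ∀ r : R, (r, (0 : R)) ∈ (DirectSum.coeAddMonoidHom (mooreGrading 𝒜 d)).range := by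
      intro r
      induction r using DirectSum.Decomposition.inductionOn 𝒜 with
      | zero => exact zero_mem _
      | @homogeneous i r => exact ⟨DirectSum.of _ i ⟨(r, 0), r.2, zero_mem _⟩, by simp⟩
      | add r s hr hs => simpa using add_mem hr hs
    have h2 : ∀ r : R, ((0 : R), r) ∈ (DirectSum.coeAddMonoidHom (mooreGrading 𝒜 d)).range := by
      intro r
      induction r using DirectSum.Decomposition.inductionOn 𝒜 with
      | zero => exact zero_mem _
      | @homogeneous i r =>
        refine ⟨DirectSum.of _ (i + (d + 1)) ⟨(0, r), zero_mem _, ?_⟩, by simp⟩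
        rw [add_sub_cancel_right]
        exact r.2
      | add r s hr hs => simpa using add_mem hr hs
    rintro ⟨r, s⟩
    have := add_mem (h1 r) (h2 s)
    rw [Prod.mk_add_mk, add_zero, zero_add] at this
    exact this

/-- A Moore algebra over an evenly graded ring as an `A_∞`-algebra. -/
def MooreAlgebra.toAInfAlgebra (hR : ∀ i, Odd i → 𝒜 i = ⊥) (A : MooreAlgebra 𝒜 d) :
    AInfAlgebra 𝒜 where
  carrier := R × R
  grading := mooreGrading 𝒜 d
  isInternal := moore_isInternal 𝒜 d
  smul_mem i j r hr x hx := by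
    refine ⟨SetLike.GradedMul.mul_mem hr hx.1, ?_⟩
    have := SetLike.GradedMul.mul_mem hr hx.2
    rwa [← add_sub_assoc] at this
  str := A.1
  cell := by
    have h1 : A.1.d (1, 0) = 0 := by
      have h : A.1.d A.1.one = 0 := A.1.map_one 1 (by norm_num) _ ⟨0, rfl⟩
      have h2 : A.1.one = (1, 0) := A.2
      rwa [h2] at h
    have h2 : (A.1.d mooreY).2 = 0 := by
      have h := (A.1.degree 1 (fun _ => mooreY) (fun _ => d + 1) fun _ => mooreY_mem).2
      have h3 : (∑ _i : Fin 1, (d + 1 + 1) + -1 - 1 - (d + 1) : ℤ) = -1 := by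
        simp
      rw [h3, hR (-1) (by decide)] at h
      exact h
    let b : Module.Basis (Fin 2) R (R × R) := Module.Basis.finTwoProd R
    have b0 : (b.reindex Equiv.ulift.symm) ⟨0⟩ = ((1, 0) : R × R) := by simp [b]
    have b1 : (b.reindex Equiv.ulift.symm) ⟨1⟩ = (mooreY : R × R) := by simp [b, mooreY]
    refine ⟨ULift (Fin 2), b.reindex Equiv.ulift.symm, fun i => ![0, d + 1] i.down,
      fun i => i.down, ?_, ?_⟩
    · rintro ⟨i⟩
      fin_cases i
      · change (b.reindex Equiv.ulift.symm) ⟨0⟩ ∈ mooreGrading 𝒜 d 0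
        rw [b0]
        exact ⟨SetLike.GradedOne.one_mem (A := 𝒜), zero_mem _⟩
      · change (b.reindex Equiv.ulift.symm) ⟨1⟩ ∈ mooreGrading 𝒜 d (d + 1)
        rw [b1]
        exact mooreY_mem
    · rintro ⟨i⟩
      fin_cases i
      · change A.1.d ((b.reindex Equiv.ulift.symm) ⟨0⟩) ∈ _
        rw [b0, h1]
        exact zero_mem _
      · change A.1.d ((b.reindex Equiv.ulift.symm) ⟨1⟩) ∈ _
        have h4 : A.1.d mooreY = (A.1.d mooreY).1 • (b.reindex Equiv.ulift.symm) ⟨0⟩ := by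
          rw [b0]
          refine Prod.ext ?_ ?_
          · simp
          · simpa using h2
        rw [b1, h4]
        exact Submodule.smul_mem _ _ (Submodule.subset_span ⟨⟨0⟩, by simp, rfl⟩)

/-- Weak equivalence of Moore algebras of degree `d`. -/
def mooreSetoid (d : ℤ) (hR : ∀ i, Odd i → 𝒜 i = ⊥) : Setoid (MooreAlgebra 𝒜 d) where
  r A C := WeaklyEquivalent (A.toAInfAlgebra hR) (C.toAInfAlgebra hR)
  iseqv :=
    ⟨fun _ => Relation.EqvGen.refl _, fun h => Relation.EqvGen.symm _ _ h,
      fun h h' => Relation.EqvGen.trans _ _ _ h h'⟩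

/-- The characteristic series `u(t) = ∑ uₙ tⁿ` of a Moore algebra, where `uₙ` is the coefficient of
`[1]` in `mₙ[y|…|y]`. -/
def charSeries (A : MooreAlgebra 𝒜 d) : CharSeries 𝒜 d :=
  ⟨PowerSeries.mk fun n => (A.1.m n fun _ => mooreY).1, by
    simp [A.1.m.comps_zero], fun n => by
    have h := (A.1.degree n (fun _ => mooreY) (fun _ => d + 1) fun _ => mooreY_mem).1
    have e : (∑ _i : Fin n, (d + 1 + 1) + -1 - 1 : ℤ) = n * (d + 2) + -2 := by
      simp only [Finset.sum_const, Finset.card_univ, Fintype.card_fin, nsmul_eq_mul]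
      ring
    rw [e] at h
    rw [PowerSeries.coeff_mk]
    exact h⟩

end Moore
end MooreAInf

open MooreAInf

/-!
Parity does most of the work in describing Moore algebras and automorphisms by power series. Since
`R` is even and `y` has odd degree, a homogeneous element of `R ⊕ R y` is a multiple of `1` or of
`y` (`mooreGrading_cases`), so `mₙ[y|…|y]` is a multiple of `[1]` and, for an automorphism `f`,
`fₙ[y|…|y]` is a multiple of `[y]`. Strict unitality prescribes the values on the words containing
`1`, so a structure is determined by a power series `u` (`moore_m_eq`) and an automorphism by a
power series `φ` (`isNormalized_ext`). For any `u` the relation `m ∘ m = 0` holds, because only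
products with the unit contribute and their sum telescopes (`prodBar_compCoder`). In the equation
`m_A ∘ f = f ∘ m_B` the same telescoping sum occurs on both sides, and what is left is
`u^B(t) = u^A(φ(t))`, by Faà di Bruno's formula (`autBar_isAInfMorphism_iff`).

As for weak equivalence classes, an automorphism with `u^B(t) = u^A(φ(t))` is a weak equivalence
`B → A`, because `φ₁` is invertible. The converse has to deal with chains of weak equivalences
through arbitrary `A_∞`-algebras `X`. For a power series `u`, consider the weak Maurer–Cartan
elements of `X` with potential `u`: the solutions `b(t) = b₁ t + b₂ t² + ⋯` of
`∑ₖ mₖ[b(t)|…|b(t)] = u(t)·1`, where `b(t)` has even degree in the suspension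
(`IsWeakMaurerCartan`). The property `Realizes u d X` says that there is such a `b` for which `1`
and `b₁` induce a quasi-isomorphism from a two-cell complex to `X`. A Moore algebra realizes its
own series by `b(t) = y t`. In a Moore algebra with series `u'` every weak Maurer–Cartan element
has the form `φ(t) y`, its potential is `u'(φ(t))`, and the condition on `b₁` makes `φ₁` invertible
(`Realizes.exists_subst`). It remains to see that the property is invariant under weak equivalence.

A morphism `f : A → C` pushes `b` forward to `∑ₖ fₖ[b(t)|…|b(t)]`, with the same potential
(`IsWeakMaurerCartan.push`). Conversely, let `f` be a weak equivalence and let `b'` be a weak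
Maurer–Cartan element of `C`. A weak Maurer–Cartan element `b` of `A` and an element
`c(t) = 1 + c₁ t + ⋯` with `∑ m[f_* b|…|f_* b|c|b'|…|b'] = 0` are constructed one power of `t` at a
time (`IsWeakMaurerCartan.exists_lift`). The Bianchi identity (`insertSum_push_self`) and the
identity `insertSum_insertSum` show that the two obstructions in each step form a cycle of the
mapping cone of `f₁`, which is acyclic (`IsWeakEquivalence.exists_cone_boundary`). Because the
potential is a multiple of the strict unit, it cancels from both identities. The coefficient of `t`
in the equation for `c` shows that the images of the leading terms are homologous.
-/

namespace MooreAInf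

/-! ### Words of positive integers -/

section Words

variable {α β G : Type*} [AddCommMonoid G]

/-- The sum of `F p q` over all ways `l = p ++ q` of cutting the word `l` in two. -/
def splitSum : List α → (List α → List α → G) → G
  | [], F => F [] []
  | x :: l, F => F [] (x :: l) + splitSum l fun p q => F (x :: p) q

theorem splitSum_eq_sum_range (l : List α) (F : List α → List α → G) :
    splitSum l F = ∑ i ∈ Finset.range (l.length + 1), F (l.take i) (l.drop i) := by
  induction l generalizing F with
  | nil => simp [splitSum]
  | cons x l ih =>
    rw [splitSum, ih, List.length_cons, Finset.sum_range_succ' _ (l.length + 1), add_comm]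
    rfl

theorem splitSum_map (f : α → β) (l : List α) (F : List β → List β → G) :
    splitSum (l.map f) F = splitSum l fun p q => F (p.map f) (q.map f) := by
  induction l generalizing F with
  | nil => rfl
  | cons x l ih => simp only [List.map_cons, splitSum, ih, List.map_nil]

/-- A cut of `u ++ c :: v` lies either before or after the letter `c`. -/
theorem splitSum_append_cons (l : List α) (c : α) (r : List α) (F : List α → List α → G) :
    splitSum (l ++ c :: r) F =
      splitSum l (fun p q => F p (q ++ c :: r)) + splitSum r (fun p q => F (l ++ c :: p) q) := by
  induction l generalizing F with
  | nil => simp [splitSum]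
  | cons x l ih => simp only [List.cons_append, splitSum, ih, add_assoc]

/-- The words in positive integers with sum `n`. -/
def compWords (n : ℕ) : Finset (List ℕ) := Finset.univ.image fun c : Composition n => c.blocks

theorem mem_compWords {n : ℕ} {l : List ℕ} :
    l ∈ compWords n ↔ (∀ i ∈ l, 0 < i) ∧ l.sum = n := by
  simp only [compWords, Finset.mem_image, Finset.mem_univ, true_and]
  constructor
  · rintro ⟨c, rfl⟩
    exact ⟨fun i hi => c.blocks_pos hi, c.blocks_sum⟩
  · rintro ⟨h1, h2⟩
    exact ⟨⟨l, fun {i} hi => h1 i hi, h2⟩, rfl⟩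

theorem sum_composition (n : ℕ) (F : List ℕ → G) :
    ∑ c : Composition n, F c.blocks = ∑ l ∈ compWords n, F l := by
  rw [compWords, Finset.sum_image]
  exact fun c _ c' _ h => Composition.ext h

theorem compWords_zero : compWords 0 = {[]} := by
  ext l
  rw [mem_compWords, Finset.mem_singleton]
  constructor
  · rintro ⟨h1, h2⟩
    rw [List.sum_eq_zero_iff] at h2
    exact List.eq_nil_iff_forall_not_mem.2 fun i hi => (h1 i hi).ne' (h2 i hi)
  · rintro rfl
    simp

theorem nil_mem_compWords {n : ℕ} : [] ∈ compWords n ↔ n = 0 := by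
  simp [mem_compWords, eq_comm]

theorem le_of_mem_compWords {n : ℕ} {l : List ℕ} (hl : l ∈ compWords n) : ∀ i ∈ l, i ≤ n := by
  intro i hi
  rw [← (mem_compWords.1 hl).2]
  exact List.le_sum_of_mem hi

theorem lt_of_mem_compWords {n : ℕ} {l : List ℕ} (hl : l ∈ compWords n) (hne : l ≠ [n]) :
    ∀ i ∈ l, i < n := by
  intro i hi
  rw [mem_compWords] at hl
  by_contra hlt
  obtain ⟨s, t, rfl⟩ := List.append_of_mem hi
  have h := hl.2
  rw [List.sum_append, List.sum_cons] at h
  have hs : s = [] := List.eq_nil_iff_forall_not_mem.2 fun j hj => by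
    have h1 := hl.1 j (by simp [hj])
    have h2 := List.le_sum_of_mem hj
    omega
  have ht : t = [] := List.eq_nil_iff_forall_not_mem.2 fun j hj => by
    have h1 := hl.1 j (by simp [hj])
    have h2 := List.le_sum_of_mem hj
    omega
  subst hs ht
  refine hne ?_
  simp at h ⊢
  exact h

theorem compWords_one : compWords 1 = {[1]} := by
  ext l
  rw [Finset.mem_singleton]
  refine ⟨fun hl => ?_, ?_⟩
  · by_contra hne
    have h : l = [] := List.eq_nil_iff_forall_not_mem.2 fun i hi => by
      have h1 := lt_of_mem_compWords hl hne i hi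
      have h2 := (mem_compWords.1 hl).1 i hi
      omega
    subst h
    exact one_ne_zero (nil_mem_compWords.1 hl)
  · rintro rfl
    simp [mem_compWords]

theorem map_congr_of_lt {b b' : ℕ → α} {n : ℕ} (h : ∀ i < n, b' i = b i) {l : List ℕ}
    (hl : ∀ i ∈ l, i < n) : l.map b' = l.map b :=
  List.map_congr_left fun i hi => h i (hl i hi)

theorem sum_compWords_split (n : ℕ) (F : List ℕ → List ℕ → G) :
    ∑ l ∈ compWords n, splitSum l F = ∑ p ∈ Finset.HasAntidiagonal.antidiagonal n,
      ∑ l ∈ compWords p.1, ∑ r ∈ compWords p.2, F l r := by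
  simp only [splitSum_eq_sum_range, Finset.sum_sigma']
  refine Finset.sum_bij'
    (fun x _ => ⟨((x.1.take x.2).sum, (x.1.drop x.2).sum), x.1.take x.2, x.1.drop x.2⟩)
    (fun x _ => ⟨x.2.1 ++ x.2.2, x.2.1.length⟩) ?_ ?_ ?_ ?_ ?_
  · rintro ⟨l, i⟩ h
    simp only [Finset.mem_sigma, mem_compWords, Finset.HasAntidiagonal.mem_antidiagonal] at h ⊢
    refine ⟨?_, ⟨fun j hj => h.1.1 j (List.mem_of_mem_take hj), trivial⟩,
      fun j hj => h.1.1 j (List.mem_of_mem_drop hj), trivial⟩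
    rw [← List.sum_append, List.take_append_drop, h.1.2]
  · rintro ⟨⟨a, b⟩, l, r⟩ h
    simp only [Finset.mem_sigma, mem_compWords, Finset.HasAntidiagonal.mem_antidiagonal] at h ⊢
    refine ⟨⟨fun j hj => (List.mem_append.1 hj).elim (h.2.1.1 j) (h.2.2.1 j), ?_⟩, by simp⟩
    rw [List.sum_append, h.2.1.2, h.2.2.2, h.1]
  · rintro ⟨l, i⟩ h
    simp only [Finset.mem_sigma, Finset.mem_range] at h
    have : i ≤ l.length := by omega
    simp [this]
  · rintro ⟨⟨a, b⟩, l, r⟩ h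
    simp only [Finset.mem_sigma, mem_compWords] at h
    simp [h.2.1.2, h.2.2.2]
  · rintro ⟨l, i⟩ h
    rfl

/-- Sums over words that are cut in three, with the middle piece summed last. -/
theorem sum_compWords_split_split (n : ℕ) (F : List ℕ → List ℕ → List ℕ → G) :
    ∑ l ∈ compWords n, splitSum l (fun p l' => splitSum l' (F p)) =
      ∑ x ∈ Finset.HasAntidiagonal.antidiagonal n, ∑ p ∈ compWords x.1,
        ∑ y ∈ Finset.HasAntidiagonal.antidiagonal x.2,
          ∑ r ∈ compWords y.2, ∑ q ∈ compWords y.1, F p q r := by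
  rw [sum_compWords_split]
  refine Finset.sum_congr rfl fun x _ => Finset.sum_congr rfl fun p _ => ?_
  rw [sum_compWords_split]
  exact Finset.sum_congr rfl fun y _ => Finset.sum_comm

theorem sum_compWords_cons {n : ℕ} (hn : n ≠ 0) (F : ℕ → List ℕ → G) (F0 : G) :
    ∑ l ∈ compWords n, (match l with | [] => F0 | j :: l => F j l) =
      ∑ p ∈ Finset.HasAntidiagonal.antidiagonal n,
        if p.1 ≠ 0 then ∑ l ∈ compWords p.2, F p.1 l else 0 := by
  simp only [← Finset.sum_filter, Finset.sum_sigma']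
  refine Finset.sum_bij' (fun l _ => ⟨(l.headD 0, l.tail.sum), l.tail⟩)
    (fun x _ => x.1.1 :: x.2) ?_ ?_ ?_ ?_ ?_
  · rintro (_ | ⟨j, l⟩) h
    · exact (hn (nil_mem_compWords.1 h)).elim
    · rw [mem_compWords] at h
      simp only [List.mem_cons, forall_eq_or_imp, List.sum_cons] at h
      simp [mem_compWords, h.2]
      exact ⟨by omega, h.1.2⟩
  · rintro ⟨⟨a, b⟩, l⟩ h
    simp only [Finset.mem_sigma, mem_compWords, Finset.HasAntidiagonal.mem_antidiagonal,
      Finset.mem_filter] at h ⊢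
    simp only [List.mem_cons, forall_eq_or_imp, List.sum_cons]
    exact ⟨⟨by omega, h.2.1⟩, by omega⟩
  · rintro (_ | ⟨j, l⟩) h
    · exact (hn (nil_mem_compWords.1 h)).elim
    · rfl
  · rintro ⟨⟨a, b⟩, l⟩ h
    simp only [Finset.mem_sigma, mem_compWords] at h
    simp [h.2.2]
  · rintro (_ | ⟨j, l⟩) h
    · exact (hn (nil_mem_compWords.1 h)).elim
    · rfl

end Words

/-! ### Coefficients of a substitution -/

section SubstSeries

variable {R : Type u} [CommRing R]

theorem coeff_pow_eq_sum_compWords {f : PowerSeries R} (hf : PowerSeries.constantCoeff f = 0)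
    (k n : ℕ) : PowerSeries.coeff n (f ^ k) = ∑ l ∈ compWords n,
      if l.length = k then (l.map fun i => PowerSeries.coeff i f).prod else 0 := by
  induction k generalizing n with
  | zero =>
    rw [pow_zero, PowerSeries.coeff_one]
    simp only [List.length_eq_zero_iff, Finset.sum_ite_eq', nil_mem_compWords, List.map_nil,
      List.prod_nil]
  | succ k ih =>
    rw [pow_succ', PowerSeries.coeff_mul]
    obtain rfl | hn := eq_or_ne n 0
    · simp [compWords_zero, hf]
    · have h : ∀ l ∈ compWords n, (if l.length = k + 1 then
          (l.map fun i => PowerSeries.coeff i f).prod else 0) = (match l with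
          | [] => 0
          | j :: l => if l.length = k then PowerSeries.coeff j f *
              (l.map fun i => PowerSeries.coeff i f).prod else 0) := by
        rintro (_ | ⟨j, l⟩) _
        · simp
        · simp
      rw [Finset.sum_congr rfl h, sum_compWords_cons hn (fun j l => if l.length = k then
        PowerSeries.coeff j f * (l.map fun i => PowerSeries.coeff i f).prod else 0) 0]
      refine Finset.sum_congr rfl fun p _ => ?_
      by_cases hp : p.1 = 0
      · rw [if_neg (not_not.2 hp), hp, PowerSeries.coeff_zero_eq_constantCoeff_apply, hf, zero_mul]
      · rw [if_pos hp, ih, Finset.mul_sum]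
        refine Finset.sum_congr rfl fun l _ => ?_
        rw [mul_ite, mul_zero]

/-- Faà di Bruno's formula for substitution: the coefficients of `u(f(t))` are sums over
compositions. -/
theorem coeff_subst_eq_sum_composition (u : PowerSeries R) {f : PowerSeries R}
    (hf : PowerSeries.constantCoeff f = 0) (n : ℕ) :
    PowerSeries.coeff n (u.subst f) = ∑ c : Composition n,
      PowerSeries.coeff c.length u * ∏ i, PowerSeries.coeff (c.blocksFun i) f := by
  have h : ∀ c : Composition n, PowerSeries.coeff c.length u *
      ∏ i, PowerSeries.coeff (c.blocksFun i) f = (fun l : List ℕ =>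
        PowerSeries.coeff l.length u * (l.map fun i => PowerSeries.coeff i f).prod) c.blocks := by
    intro c
    refine congrArg (PowerSeries.coeff c.length u * ·) ?_
    rw [← c.ofFn_blocksFun, List.map_ofFn, List.prod_ofFn]
    rfl
  rw [Fintype.sum_congr _ _ h, sum_composition n (fun l : List ℕ =>
        PowerSeries.coeff l.length u * (l.map fun i => PowerSeries.coeff i f).prod),
    PowerSeries.coeff_subst' (PowerSeries.HasSubst.of_constantCoeff_zero' hf),
    finsum_eq_sum_of_support_subset (s := Finset.range (n + 1))]
  · simp only [coeff_pow_eq_sum_compWords hf, smul_eq_mul, Finset.mul_sum, mul_ite, mul_zero]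
    rw [Finset.sum_comm]
    refine Finset.sum_congr rfl fun l hl => ?_
    rw [Finset.sum_ite_eq, if_pos]
    rw [Finset.mem_range, Nat.lt_succ_iff]
    rw [mem_compWords] at hl
    rw [← hl.2]
    exact List.length_le_sum_of_one_le _ hl.1
  · intro k hk
    by_contra hkn
    refine hk ?_
    have hkn' : n < k := by simpa using hkn
    change PowerSeries.coeff k u • PowerSeries.coeff n (f ^ k) = 0
    rw [PowerSeries.coeff_of_lt_order (φ := f ^ k), smul_zero]
    refine lt_of_lt_of_le ?_ (PowerSeries.le_order_pow_of_constantCoeff_eq_zero k hf)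
    exact_mod_cast hkn'

end SubstSeries

/-! ### Coalgebra maps on the two-cell module -/

section TwoCell

variable {R : Type u} [CommRing R]

/-- The product `a₁ ⋯ aₙ` of the `y`-coordinates, as a multilinear map. -/
noncomputable def prodSnd (R : Type u) [CommRing R] (n : ℕ) :
    MultilinearMap R (fun _ : Fin n => R × R) R :=
  (MultilinearMap.mkPiAlgebra R (Fin n) R).compLinearMap fun _ => LinearMap.snd R R R

theorem prodSnd_apply (n : ℕ) (a : Fin n → R × R) : prodSnd R n a = ∏ i, (a i).2 := by
  simp [prodSnd]

/-- The map of tensor coalgebras with `[y|…|y] ↦ cₙ` that vanishes on the words containing `1`. -/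
noncomputable def prodBar (c : ℕ → R × R) (hc : c 0 = 0) : BarMap R (R × R) (R × R) where
  comps n := (prodSnd R n).smulRight (c n)
  comps_zero := by
    ext <;> simp [hc]

theorem prodBar_apply (c : ℕ → R × R) (hc : c 0 = 0) (n : ℕ) (a : Fin n → R × R) :
    prodBar c hc n a = (∏ i, (a i).2) • c n := by
  rw [← prodSnd_apply]
  rfl

/-- The part of the structure map of a Moore algebra that is prescribed by strict unitality:
`[1|1] ↦ [1]`, `[1|y] ↦ [y]`, `[y|1] ↦ -[y]`, and `0` on all other words in `1` and `y`. -/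
noncomputable def unitMul (R : Type u) [CommRing R] : BarMap R (R × R) (R × R) where
  comps
    | 2 => ((MultilinearMap.mkPiAlgebra R (Fin 2) R).compLinearMap
        ![LinearMap.fst R R R, LinearMap.fst R R R]).smulRight (1, 0) +
      ((MultilinearMap.mkPiAlgebra R (Fin 2) R).compLinearMap
        ![LinearMap.fst R R R, LinearMap.snd R R R]).smulRight (0, 1) -
      ((MultilinearMap.mkPiAlgebra R (Fin 2) R).compLinearMap
        ![LinearMap.snd R R R, LinearMap.fst R R R]).smulRight (0, 1)
    | _ => 0
  comps_zero := rfl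

theorem unitMul_two (a : Fin 2 → R × R) :
    unitMul R 2 a = ((a 0).1 * (a 1).1, (a 0).1 * (a 1).2 - (a 0).2 * (a 1).1) := by
  simp [unitMul, Fin.prod_univ_two]

theorem unitMul_of_ne {n : ℕ} (hn : n ≠ 2) (a : Fin n → R × R) : unitMul R n a = 0 := by
  match n, hn with
  | 0, _ => rfl
  | 1, _ => rfl
  | n + 3, _ => rfl

theorem unitMul_of_eq {n : ℕ} (hn : n = 2) (a : Fin n → R × R) :
    unitMul R n a = ((a ⟨0, by omega⟩).1 * (a ⟨1, by omega⟩).1,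
      (a ⟨0, by omega⟩).1 * (a ⟨1, by omega⟩).2 - (a ⟨0, by omega⟩).2 * (a ⟨1, by omega⟩).1) := by
  subst hn
  exact unitMul_two a

/-- The part of a normalized automorphism that is prescribed by normalization: `[1] ↦ [1]`, and `0`
on all other words in `1` and `y`. -/
noncomputable def unitId (R : Type u) [CommRing R] : BarMap R (R × R) (R × R) where
  comps
    | 1 => MultilinearMap.ofSubsingleton R (R × R) (R × R) (0 : Fin 1)
        (LinearMap.inl R R R ∘ₗ LinearMap.fst R R R)
    | _ => 0
  comps_zero := rfl

theorem unitId_one (a : Fin 1 → R × R) : unitId R 1 a = ((a 0).1, 0) := rfl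

theorem unitId_of_ne {n : ℕ} (hn : n ≠ 1) (a : Fin n → R × R) : unitId R n a = 0 := by
  match n, hn with
  | 0, _ => rfl
  | n + 2, _ => rfl

theorem unitId_of_eq {n : ℕ} (hn : n = 1) (a : Fin n → R × R) :
    unitId R n a = ((a ⟨0, by omega⟩).1, 0) := by
  subst hn
  rfl

/-- A multilinear map on `R ⊕ R y` that vanishes on the words containing `1` is determined by its
value on `[y|…|y]`. -/
theorem multilinear_eq_prod_smul {N : Type*} [AddCommGroup N] [Module R N] {n : ℕ}
    (g : MultilinearMap R (fun _ : Fin n => R × R) N)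
    (hg : ∀ a : Fin n → R × R, (∀ i, a i = (1, 0) ∨ a i = mooreY) → (∃ i, a i = (1, 0)) → g a = 0)
    (a : Fin n → R × R) : g a = (∏ i, (a i).2) • g fun _ => mooreY := by
  have h : g = (prodSnd R n).smulRight (g fun _ => mooreY) := by
    refine Module.Basis.ext_multilinear (fun _ => Module.Basis.finTwoProd R) fun v => ?_
    have hv : ∀ i, Module.Basis.finTwoProd R (v i) = (1, 0) ∨
        Module.Basis.finTwoProd R (v i) = mooreY := by
      intro i
      generalize v i = k
      fin_cases k
      · left; simp
      · right; simp [mooreY]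
    by_cases h1 : ∃ i, Module.Basis.finTwoProd R (v i) = (1, 0)
    · rw [hg _ hv h1]
      obtain ⟨i, hi⟩ := h1
      rw [MultilinearMap.smulRight_apply, prodSnd_apply,
        Finset.prod_eq_zero (Finset.mem_univ i) (by rw [hi]), zero_smul]
    · have h2 : (fun i => Module.Basis.finTwoProd R (v i)) = fun _ => mooreY :=
        funext fun i => (hv i).resolve_left fun h => h1 ⟨i, h⟩
      rw [h2, MultilinearMap.smulRight_apply, prodSnd_apply]
      simp [mooreY]
  conv_lhs => rw [h]
  rw [MultilinearMap.smulRight_apply, prodSnd_apply]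

variable {𝒜 : ℤ → AddSubgroup R} {d : ℤ}

theorem unitId_hasDegree :
    (unitId R).HasDegree (mooreGrading 𝒜 d) (mooreGrading 𝒜 d) 0 := by
  intro n a δ ha
  obtain rfl | hn := eq_or_ne n 1
  · rw [unitId_one]
    refine ⟨?_, zero_mem _⟩
    simpa using (ha 0).1
  · rw [unitId_of_ne hn]
    exact zero_mem _

/-- Since `R` is even and `y` has odd degree, a homogeneous element is a multiple of `1` or of
`y`. -/
theorem mooreGrading_cases (hR : ∀ i, Odd i → 𝒜 i = ⊥) (hd : Even d) {a : R × R} {δ : ℤ}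
    (ha : a ∈ mooreGrading 𝒜 d δ) : (Even δ ∧ a.2 = 0) ∨ (Odd δ ∧ a.1 = 0) := by
  rcases Int.even_or_odd δ with h | h
  · refine Or.inl ⟨h, ?_⟩
    have := ha.2
    rw [hR _ (h.sub_odd hd.add_one)] at this
    exact this
  · refine Or.inr ⟨h, ?_⟩
    have := ha.1
    rw [hR _ h] at this
    exact this

variable [GradedRing 𝒜]

theorem smul_mem_mooreGrading {i j k : ℤ} {r : R} {x : R × R} (hr : r ∈ 𝒜 i)
    (hx : x ∈ mooreGrading 𝒜 d j) (hk : i + j = k) : r • x ∈ mooreGrading 𝒜 d k := by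
  subst hk
  refine ⟨SetLike.GradedMul.mul_mem hr hx.1, ?_⟩
  have := SetLike.GradedMul.mul_mem hr hx.2
  rwa [← add_sub_assoc] at this

theorem prodBar_hasDegree {c : ℕ → R × R} {hc : c 0 = 0} {p : ℤ}
    (h : ∀ n : ℕ, c n ∈ mooreGrading 𝒜 d (n * (d + 2) + p - 1)) :
    (prodBar c hc).HasDegree (mooreGrading 𝒜 d) (mooreGrading 𝒜 d) p := by
  intro n a δ ha
  rw [prodBar_apply]
  have h1 : ∏ i, (a i).2 ∈ 𝒜 (∑ i, (δ i - (d + 1))) :=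
    SetLike.prod_mem_graded _ _ _ fun i _ => (ha i).2
  refine smul_mem_mooreGrading h1 (h n) ?_
  simp only [Finset.sum_sub_distrib, Finset.sum_add_distrib, Finset.sum_const, Finset.card_univ,
    Fintype.card_fin, nsmul_eq_mul]
  ring

theorem unitMul_hasDegree :
    (unitMul R).HasDegree (mooreGrading 𝒜 d) (mooreGrading 𝒜 d) (-1) := by
  intro n a δ ha
  obtain rfl | hn := eq_or_ne n 2
  · rw [unitMul_two]
    have e : ∑ i, (δ i + 1) + -1 - 1 = δ 0 + δ 1 := by
      rw [Fin.sum_univ_two]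
      ring
    rw [e]
    have h1 : (a 0).1 * (a 1).1 ∈ 𝒜 (δ 0 + δ 1) := SetLike.GradedMul.mul_mem (ha 0).1 (ha 1).1
    refine ⟨h1, AddSubgroup.sub_mem _ ?_ ?_⟩
    · have := SetLike.GradedMul.mul_mem (A := 𝒜) (ha 0).1 (ha 1).2
      rwa [← add_sub_assoc] at this
    · have := SetLike.GradedMul.mul_mem (A := 𝒜) (ha 0).2 (ha 1).1
      rwa [sub_add_eq_add_sub] at this
  · rw [unitMul_of_ne hn]
    exact zero_mem _

end TwoCell

/-! ### Composition with a coderivation on the two-cell module -/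

section Compute

variable {R : Type u} [CommRing R]

/-- The coefficient of the word `a₀ ⋯ aₙ₋₁` at `y ⋯ y 1 y ⋯ y`, with the letter `1` in place `i`. -/
noncomputable def unitCoeff (n : ℕ) (a : ℕ → R × R) (i : ℕ) : R :=
  (∏ j ∈ Finset.range i, (a j).2) * (a i).1 * ∏ j ∈ Finset.Ico (i + 1) n, (a j).2

variable {a : ℕ → R × R} {δ : ℕ → ℤ}

theorem negOnePow_sum_smul_prod (hs : ∀ i, (δ i + 1).negOnePow • (a i).2 = (a i).2) (i : ℕ) :
    (∑ l ∈ Finset.range i, (δ l + 1)).negOnePow • ∏ l ∈ Finset.range i, (a l).2 =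
      ∏ l ∈ Finset.range i, (a l).2 := by
  induction i with
  | zero => simp
  | succ i ih =>
    rw [Finset.sum_range_succ, Finset.prod_range_succ, Int.negOnePow_add, mul_smul,
      ← mul_smul_comm, hs, ← smul_mul_assoc, ih]

/-- Only the products `[1|y] ↦ [y]` and `[y|1] ↦ -[y]` of neighbours contribute, and their sum
telescopes. -/
theorem prodBar_compCoder (c : ℕ → R × R) (hc : c 0 = 0) (m : BarMap R (R × R) (R × R))
    (hm : ∀ k v, (m k v).2 = (unitMul R k v).2)
    (hs : ∀ i, (δ i + 1).negOnePow • (a i).2 = (a i).2) (n : ℕ) :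
    (prodBar c hc).compCoder m (n + 1) a δ =
      (unitCoeff (n + 1) a 0 - unitCoeff (n + 1) a n) • c n := by
  rw [BarMap.compCoder]
  obtain rfl | hn := n.eq_zero_or_pos
  · rw [sub_self, zero_smul]
    refine Finset.sum_eq_zero fun k hk => Finset.sum_eq_zero fun i hi => ?_
    obtain rfl : k = 1 := by simpa using hk
    rw [prodBar_apply, Finset.prod_eq_zero (Finset.mem_univ (⟨i, by simpa using hi⟩)), zero_smul,
      smul_zero]
    rw [if_neg (lt_irrefl _), if_pos rfl, hm, unitMul_of_ne (by norm_num)]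
    rfl
  obtain ⟨N, rfl⟩ : ∃ N, n = N + 1 := ⟨n - 1, by omega⟩
  rw [Finset.sum_eq_single 2]
  · have key : ∀ i ∈ Finset.range (N + 1), (∑ l ∈ Finset.range i, (δ l + 1)).negOnePow •
        (prodBar c hc (N + 1) fun j => if (j : ℕ) < i then a j else if (j : ℕ) = i then
          m 2 fun l => a (i + l) else a (j + 2 - 1)) =
        (unitCoeff (N + 2) a i - unitCoeff (N + 2) a (i + 1)) • c (N + 1) := by
      intro i hi
      rw [Finset.mem_range] at hi
      rw [prodBar_apply, ← smul_assoc]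
      congr 1
      rw [Fin.prod_univ_eq_prod_range (fun j => (if j < i then a j else if j = i then
          m 2 fun l => a (i + l) else a (j + 2 - 1)).2) (N + 1),
        ← Finset.prod_range_mul_prod_Ico _ hi.le, Finset.prod_eq_prod_Ico_succ_bot hi]
      have h1 : ∏ j ∈ Finset.range i, (if j < i then a j else if j = i then
          m 2 fun l => a (i + l) else a (j + 2 - 1)).2 = ∏ j ∈ Finset.range i, (a j).2 :=
        Finset.prod_congr rfl fun j hj => by rw [if_pos (Finset.mem_range.1 hj)]
      have h2 : ∏ j ∈ Finset.Ico (i + 1) (N + 1), (if j < i then a j else if j = i then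
          m 2 fun l => a (i + l) else a (j + 2 - 1)).2 =
          ∏ j ∈ Finset.Ico (i + 2) (N + 2), (a j).2 := by
        rw [← Finset.prod_Ico_add' _ (i + 1) (N + 1) 1]
        refine Finset.prod_congr rfl fun j hj => ?_
        rw [Finset.mem_Ico] at hj
        rw [if_neg (by omega), if_neg (by omega)]
        rfl
      rw [h1, h2, if_neg (lt_irrefl _), if_pos rfl, ← smul_mul_assoc,
        negOnePow_sum_smul_prod hs, hm, unitMul_two]
      rw [unitCoeff, unitCoeff, Finset.prod_range_succ,
        Finset.prod_eq_prod_Ico_succ_bot (show i + 1 < N + 2 by omega)]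
      simp only [Fin.val_zero, Fin.val_one, add_zero]
      ring
    exact (Finset.sum_congr rfl key).trans (by rw [← Finset.sum_smul, Finset.sum_range_sub'])
  · intro k hk hk2
    refine Finset.sum_eq_zero fun i hi => ?_
    rw [prodBar_apply, Finset.prod_eq_zero (Finset.mem_univ (⟨i, by simpa using hi⟩)), zero_smul,
      smul_zero]
    rw [if_neg (lt_irrefl _), if_pos rfl, hm, unitMul_of_ne hk2]
    rfl
  · intro h
    exact (h (Finset.mem_Icc.2 ⟨by omega, by omega⟩)).elim

theorem unitMul_compCoder (m : BarMap R (R × R) (R × R)) (n : ℕ) :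
    (unitMul R).compCoder m (n + 1) a δ =
      (unitMul R 2 ![m n fun i => a i, a n]) +
        (δ 0 + 1).negOnePow • unitMul R 2 ![a 0, m n fun i => a (1 + i)] := by
  rw [BarMap.compCoder, Finset.sum_eq_single n]
  · have e : n + 1 - n + 1 = 2 := by omega
    rw [e, Finset.sum_range_succ, Finset.sum_range_one]
    congr 1
    · rw [unitMul_two, unitMul_two]
      simp [add_comm]
    · rw [unitMul_two, unitMul_two]
      simp
  · intro k hk hkn
    rw [Finset.mem_Icc] at hk
    refine Finset.sum_eq_zero fun i _ => ?_
    rw [unitMul_of_ne (by omega), smul_zero]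
  · intro h
    obtain rfl : n = 0 := by
      rw [Finset.mem_Icc] at h
      omega
    refine Finset.sum_eq_zero fun i _ => ?_
    rw [m.comps_zero]
    rw [unitMul_of_eq rfl]
    have hi : i = 0 ∨ i = 1 := by
      have := Finset.mem_range.1 ‹_›
      omega
    rcases hi with rfl | rfl <;> simp

theorem unitId_compCoder (m : BarMap R (R × R) (R × R)) (n : ℕ) :
    (unitId R).compCoder m n a δ = ((m n fun i => a i).1, 0) := by
  obtain rfl | hn := n.eq_zero_or_pos
  · simp [BarMap.compCoder, m.comps_zero, Prod.ext_iff]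
  rw [BarMap.compCoder, Finset.sum_eq_single n]
  · have e : n - n + 1 = 1 := by omega
    rw [e, Finset.sum_range_one, unitId_one]
    simp
  · intro k hk hkn
    rw [Finset.mem_Icc] at hk
    refine Finset.sum_eq_zero fun i _ => ?_
    rw [unitId_of_ne (by omega), smul_zero]
  · intro h
    exact (h (Finset.mem_Icc.2 ⟨hn, le_rfl⟩)).elim

end Compute

/-! ### Sums of coalgebra maps -/

namespace BarMap

variable {R M N P : Type*} [CommRing R] [AddCommGroup M] [Module R M] [AddCommGroup N] [Module R N]
  [AddCommGroup P] [Module R P]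

instance : Add (BarMap R M N) :=
  ⟨fun f g => ⟨fun n => f n + g n, by rw [f.comps_zero, g.comps_zero, add_zero]⟩⟩

theorem add_apply (f g : BarMap R M N) (n : ℕ) (a : Fin n → M) : (f + g) n a = f n a + g n a := rfl

theorem HasDegree.add {ℳ : ℤ → AddSubgroup M} {𝒩 : ℤ → AddSubgroup N} {p : ℤ} {f g : BarMap R M N}
    (hf : f.HasDegree ℳ 𝒩 p) (hg : g.HasDegree ℳ 𝒩 p) : (f + g).HasDegree ℳ 𝒩 p :=
  fun n a δ ha => add_mem (hf n a δ ha) (hg n a δ ha)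

theorem add_comp (f g : BarMap R N P) (h : BarMap R M N) (n : ℕ) (a : Fin n → M) :
    (f + g).comp h n a = f.comp h n a + g.comp h n a := by
  simp only [comp_apply, add_apply, Finset.sum_add_distrib]

theorem add_compCoder (f g : BarMap R M N) (m : BarMap R M M) (n : ℕ) (a : ℕ → M) (δ : ℕ → ℤ) :
    (f + g).compCoder m n a δ = f.compCoder m n a δ + g.compCoder m n a δ := by
  simp only [compCoder, add_apply, smul_add, Finset.sum_add_distrib]

end BarMap

/-! ### Structure maps and automorphisms given by power series -/

section Structures

variable {R : Type u} [CommRing R]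

/-- The structure map of the Moore algebra with characteristic series `u`. -/
noncomputable def mooreBar (u : PowerSeries R) (hu : PowerSeries.constantCoeff u = 0) :
    BarMap R (R × R) (R × R) :=
  prodBar (fun n => (PowerSeries.coeff n u, 0)) (by simp [hu]) + unitMul R

/-- The normalized endomorphism `[y|…|y] ↦ φₙ[y]` of the tensor coalgebra. -/
noncomputable def autBar (φ : PowerSeries R) (hφ : PowerSeries.constantCoeff φ = 0) :
    BarMap R (R × R) (R × R) :=
  prodBar (fun n => (0, PowerSeries.coeff n φ)) (by simp [hφ]) + unitId R

theorem unitMul_mooreY (n : ℕ) : (unitMul R n fun _ => mooreY) = 0 := by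
  obtain rfl | hn := eq_or_ne n 2
  · simp [unitMul_two, mooreY]
  · exact unitMul_of_ne hn _

theorem unitId_mooreY (n : ℕ) : (unitId R n fun _ => mooreY) = 0 := by
  obtain rfl | hn := eq_or_ne n 1
  · rfl
  · exact unitId_of_ne hn _

/-- A coalgebra map that agrees with `e` on the words containing `1` is determined by its values on
the words `[y|…|y]`. -/
theorem barMap_apply_eq {g e : BarMap R (R × R) (R × R)}
    (hg : ∀ n (a : Fin n → R × R), (∀ i, a i = (1, 0) ∨ a i = mooreY) → (∃ i, a i = (1, 0)) →
      g n a = e n a) (he : ∀ n, (e n fun _ => mooreY) = 0) (n : ℕ) (a : Fin n → R × R) :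
    g n a = (∏ i, (a i).2) • (g n fun _ => mooreY) + e n a := by
  have h := multilinear_eq_prod_smul (g n - e n) (fun a h1 h2 => sub_eq_zero.2 (hg n a h1 h2)) a
  rw [sub_apply, sub_apply, he, sub_zero] at h
  rw [← h, sub_add_cancel]

theorem mooreBar_apply {u : PowerSeries R} {hu : PowerSeries.constantCoeff u = 0} {n : ℕ}
    (a : Fin n → R × R) : mooreBar u hu n a =
      (PowerSeries.coeff n u * ∏ i, (a i).2, 0) + unitMul R n a := by
  rw [mooreBar, BarMap.add_apply, prodBar_apply]
  simp [mul_comm]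

theorem autBar_apply {φ : PowerSeries R} {hφ : PowerSeries.constantCoeff φ = 0} {n : ℕ}
    (a : Fin n → R × R) : autBar φ hφ n a =
      (0, PowerSeries.coeff n φ * ∏ i, (a i).2) + unitId R n a := by
  rw [autBar, BarMap.add_apply, prodBar_apply]
  simp [mul_comm]

theorem unitId_snd (n : ℕ) (a : Fin n → R × R) : (unitId R n a).2 = 0 := by
  obtain rfl | hn := eq_or_ne n 1
  · rfl
  · rw [unitId_of_ne hn]
    rfl

theorem autBar_snd {φ : PowerSeries R} {hφ : PowerSeries.constantCoeff φ = 0} {n : ℕ}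
    (a : Fin n → R × R) : (autBar φ hφ n a).2 = PowerSeries.coeff n φ * ∏ i, (a i).2 := by
  rw [autBar_apply, Prod.snd_add, unitId_snd, add_zero]

theorem autBar_fst {φ : PowerSeries R} {hφ : PowerSeries.constantCoeff φ = 0} {n : ℕ}
    (a : Fin n → R × R) : (autBar φ hφ n a).1 = (unitId R n a).1 := by
  rw [autBar_apply, Prod.fst_add, zero_add]

theorem autBar_mooreY {φ : PowerSeries R} {hφ : PowerSeries.constantCoeff φ = 0} (n : ℕ) :
    (autBar φ hφ n fun _ => mooreY) = (0, PowerSeries.coeff n φ) := by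
  rw [autBar_apply, unitId_mooreY]
  simp [mooreY]

theorem autBar_isNormalized {φ : PowerSeries R} {hφ : PowerSeries.constantCoeff φ = 0} :
    (autBar φ hφ).IsNormalized (1, 0) (1, 0) := by
  refine ⟨?_, fun n hn a ha => ?_⟩
  · simp [autBar_apply, unitId_one]
  · obtain ⟨i, hi⟩ := ha
    rw [autBar_apply, unitId_of_ne (by omega),
      Finset.prod_eq_zero (Finset.mem_univ i) (by rw [hi])]
    simp

theorem isNormalized_apply_eq {f : BarMap R (R × R) (R × R)} (hf : f.IsNormalized (1, 0) (1, 0))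
    {n : ℕ} (a : Fin n → R × R) :
    f n a = (∏ i, (a i).2) • (f n fun _ => mooreY) + unitId R n a := by
  refine barMap_apply_eq (fun n a _ ha => ?_) unitId_mooreY n a
  match n with
  | 0 => exact ha.choose.elim0
  | 1 =>
    have h : a = fun _ => (1, 0) := by
      obtain ⟨i, hi⟩ := ha
      funext j
      rw [Subsingleton.elim j i, hi]
    rw [h, hf.1]
    rfl
  | n + 2 => rw [hf.2 _ (by omega) a ha, unitId_of_ne (by omega)]

theorem isNormalized_ext {f g : BarMap R (R × R) (R × R)} (hf : f.IsNormalized (1, 0) (1, 0))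
    (hg : g.IsNormalized (1, 0) (1, 0))
    (h : ∀ n, (f n fun _ => mooreY) = g n fun _ => mooreY) : f = g := by
  refine BarMap.ext (funext fun n => MultilinearMap.ext fun a => ?_)
  rw [isNormalized_apply_eq hf, isNormalized_apply_eq hg, h]

variable {𝒜 : ℤ → AddSubgroup R} {d : ℤ}

theorem negOnePow_smul_snd {a : R × R} {δ : ℤ} (hR : ∀ i, Odd i → 𝒜 i = ⊥) (hd : Even d)
    (ha : a ∈ mooreGrading 𝒜 d δ) : (δ + 1).negOnePow • a.2 = a.2 := by
  rcases mooreGrading_cases hR hd ha with ⟨_, h⟩ | ⟨h, _⟩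
  · rw [h, smul_zero]
  · rw [Int.negOnePow_even _ h.add_one, one_smul]

theorem negOnePow_smul_fst {a : R × R} {δ : ℤ} (hR : ∀ i, Odd i → 𝒜 i = ⊥) (hd : Even d)
    (ha : a ∈ mooreGrading 𝒜 d δ) : (δ + 1).negOnePow • a.1 = -a.1 := by
  rcases mooreGrading_cases hR hd ha with ⟨h, _⟩ | ⟨_, h⟩
  · rw [Int.negOnePow_odd _ h.add_one, Units.neg_smul, one_smul]
  · rw [h, smul_zero, neg_zero]

theorem mooreBar_snd {u : PowerSeries R} {hu : PowerSeries.constantCoeff u = 0} (n : ℕ)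
    (a : Fin n → R × R) : (mooreBar u hu n a).2 = (unitMul R n a).2 := by
  rw [mooreBar_apply, Prod.snd_add, zero_add]

theorem prod_fin_eq_prod_Ico (a : ℕ → R × R) (n : ℕ) :
    ∏ i : Fin n, (a (1 + i)).2 = ∏ j ∈ Finset.Ico 1 (n + 1), (a j).2 := by
  rw [Fin.prod_univ_eq_prod_range (fun i => (a (1 + i)).2) n, Finset.prod_Ico_eq_prod_range]
  rfl

/-- The relation `m ∘ m = 0`: the telescoped products with the unit inside `mₙ` cancel against the
two products of the unit with a value `mₙ[y|…|y]`. -/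
theorem mooreBar_compCoder_mooreBar {u : PowerSeries R} {hu : PowerSeries.constantCoeff u = 0}
    (hR : ∀ i, Odd i → 𝒜 i = ⊥) (hd : Even d) (n : ℕ) (a : ℕ → R × R) (δ : ℕ → ℤ)
    (ha : ∀ i, a i ∈ mooreGrading 𝒜 d (δ i)) :
    (mooreBar u hu).compCoder (mooreBar u hu) n a δ = 0 := by
  match n with
  | 0 => simp [BarMap.compCoder]
  | n + 1 =>
    have hs := fun i => negOnePow_smul_snd hR hd (ha i)
    have hf := negOnePow_smul_fst hR hd (ha 0)
    change (prodBar _ _ + unitMul R).compCoder _ _ _ _ = 0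
    rw [BarMap.add_compCoder, prodBar_compCoder _ _ _ mooreBar_snd hs, unitMul_compCoder,
      unitMul_two, unitMul_two, mooreBar_apply, mooreBar_apply, prod_fin_eq_prod_Ico,
      Fin.prod_univ_eq_prod_range (fun i => (a i).2) n]
    have h0 : (∏ j ∈ Finset.range n, (a j).2) * (a n).2 =
        (a 0).2 * ∏ j ∈ Finset.Ico 1 (n + 1), (a j).2 := by
      rw [← Finset.prod_range_succ, Finset.range_eq_Ico,
        Finset.prod_eq_prod_Ico_succ_bot (by omega)]
    have hs0 := hs 0
    simp only [unitCoeff, Finset.range_zero, Finset.prod_empty, Finset.Ico_self, one_mul, mul_one,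
      zero_add, Matrix.cons_val_zero, Matrix.cons_val_one, Prod.fst_add, Prod.snd_add]
    generalize hL : ∏ j ∈ Finset.range n, (a j).2 = L at *
    generalize ∏ j ∈ Finset.Ico 1 (n + 1), (a j).2 = L' at *
    generalize (δ 0 + 1).negOnePow = s at *
    have e1 : ∀ x : R, s • ((a 0).1 * x) = -((a 0).1 * x) := fun x => by
      rw [← smul_mul_assoc, hf, neg_mul]
    have e2 : ∀ x : R, s • ((a 0).2 * x) = (a 0).2 * x := fun x => by
      rw [← smul_mul_assoc, hs0]
    obtain rfl | hn := eq_or_ne n 2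
    · rw [unitMul_two, unitMul_two]
      refine Prod.ext ?_ ?_
      · simp only [Prod.fst_add, Prod.smul_fst, smul_eq_mul, e1, Prod.fst_zero]
        simp
        ring
      · simp only [Prod.snd_add, Prod.smul_snd, smul_eq_mul, smul_sub, e1, e2, Prod.snd_zero]
        simp
        linear_combination PowerSeries.coeff 2 u * h0
    · rw [unitMul_of_ne hn, unitMul_of_ne hn]
      refine Prod.ext ?_ ?_
      · simp only [Prod.fst_add, Prod.smul_fst, smul_eq_mul, e1, Prod.fst_zero]
        ring
      · simp only [Prod.snd_add, Prod.smul_snd, smul_eq_mul, smul_sub, e1, e2, Prod.snd_zero,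
          Prod.fst_zero]
        linear_combination PowerSeries.coeff n u * h0

variable [GradedRing 𝒜]

theorem mooreBar_hasDegree {u : PowerSeries R} {hu : PowerSeries.constantCoeff u = 0}
    (h : SeriesHasDegree 𝒜 (d + 2) (-2) u) :
    (mooreBar u hu).HasDegree (mooreGrading 𝒜 d) (mooreGrading 𝒜 d) (-1) :=
  .add (prodBar_hasDegree fun n => ⟨by
    have := h n
    rwa [show (n * (d + 2) + -2 : ℤ) = n * (d + 2) + -1 - 1 by ring] at this, zero_mem _⟩)
    unitMul_hasDegree

theorem autBar_hasDegree {φ : PowerSeries R} {hφ : PowerSeries.constantCoeff φ = 0}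
    (h : SeriesHasDegree 𝒜 (d + 2) (-(d + 2)) φ) :
    (autBar φ hφ).HasDegree (mooreGrading 𝒜 d) (mooreGrading 𝒜 d) 0 :=
  .add (prodBar_hasDegree fun n => ⟨zero_mem _, by
    have := h n
    rwa [show (n * (d + 2) + -(d + 2) : ℤ) = n * (d + 2) + 0 - 1 - (d + 1) by ring] at this⟩)
    unitId_hasDegree

end Structures

/-! ### Moore algebras and automorphisms as power series -/

section Classify

variable {R : Type u} [CommRing R]

/-- The sum over all `n = i₁ + ⋯ + iₖ` defining `unitMul ∘ f` on `a₀ ⋯ aₙ` involves only the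
compositions `1 + n` and `n + 1`. -/
theorem unitMul_comp_autBar {φ : PowerSeries R} {hφ : PowerSeries.constantCoeff φ = 0} (n : ℕ)
    (a : ℕ → R × R) : (unitMul R).comp (autBar φ hφ) (n + 1) (fun i => a i) =
      ((unitMul R (n + 1) fun i => a i).1,
        (unitCoeff (n + 1) a 0 - unitCoeff (n + 1) a n) * PowerSeries.coeff n φ) := by
  have key : ∀ (p q : ℕ) (hpq : p + q = n + 1) (c : Composition (n + 1)), c.blocks = [p, q] →
      (unitMul R c.length fun i => autBar φ hφ (c.blocksFun i) fun j => a (c.embedding i j)) =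
        unitMul R 2 ![autBar φ hφ p fun j => a j, autBar φ hφ q fun j => a (p + j)] := by
    rintro p q hpq ⟨_, h1, h2⟩ rfl
    refine (unitMul R).congr rfl fun i hi1 hi2 => ?_
    have hi3 : i < 2 := hi1
    have hi : i = 0 ∨ i = 1 := by omega
    rcases hi with rfl | rfl
    · refine (autBar φ hφ).congr rfl fun j hj1 hj2 => congrArg a ?_
      rw [Composition.coe_embedding]
      simp
    · refine (autBar φ hφ).congr rfl fun j hj1 hj2 => congrArg a ?_
      rw [Composition.coe_embedding]
      simp [Composition.sizeUpTo]
  have hvanish : ∀ c : Composition (n + 1), c.blocks ≠ [1, n] → c.blocks ≠ [n, 1] →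
      (unitMul R c.length fun i =>
        autBar φ hφ (c.blocksFun i) fun j => a (c.embedding i j)) = 0 := by
    intro c h1 h2
    by_cases hc : c.length = 2
    · obtain ⟨p, q, hpq⟩ := List.length_eq_two.1 hc
      have hs : p + q = n + 1 := by
        have := c.blocks_sum
        rw [hpq] at this
        simpa using this
      have hp : p ≠ 1 := by
        rintro rfl
        obtain rfl : q = n := by omega
        exact h1 hpq
      have hq : q ≠ 1 := by
        rintro rfl
        obtain rfl : p = n := by omega
        exact h2 hpq
      rw [key p q hs c hpq, unitMul_two]
      simp [autBar_fst, unitId_of_ne hp, unitId_of_ne hq]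
    · rw [unitMul_of_ne hc]
  rw [BarMap.comp_apply]
  obtain rfl | hn := n.eq_zero_or_pos
  · rw [Finset.sum_eq_zero, sub_self, zero_mul, unitMul_of_ne (by norm_num)]
    · rfl
    · intro c _
      have := c.length_le
      exact unitMul_of_ne (by omega) _
  have hprod : ∏ i : Fin n, (a (1 + i)).2 = ∏ j ∈ Finset.Ico 1 (n + 1), (a j).2 :=
    prod_fin_eq_prod_Ico a n
  let c₁ : Composition (n + 1) := ⟨[1, n], by simp [hn], by simp [add_comm]⟩
  let c₂ : Composition (n + 1) := ⟨[n, 1], by simp [hn], by simp⟩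
  obtain rfl | hn1 := eq_or_ne n 1
  · rw [Fintype.sum_eq_single c₁, key 1 1 rfl c₁ rfl, unitMul_two, unitMul_two]
    · simp [autBar_fst, autBar_snd, unitId_one, unitCoeff]
      ring
    · intro c hc
      have h : c.blocks ≠ [1, 1] := fun h => hc (Composition.ext h)
      exact hvanish c h h
  · rw [Fintype.sum_eq_add c₁ c₂, key 1 n (by omega) c₁ rfl, key n 1 rfl c₂ rfl, unitMul_two,
      unitMul_two, unitMul_of_ne (by omega)]
    · simp [autBar_fst, autBar_snd, unitId_one, unitCoeff, unitId_of_ne hn1, hprod,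
        Fin.prod_univ_eq_prod_range (fun i => (a i).2) n]
      ring
    · intro h
      have := congrArg Composition.blocks h
      simp [c₁, c₂] at this
      omega
    · rintro c ⟨h1, h2⟩
      exact hvanish c (fun h => h1 (Composition.ext h)) fun h => h2 (Composition.ext h)

theorem prodBar_comp_autBar {φ u : PowerSeries R} {hφ : PowerSeries.constantCoeff φ = 0} (x : R × R)
    (hc : PowerSeries.coeff 0 u • x = 0) (n : ℕ) (a : Fin n → R × R) :
    (prodBar (fun n => PowerSeries.coeff n u • x) hc).comp (autBar φ hφ) n a =
      (PowerSeries.coeff n (u.subst φ) * ∏ i, (a i).2) • x := by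
  rw [BarMap.comp_apply, coeff_subst_eq_sum_composition u hφ, Finset.sum_mul, Finset.sum_smul]
  refine Finset.sum_congr rfl fun c _ => ?_
  rw [prodBar_apply, smul_smul]
  congr 1
  simp only [autBar_snd, Finset.prod_mul_distrib]
  have : ∏ i, ∏ j, (a (c.embedding i j)).2 = ∏ i, (a i).2 := by
    rw [← c.blocksFinEquiv.prod_comp, Fintype.prod_sigma]
    rfl
  rw [this]
  ring

/-- The left-hand side of the morphism equation `m ∘ f = f ∘ m`. On `[y|…|y]` it is `u(φ(t))`; on
words containing `1` it does not depend on `u`. -/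
theorem mooreBar_comp_autBar {φ u : PowerSeries R} {hφ : PowerSeries.constantCoeff φ = 0}
    {hu : PowerSeries.constantCoeff u = 0} (n : ℕ) (a : ℕ → R × R) :
    (mooreBar u hu).comp (autBar φ hφ) (n + 1) (fun i => a i) =
      (PowerSeries.coeff (n + 1) (u.subst φ) * ∏ i : Fin (n + 1), (a i).2 +
        (unitMul R (n + 1) fun i => a i).1,
        (unitCoeff (n + 1) a 0 - unitCoeff (n + 1) a n) * PowerSeries.coeff n φ) := by
  have h : mooreBar u hu = prodBar (fun n => PowerSeries.coeff n u • (1, 0)) (by simp [hu]) +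
      unitMul R := by
    refine BarMap.ext (funext fun n => MultilinearMap.ext fun a => ?_)
    rw [mooreBar_apply, BarMap.add_apply, prodBar_apply]
    simp [mul_comm]
  rw [h, BarMap.add_comp, unitMul_comp_autBar, prodBar_comp_autBar]
  simp

theorem autBar_mul {φ ψ : PowerSeries R} {hφ : PowerSeries.constantCoeff φ = 0}
    {hψ : PowerSeries.constantCoeff ψ = 0} :
    autBar φ hφ * autBar ψ hψ = autBar (φ.subst ψ) (constantCoeff_subst' hφ hψ) := by
  refine isNormalized_ext (autBar_isNormalized.mul autBar_isNormalized) autBar_isNormalized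
    fun n => ?_
  rw [autBar_mooreY]
  have h : autBar φ hφ = prodBar (fun n => PowerSeries.coeff n φ • (0, 1)) (by simp [hφ]) +
      unitId R := by
    refine BarMap.ext (funext fun n => MultilinearMap.ext fun a => ?_)
    rw [autBar_apply, BarMap.add_apply, prodBar_apply]
    simp [mul_comm]
  change (autBar φ hφ).comp (autBar ψ hψ) n _ = _
  rw [h, BarMap.add_comp, prodBar_comp_autBar, BarMap.comp_apply, Finset.sum_eq_zero]
  · simp [mooreY]
  · intro c _
    by_cases hc : c.length = 1
    · rw [unitId_of_eq hc]
      rw [autBar_mooreY]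
      rfl
    · rw [unitId_of_ne hc]

theorem autBar_X : autBar (PowerSeries.X : PowerSeries R) (by simp) = 1 := by
  refine isNormalized_ext autBar_isNormalized ⟨rfl, fun _ hn a _ => BarMap.id_of_one_lt hn a⟩
    fun n => ?_
  rw [autBar_mooreY, PowerSeries.coeff_X]
  split_ifs with hn
  · subst hn
    rfl
  · match n, hn with
    | 0, _ => rfl
    | n + 2, _ => rfl

variable {𝒜 : ℤ → AddSubgroup R} {d : ℤ}

/-- The right-hand side of the morphism equation `m ∘ f = f ∘ m`. It differs from the left-hand side
only in that `u(φ(t))` is replaced by the series of the source. -/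
theorem autBar_compCoder_mooreBar {φ : PowerSeries R} {hφ : PowerSeries.constantCoeff φ = 0}
    (hR : ∀ i, Odd i → 𝒜 i = ⊥) (hd : Even d) {u : PowerSeries R}
    {hu : PowerSeries.constantCoeff u = 0} (n : ℕ) (a : ℕ → R × R) (δ : ℕ → ℤ)
    (ha : ∀ i, a i ∈ mooreGrading 𝒜 d (δ i)) :
    (autBar φ hφ).compCoder (mooreBar u hu) (n + 1) a δ =
      (PowerSeries.coeff (n + 1) u * ∏ i : Fin (n + 1), (a i).2 +
        (unitMul R (n + 1) fun i => a i).1,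
        (unitCoeff (n + 1) a 0 - unitCoeff (n + 1) a n) * PowerSeries.coeff n φ) := by
  change (prodBar _ _ + unitId R).compCoder _ _ _ _ = _
  rw [BarMap.add_compCoder,
    prodBar_compCoder _ _ _ mooreBar_snd fun i => negOnePow_smul_snd hR hd (ha i),
    unitId_compCoder, mooreBar_apply]
  simp

variable [GradedRing 𝒜]

theorem moore_m_mooreY (hR : ∀ i, Odd i → 𝒜 i = ⊥) (hd : Even d) (A : MooreAlgebra 𝒜 d) (n : ℕ) :
    A.1.m n (fun _ => mooreY) = (PowerSeries.coeff n (charSeries A).1, 0) := by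
  refine Prod.ext ?_ ?_
  · simp [charSeries]
  · have h := A.1.degree n (fun _ => mooreY) (fun _ => d + 1) fun _ => mooreY_mem
    have e : (∑ _i : Fin n, (d + 1 + 1) + -1 - 1 : ℤ) = n * (d + 2) - 2 := by
      simp only [Finset.sum_const, Finset.card_univ, Fintype.card_fin, nsmul_eq_mul]
      ring
    rw [e] at h
    have he : Even ((n : ℤ) * (d + 2) - 2) :=
      ((hd.add even_two).mul_left _).sub even_two
    rcases mooreGrading_cases hR hd h with ⟨_, h⟩ | ⟨h, _⟩
    · exact h
    · exact (Int.not_even_iff_odd.2 h he).elim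

theorem moore_m_eq (hR : ∀ i, Odd i → 𝒜 i = ⊥) (hd : Even d) (A : MooreAlgebra 𝒜 d) :
    A.1.m = mooreBar (charSeries A).1 (charSeries A).2.1 := by
  refine BarMap.ext (funext fun n => MultilinearMap.ext fun a => ?_)
  rw [mooreBar_apply, barMap_apply_eq (e := unitMul R) ?_ unitMul_mooreY, moore_m_mooreY hR hd]
  · simp [mul_comm]
  · intro n a h1 h2
    obtain rfl | hn := eq_or_ne n 2
    · have ha : a = ![a 0, a 1] := by
        ext i <;> fin_cases i <;> rfl
      have hl : ∀ x, A.1.m 2 ![(1, 0), x] = x := fun x => by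
        have := A.1.one_left x
        rwa [A.2] at this
      have hr : A.1.m 2 ![mooreY, (1, 0)] = -mooreY := by
        have := A.1.one_right _ _ mooreY_mem
        rw [A.2, Int.negOnePow_odd _ hd.add_one, Units.neg_smul, one_smul] at this
        rw [← this, neg_neg, this]
      rw [ha, unitMul_two]
      rcases h1 0 with h | h
      · rw [h, hl]
        simp
      · rcases h1 1 with h' | h'
        · rw [h, h', hr]
          simp [mooreY]
        · -- the letter `1` can only occur here if `1 = y`, that is, over the zero ring
          have h3 : (mooreY : R × R) = (1, 0) := by
            obtain ⟨i, hi⟩ := h2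
            fin_cases i
            · exact h.symm.trans hi
            · exact h'.symm.trans hi
          rw [h, h', h3, hl]
          simp
    · rw [unitMul_of_ne hn]
      refine A.1.map_one n hn a ?_
      rw [A.2]
      exact h2

theorem charSeries_injective (hR : ∀ i, Odd i → 𝒜 i = ⊥) (hd : Even d) :
    Function.Injective (charSeries : MooreAlgebra 𝒜 d → _) := by
  intro A B h
  refine Subtype.ext (UnitalAInf.ext ?_ (A.2.trans B.2.symm))
  rw [moore_m_eq hR hd, moore_m_eq hR hd]
  simp only [h]

/-- The Moore algebra with a given characteristic series. -/
noncomputable def mooreOfSeries (hR : ∀ i, Odd i → 𝒜 i = ⊥) (hd : Even d) (u : CharSeries 𝒜 d) :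
    MooreAlgebra 𝒜 d :=
  ⟨{  m := mooreBar u.1 u.2.1
      degree := mooreBar_hasDegree u.2.2
      sq_zero := mooreBar_compCoder_mooreBar hR hd
      one := (1, 0)
      one_mem := ⟨SetLike.GradedOne.one_mem (A := 𝒜), zero_mem _⟩
      one_left := fun a => by
        rw [mooreBar_apply, unitMul_two]
        simp
      one_right := fun j a ha => by
        rw [mooreBar_apply, unitMul_two]
        rcases mooreGrading_cases hR hd ha with ⟨hj, h⟩ | ⟨hj, h⟩
        · rw [Int.negOnePow_even _ hj, one_smul]
          refine Prod.ext ?_ ?_ <;> simp [h]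
        · rw [Int.negOnePow_odd _ hj]
          refine Prod.ext ?_ ?_ <;> simp [h]
      map_one := fun n hn a ⟨i, hi⟩ => by
        rw [mooreBar_apply, unitMul_of_ne hn,
          Finset.prod_eq_zero (Finset.mem_univ i) (by rw [hi])]
        simp }, rfl⟩

theorem charSeries_mooreOfSeries (hR : ∀ i, Odd i → 𝒜 i = ⊥) (hd : Even d) (u : CharSeries 𝒜 d) :
    charSeries (mooreOfSeries hR hd u) = u := by
  refine Subtype.ext (PowerSeries.ext fun n => ?_)
  simp [charSeries, mooreOfSeries, mooreBar_apply, unitMul_mooreY]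
  simp [mooreY]

theorem charSeries_bijective (hR : ∀ i, Odd i → 𝒜 i = ⊥) (hd : Even d) :
    Function.Bijective (charSeries : MooreAlgebra 𝒜 d → _) :=
  ⟨charSeries_injective hR hd, fun u => ⟨_, charSeries_mooreOfSeries hR hd u⟩⟩

/-- The coalgebra endomorphism with a given power series, as a homomorphism of monoids. -/
noncomputable def seriesToEnd : SeriesGroup 𝒜 d →* BarMap.degreeZeroEnd R (mooreGrading 𝒜 d) where
  toFun φ := ⟨autBar φ.1 φ.2.1, autBar_hasDegree φ.2.2.2⟩
  map_one' := Subtype.ext autBar_X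
  map_mul' φ ψ := Subtype.ext (autBar_mul (hφ := φ.2.1) (hψ := ψ.2.1)).symm

/-- The automorphism of the tensor coalgebra with a given power series, as an element of the group
of normalized automorphisms. -/
noncomputable def seriesToAut :
    SeriesGroup 𝒜 d →* BarMap.normalizedAut R (mooreGrading 𝒜 d) (1, 0) :=
  (seriesToEnd.toHomUnits).codRestrict _ fun φ =>
    show (seriesToEnd φ).1.IsNormalized (1, 0) (1, 0) from autBar_isNormalized (hφ := φ.2.1)

theorem seriesToAut_val (φ : SeriesGroup 𝒜 d) :
    (seriesToAut φ).1.val.val = autBar φ.1 φ.2.1 := rfl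

theorem seriesToAut_injective :
    Function.Injective (seriesToAut : SeriesGroup 𝒜 d →* _) := by
  intro φ ψ h
  have h1 : autBar φ.1 φ.2.1 = autBar ψ.1 ψ.2.1 := by
    rw [← seriesToAut_val, h, seriesToAut_val]
  refine Subtype.ext (PowerSeries.ext fun n => ?_)
  have h2 := autBar_mooreY (hφ := φ.2.1) n
  rw [h1, autBar_mooreY] at h2
  exact (congrArg Prod.snd h2).symm

/-- For degree reasons, `fₙ[y|…|y]` is a multiple of `[y]`: it has odd degree. -/
theorem degreeZero_mooreY (hR : ∀ i, Odd i → 𝒜 i = ⊥) (hd : Even d) {f : BarMap R (R × R) (R × R)}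
    (hf : f.HasDegree (mooreGrading 𝒜 d) (mooreGrading 𝒜 d) 0) (n : ℕ) :
    (f n fun _ => mooreY).1 = 0 ∧ (f n fun _ => mooreY).2 ∈ 𝒜 (n * (d + 2) + -(d + 2)) := by
  have h := hf n (fun _ => mooreY) (fun _ => d + 1) fun _ => mooreY_mem
  have e : (∑ _i : Fin n, (d + 1 + 1) + 0 - 1 : ℤ) = n * (d + 2) - 1 := by
    simp only [Finset.sum_const, Finset.card_univ, Fintype.card_fin, nsmul_eq_mul]
    ring
  rw [e] at h
  have he : Odd ((n : ℤ) * (d + 2) - 1) := ((hd.add even_two).mul_left _).sub_odd odd_one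
  refine ⟨?_, ?_⟩
  · rcases mooreGrading_cases hR hd h with ⟨h, _⟩ | ⟨_, h⟩
    · exact (Int.not_even_iff_odd.2 he h).elim
    · exact h
  · have := h.2
    rwa [show (n * (d + 2) - 1 - (d + 1) : ℤ) = n * (d + 2) + -(d + 2) by ring] at this

theorem seriesToAut_surjective (hR : ∀ i, Odd i → 𝒜 i = ⊥) (hd : Even d) :
    Function.Surjective (seriesToAut : SeriesGroup 𝒜 d →* _) := by
  intro f
  have hy := degreeZero_mooreY hR hd f.1.val.2
  have hy' := degreeZero_mooreY hR hd f.1.inv.2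
  have h1 : ∀ r : R, (f.1.val.val 1 fun _ => ((0, r) : R × R)).2 =
      r * (f.1.val.val 1 fun _ => mooreY).2 := fun r => by
    rw [isNormalized_apply_eq f.2, Prod.snd_add, unitId_snd]
    simp
  let φ : PowerSeries R := PowerSeries.mk fun n => (f.1.val.val n fun _ => mooreY).2
  have hφ0 : PowerSeries.constantCoeff φ = 0 := by
    simp [φ, f.1.val.val.comps_zero]
  have hφ1 : IsUnit (PowerSeries.coeff 1 φ) := by
    have h2 := BarMap.mul_one_apply f.1.val.val f.1.inv.val mooreY
    rw [show f.1.val.val * f.1.inv.val = 1 from congrArg Subtype.val f.1.mul_inv] at h2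
    have h3 : (f.1.inv.val 1 fun _ => mooreY) = (0, (f.1.inv.val 1 fun _ => mooreY).2) :=
      Prod.ext (hy' 1).1 rfl
    rw [h3] at h2
    have h4 := congrArg Prod.snd h2
    rw [h1] at h4
    have h5 : (1 : R) = (f.1.inv.val 1 fun _ => mooreY).2 * (f.1.val.val 1 fun _ => mooreY).2 := h4
    refine IsUnit.of_mul_eq_one (f.1.inv.val 1 fun _ => mooreY).2 ?_
    rw [PowerSeries.coeff_mk, mul_comm]
    exact h5.symm
  have hφd : SeriesHasDegree 𝒜 (d + 2) (-(d + 2)) φ := fun n => by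
    rw [PowerSeries.coeff_mk]
    exact (hy n).2
  let ψ : SeriesGroup 𝒜 d := ⟨φ, hφ0, hφ1, hφd⟩
  have hf : autBar φ hφ0 = f.1.val.val := by
    refine isNormalized_ext autBar_isNormalized f.2 fun n => ?_
    rw [autBar_mooreY]
    refine Prod.ext (hy n).1.symm ?_
    simp [φ]
  exact ⟨ψ, Subtype.ext (Units.ext (Subtype.ext ((seriesToAut_val ψ).trans hf)))⟩

/-- The group of normalized automorphisms is the group of power series under composition. -/
noncomputable def autEquivSeries (hR : ∀ i, Odd i → 𝒜 i = ⊥) (hd : Even d) :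
    BarMap.normalizedAut R (mooreGrading 𝒜 d) (1, 0) ≃* SeriesGroup 𝒜 d :=
  (MulEquiv.ofBijective seriesToAut
    ⟨seriesToAut_injective, seriesToAut_surjective hR hd⟩).symm

theorem val_eq_autBar (hR : ∀ i, Odd i → 𝒜 i = ⊥) (hd : Even d)
    (f : BarMap.normalizedAut R (mooreGrading 𝒜 d) (1, 0)) :
    f.1.val.val = autBar (autEquivSeries hR hd f).1 (autEquivSeries hR hd f).2.1 := by
  rw [← seriesToAut_val]
  have h : seriesToAut (autEquivSeries hR hd f) = f :=
    (autEquivSeries hR hd).symm_apply_apply f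
  rw [h]

/-- Both sides of the equation for an `A_∞`-morphism agree on the words containing `1`, so the
equation amounts to its values on the words `[y|…|y]`. -/
theorem autBar_isAInfMorphism_iff (hR : ∀ i, Odd i → 𝒜 i = ⊥) (hd : Even d) (φ : SeriesGroup 𝒜 d)
    (A B : MooreAlgebra 𝒜 d) : IsAInfMorphism B.1 A.1 (autBar φ.1 φ.2.1) ↔
      charSeries B = MulOpposite.op φ • charSeries A := by
  have h1 : charSeries B = MulOpposite.op φ • charSeries A ↔
      (charSeries B).1 = (charSeries A).1.subst φ.1 := Subtype.ext_iff
  rw [h1]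
  constructor
  · intro h
    ext n
    match n with
    | 0 =>
      rw [PowerSeries.coeff_zero_eq_constantCoeff_apply,
        PowerSeries.coeff_zero_eq_constantCoeff_apply, (charSeries B).2.1,
        constantCoeff_subst' (charSeries A).2.1 φ.2.1]
    | n + 1 =>
      have h2 := h.comm (n + 1) (fun _ => mooreY) (fun _ => d + 1) fun _ => mooreY_mem
      rw [moore_m_eq hR hd, moore_m_eq hR hd, mooreBar_comp_autBar n fun _ => mooreY,
        autBar_compCoder_mooreBar hR hd n _ _ fun _ => mooreY_mem] at h2
      have h3 := congrArg Prod.fst h2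
      simp only [unitMul_mooreY] at h3
      simpa [mooreY] using h3.symm
  · intro h
    refine ⟨autBar_hasDegree φ.2.2.2, fun n a δ ha => ?_, ?_⟩
    · match n with
      | 0 => simp [BarMap.compCoder, BarMap.comps_zero]
      | n + 1 =>
        rw [moore_m_eq hR hd, moore_m_eq hR hd, mooreBar_comp_autBar,
          autBar_compCoder_mooreBar hR hd n _ _ ha, h]
    · rw [A.2, B.2]
      exact autBar_isNormalized

end Classify

/-! ### Sums over words with a marked letter -/

section Tri

variable {α G : Type*} [AddCommGroup G]

theorem splitSum_add (l : List α) (F F' : List α → List α → G) :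
    splitSum l (fun p q => F p q + F' p q) = splitSum l F + splitSum l F' := by
  simp only [splitSum_eq_sum_range, Finset.sum_add_distrib]

theorem splitSum_neg (l : List α) (F : List α → List α → G) :
    splitSum l (fun p q => -F p q) = -splitSum l F := by
  simp only [splitSum_eq_sum_range, Finset.sum_neg_distrib]

/-- The sum of `F p j r` over all words `p`, `r` in positive integers and all `j ≥ 0` of total
weight `n`. -/
def triSum (n : ℕ) (F : List ℕ → ℕ → List ℕ → G) : G :=
  ∑ x ∈ Finset.HasAntidiagonal.antidiagonal n, ∑ p ∈ compWords x.1,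
    ∑ y ∈ Finset.HasAntidiagonal.antidiagonal x.2, ∑ r ∈ compWords y.2, F p y.1 r

theorem triSum_congr {n : ℕ} {F F' : List ℕ → ℕ → List ℕ → G}
    (h : ∀ p j r, p.sum + j + r.sum = n → F p j r = F' p j r) : triSum n F = triSum n F' := by
  refine Finset.sum_congr rfl fun x hx => Finset.sum_congr rfl fun p hp =>
    Finset.sum_congr rfl fun y hy => Finset.sum_congr rfl fun r hr => h p y.1 r ?_
  rw [Finset.HasAntidiagonal.mem_antidiagonal] at hx hy
  rw [(mem_compWords.1 hp).2, (mem_compWords.1 hr).2]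
  omega

theorem triSum_add (n : ℕ) (F F' : List ℕ → ℕ → List ℕ → G) :
    triSum n (fun p j r => F p j r + F' p j r) = triSum n F + triSum n F' := by
  simp only [triSum, Finset.sum_add_distrib]

theorem triSum_sub (n : ℕ) (F F' : List ℕ → ℕ → List ℕ → G) :
    triSum n (fun p j r => F p j r - F' p j r) = triSum n F - triSum n F' := by
  simp only [triSum, Finset.sum_sub_distrib]

theorem triSum_zero (n : ℕ) : triSum n (fun _ _ _ => (0 : G)) = 0 := by
  simp [triSum]

theorem triSum_eq_single {n : ℕ} {F : List ℕ → ℕ → List ℕ → G}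
    (h : ∀ p j r, p ≠ [] ∨ r ≠ [] → F p j r = 0) : triSum n F = F [] n [] := by
  rw [triSum, Finset.sum_eq_single (0, n)]
  · rw [compWords_zero, Finset.sum_singleton, Finset.sum_eq_single (n, 0)]
    · rw [compWords_zero, Finset.sum_singleton]
    · intro y hy hne
      refine Finset.sum_eq_zero fun r hr => h _ _ _ (Or.inr ?_)
      rintro rfl
      rw [Finset.HasAntidiagonal.mem_antidiagonal] at hy
      have := nil_mem_compWords.1 hr
      exact hne (Prod.ext (by simp only at hy ⊢; omega) this)
    · intro h
      simp at h
  · intro x hx hne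
    refine Finset.sum_eq_zero fun p hp => Finset.sum_eq_zero fun y _ =>
      Finset.sum_eq_zero fun r _ => h _ _ _ (Or.inl ?_)
    rintro rfl
    rw [Finset.HasAntidiagonal.mem_antidiagonal] at hx
    have := nil_mem_compWords.1 hp
    exact hne (Prod.ext this (by simp only; omega))
  · intro h
    simp at h

/-- Only the term with `j = n`, and hence with empty outer words, survives. -/
theorem triSum_of_lt {n : ℕ} {F : List ℕ → ℕ → List ℕ → G}
    (h : ∀ p j r, j < n → F p j r = 0) : triSum n F = F [] n [] := by
  have h1 : triSum n F = triSum n fun p j r => if p = [] ∧ r = [] then F p j r else 0 := by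
    rw [triSum, triSum]
    refine Finset.sum_congr rfl fun x hx => Finset.sum_congr rfl fun p hp =>
      Finset.sum_congr rfl fun y hy => Finset.sum_congr rfl fun r hr => ?_
    rw [Finset.HasAntidiagonal.mem_antidiagonal] at hx hy
    split_ifs with hpr
    · rfl
    · refine h _ _ _ ?_
      by_contra hn
      have hx1 : x.1 = 0 := by omega
      have hy2 : y.2 = 0 := by omega
      rw [hx1, compWords_zero, Finset.mem_singleton] at hp
      rw [hy2, compWords_zero, Finset.mem_singleton] at hr
      exact hpr ⟨hp, hr⟩
  rw [h1, triSum_eq_single]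
  · simp
  · intro p j r hpr
    rw [if_neg]
    tauto

/-- If `F p j r` vanishes as soon as all letters of `p` are less than `n`, only `p = [n]`
survives. -/
theorem triSum_eq_of_left {n : ℕ} {F : List ℕ → ℕ → List ℕ → G}
    (hn : 0 < n) (h : ∀ p ∈ compWords n, p ≠ [n] → F p 0 [] = 0)
    (h' : ∀ p j r, (∀ i ∈ p, i < n) → F p j r = 0) : triSum n F = F [n] 0 [] := by
  have hmem : [n] ∈ compWords n := by simp [mem_compWords, hn]
  rw [triSum, Finset.sum_eq_single (n, 0)]
  · simp only [Finset.Nat.antidiagonal_zero, Finset.sum_singleton, compWords_zero]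
    exact Finset.sum_eq_single _ (fun p hp hne => h p hp hne) fun h => (h hmem).elim
  · intro x hx hne
    rw [Finset.HasAntidiagonal.mem_antidiagonal] at hx
    have hlt : x.1 < n := by
      by_contra hlt
      exact hne (Prod.ext (by simp only; omega) (by simp only; omega))
    refine Finset.sum_eq_zero fun p hp => Finset.sum_eq_zero fun y _ =>
      Finset.sum_eq_zero fun r _ => h' _ _ _ fun i hi => ?_
    have := List.le_sum_of_mem hi
    rw [(mem_compWords.1 hp).2] at this
    omega
  · intro h
    simp at h

theorem sum_rotate {α β γ : Type*} (s : Finset α) (t : Finset β) (v : Finset γ)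
    (f : α → β → γ → G) :
    ∑ a ∈ s, ∑ b ∈ t, ∑ c ∈ v, f a b c = ∑ b ∈ t, ∑ c ∈ v, ∑ a ∈ s, f a b c := by
  rw [Finset.sum_comm]
  exact Finset.sum_congr rfl fun b _ => Finset.sum_comm

/-- Regrouping of the five summands of `n`. -/
theorem sum_antidiagonal_regroup (n : ℕ) (g : ℕ → ℕ → ℕ → ℕ → ℕ → G) :
    ∑ x ∈ Finset.HasAntidiagonal.antidiagonal n,
      ∑ y ∈ Finset.HasAntidiagonal.antidiagonal x.2,
        ∑ z ∈ Finset.HasAntidiagonal.antidiagonal x.1,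
          ∑ w ∈ Finset.HasAntidiagonal.antidiagonal y.2, g z.1 z.2 y.1 w.1 w.2 =
    ∑ x ∈ Finset.HasAntidiagonal.antidiagonal n,
      ∑ y ∈ Finset.HasAntidiagonal.antidiagonal x.2,
        ∑ z ∈ Finset.HasAntidiagonal.antidiagonal y.1,
          ∑ w ∈ Finset.HasAntidiagonal.antidiagonal z.2, g x.1 z.1 w.1 w.2 y.2 := by
  simp only [Finset.sum_sigma']
  refine Finset.sum_bij'
    (fun t _ => ⟨(t.2.2.1.1, t.2.2.1.2 + t.2.1.1 + t.2.2.2.1 + t.2.2.2.2),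
      (t.2.2.1.2 + t.2.1.1 + t.2.2.2.1, t.2.2.2.2), (t.2.2.1.2, t.2.1.1 + t.2.2.2.1),
      (t.2.1.1, t.2.2.2.1)⟩)
    (fun t _ => ⟨(t.1.1 + t.2.2.1.1, t.2.2.2.1 + t.2.2.2.2 + t.2.1.2),
      (t.2.2.2.1, t.2.2.2.2 + t.2.1.2), (t.1.1, t.2.2.1.1), (t.2.2.2.2, t.2.1.2)⟩) ?_ ?_ ?_ ?_ ?_
  · rintro ⟨⟨x1, x2⟩, ⟨y1, y2⟩, ⟨z1, z2⟩, ⟨w1, w2⟩⟩ h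
    simp only [Finset.mem_sigma, Finset.HasAntidiagonal.mem_antidiagonal] at h ⊢
    obtain ⟨h1, h2, h3, h4⟩ := h
    refine ⟨?_, ?_, ?_, ?_⟩ <;> first | trivial | omega
  · rintro ⟨⟨x1, x2⟩, ⟨y1, y2⟩, ⟨z1, z2⟩, ⟨w1, w2⟩⟩ h
    simp only [Finset.mem_sigma, Finset.HasAntidiagonal.mem_antidiagonal] at h ⊢
    obtain ⟨h1, h2, h3, h4⟩ := h
    refine ⟨?_, ?_, ?_, ?_⟩ <;> first | trivial | omega
  · rintro ⟨⟨x1, x2⟩, ⟨y1, y2⟩, ⟨z1, z2⟩, ⟨w1, w2⟩⟩ h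
    simp only [Finset.mem_sigma, Finset.HasAntidiagonal.mem_antidiagonal] at h
    obtain ⟨h1, h2, h3, h4⟩ := h
    subst h3 h4 h2
    simp only [add_assoc]
  · rintro ⟨⟨x1, x2⟩, ⟨y1, y2⟩, ⟨z1, z2⟩, ⟨w1, w2⟩⟩ h
    simp only [Finset.mem_sigma, Finset.HasAntidiagonal.mem_antidiagonal] at h
    obtain ⟨h1, h2, h3, h4⟩ := h
    subst h4 h3 h2
    simp only [add_assoc]
  · rintro ⟨⟨x1, x2⟩, ⟨y1, y2⟩, ⟨z1, z2⟩, ⟨w1, w2⟩⟩ h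
    rfl

/-- If both outer words of a triple sum are cut, the two inner pieces form a triple sum together
with the middle index. -/
theorem triSum_splitSum_splitSum (n : ℕ) (F : List ℕ → List ℕ → ℕ → List ℕ → List ℕ → G) :
    triSum n (fun u j v => splitSum u fun p q => splitSum v fun r s => F p q j r s) =
      triSum n fun p i s => triSum i fun q j r => F p q j r s := by
  have h1 : triSum n (fun u j v => splitSum u fun p q => splitSum v fun r s => F p q j r s) =
      ∑ x ∈ Finset.HasAntidiagonal.antidiagonal n,
        ∑ y ∈ Finset.HasAntidiagonal.antidiagonal x.2,
        ∑ z ∈ Finset.HasAntidiagonal.antidiagonal x.1,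
          ∑ w ∈ Finset.HasAntidiagonal.antidiagonal y.2,
          ∑ p ∈ compWords z.1, ∑ q ∈ compWords z.2, ∑ r ∈ compWords w.1, ∑ s ∈ compWords w.2,
            F p q y.1 r s := by
    rw [triSum]
    refine Finset.sum_congr rfl fun x _ => ?_
    rw [Finset.sum_comm]
    refine Finset.sum_congr rfl fun y _ => ?_
    have h2 : ∀ u ∈ compWords x.1, ∑ v ∈ compWords y.2, splitSum u (fun p q =>
        splitSum v fun r s => F p q y.1 r s) = splitSum u fun p q =>
          ∑ w ∈ Finset.HasAntidiagonal.antidiagonal y.2,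
            ∑ r ∈ compWords w.1, ∑ s ∈ compWords w.2, F p q y.1 r s := by
      intro u _
      simp only [← sum_compWords_split]
      simp only [splitSum_eq_sum_range]
      exact Finset.sum_comm
    rw [Finset.sum_congr rfl h2, sum_compWords_split]
    refine Finset.sum_congr rfl fun z _ => ?_
    have h3 : ∀ p ∈ compWords z.1, ∑ q ∈ compWords z.2,
        ∑ w ∈ Finset.HasAntidiagonal.antidiagonal y.2,
          ∑ r ∈ compWords w.1, ∑ s ∈ compWords w.2, F p q y.1 r s =
        ∑ w ∈ Finset.HasAntidiagonal.antidiagonal y.2, ∑ q ∈ compWords z.2,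
          ∑ r ∈ compWords w.1, ∑ s ∈ compWords w.2, F p q y.1 r s :=
      fun p _ => Finset.sum_comm
    rw [Finset.sum_congr rfl h3, Finset.sum_comm]
  rw [h1, sum_antidiagonal_regroup n fun i1 i2 j k1 k2 => ∑ p ∈ compWords i1,
    ∑ q ∈ compWords i2, ∑ r ∈ compWords k1, ∑ s ∈ compWords k2, F p q j r s]
  simp only [triSum]
  refine Finset.sum_congr rfl fun x _ => ?_
  rw [Finset.sum_comm]
  refine Finset.sum_congr rfl fun y _ => ?_
  have h4 : ∀ z w : ℕ × ℕ, ∑ p ∈ compWords x.1, ∑ q ∈ compWords z.1,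
      ∑ r ∈ compWords w.2, ∑ s ∈ compWords y.2, F p q w.1 r s =
      ∑ p ∈ compWords x.1, ∑ s ∈ compWords y.2, ∑ q ∈ compWords z.1,
      ∑ r ∈ compWords w.2, F p q w.1 r s := fun z w => Finset.sum_congr rfl fun p _ =>
    (Finset.sum_congr rfl fun q _ => Finset.sum_comm).trans Finset.sum_comm
  have h5 : ∀ z : ℕ × ℕ, ∑ w ∈ Finset.HasAntidiagonal.antidiagonal z.2,
      ∑ p ∈ compWords x.1, ∑ q ∈ compWords z.1,
      ∑ r ∈ compWords w.2, ∑ s ∈ compWords y.2, F p q w.1 r s =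
      ∑ p ∈ compWords x.1, ∑ s ∈ compWords y.2, ∑ q ∈ compWords z.1,
      ∑ w ∈ Finset.HasAntidiagonal.antidiagonal z.2, ∑ r ∈ compWords w.2, F p q w.1 r s := by
    intro z
    rw [Finset.sum_congr rfl fun w _ => h4 z w, sum_rotate]
    exact Finset.sum_congr rfl fun p _ => Finset.sum_congr rfl fun s _ => Finset.sum_comm
  rw [Finset.sum_congr rfl fun z _ => h5 z, sum_rotate]

end Tri

/-! ### Coalgebra maps on words -/

namespace BarMap

variable {R M N P : Type*} [CommRing R] [AddCommGroup M] [Module R M] [AddCommGroup N] [Module R N]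
  [AddCommGroup P] [Module R P]

/-- The value `f[a₁|…|aₙ]` on a word given as a list. -/
def onWord (f : BarMap R M N) (l : List M) : N := f l.length fun i => l[i]

theorem onWord_nil (f : BarMap R M N) : f.onWord [] = 0 := by
  rw [onWord]
  exact congrArg (fun g : MultilinearMap R (fun _ : Fin 0 => M) N => g _) f.comps_zero

theorem onWord_singleton (f : BarMap R M N) (x : M) : f.onWord [x] = f 1 fun _ => x :=
  f.congr rfl fun i hi _ => by
    obtain rfl : i = 0 := by simpa using hi
    rfl

theorem onWord_pair (f : BarMap R M N) (x y : M) : f.onWord [x, y] = f 2 ![x, y] :=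
  f.congr rfl fun i hi hi' => by
    have hi2 : i < 2 := hi'
    have : i = 0 ∨ i = 1 := by omega
    rcases this with rfl | rfl <;> rfl

theorem apply_eq_onWord (f : BarMap R M N) {n : ℕ} {a : Fin n → M} {l : List M} (h : n = l.length)
    (ha : ∀ (i : ℕ) (hi : i < n) (hi' : i < l.length), a ⟨i, hi⟩ = l[i]) : f n a = f.onWord l :=
  f.congr h ha

theorem exists_linearMap_onWord (f : BarMap R M N) (l r : List M) :
    ∃ g : M →ₗ[R] N, ∀ x, g x = f.onWord (l ++ x :: r) := by
  refine ⟨(f (l.length + (r.length + 1))).toLinearMap (fun i => (l ++ 0 :: r).getD i 0)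
    ⟨l.length, by omega⟩, fun x => ?_⟩
  rw [MultilinearMap.toLinearMap_apply]
  refine f.apply_eq_onWord (by simp) fun i hi hi' => ?_
  rw [Function.update_apply]
  have hlen : i < l.length + (r.length + 1) := hi
  split_ifs with h
  · obtain rfl : i = l.length := congrArg Fin.val h
    simp
  · have h' : i ≠ l.length := fun h2 => h (Fin.ext h2)
    rcases Nat.lt_or_gt_of_ne h' with h2 | h2
    · have h3 : i < (l ++ (0 : M) :: r).length := by simp; omega
      rw [List.getD_eq_getElem _ _ h3, List.getElem_append_left h2, List.getElem_append_left h2]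
    · obtain ⟨k, rfl⟩ : ∃ k, i = l.length + 1 + k := ⟨i - (l.length + 1), by omega⟩
      have hk : k < r.length := by omega
      simp [List.getElem_append, List.getElem?_append, hk,
        show l.length + 1 + k - l.length = k + 1 by omega,
        show ¬ l.length + 1 + k < l.length by omega]

/-- The value of `f` on the words `l ++ x :: r`, as a linear map in the letter `x`. -/
noncomputable def insertMap (f : BarMap R M N) (l r : List M) : M →ₗ[R] N :=
  (f.exists_linearMap_onWord l r).choose

theorem insertMap_apply (f : BarMap R M N) (l r : List M) (x : M) :
    f.insertMap l r x = f.onWord (l ++ x :: r) :=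
  (f.exists_linearMap_onWord l r).choose_spec x

/-- The sign `(-1)^{|a₁| + ⋯ + |aₙ| + n}` of a word whose letters are paired with their degrees. -/
def wordSign (l : List (M × ℤ)) : ℤˣ := Int.negOnePow (l.map fun x => x.2 + 1).sum

theorem wordSign_eq (L : List (M × ℤ)) {i : ℕ} (hi : i ≤ L.length) :
    (∑ l ∈ Finset.range i, ((L.getD l 0).2 + 1)).negOnePow = wordSign (L.take i) := by
  rw [wordSign]
  congr 1
  induction i with
  | zero => simp
  | succ i ih =>
    rw [Finset.sum_range_succ, ih (by omega), List.take_add_one, List.map_append, List.sum_append]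
    have h : i < L.length := by omega
    simp [h]

/-- `compCoder` on a word, as a sum over all ways of cutting the word in three. -/
theorem compCoder_eq_splitSum (f : BarMap R M N) (m : BarMap R M M) (L : List (M × ℤ)) :
    f.compCoder m L.length (fun i => (L.getD i 0).1) (fun i => (L.getD i 0).2) =
      splitSum L fun p L' => wordSign p • splitSum L' fun q r =>
        f.onWord (p.map Prod.fst ++ m.onWord (q.map Prod.fst) :: r.map Prod.fst) := by
  set n := L.length with hn
  let T : ℕ → ℕ → N := fun i k => wordSign (L.take i) •
    f.onWord ((L.take i).map Prod.fst ++ m.onWord (((L.drop i).take k).map Prod.fst) ::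
      ((L.drop i).drop k).map Prod.fst)
  have h1 : ∀ k ∈ Finset.Icc 1 n, ∀ i ∈ Finset.range (n - k + 1),
      (∑ l ∈ Finset.range i, ((L.getD l 0).2 + 1)).negOnePow • (f (n - k + 1) fun j =>
        if (j : ℕ) < i then (L.getD j 0).1
        else if (j : ℕ) = i then m k fun l => (L.getD (i + l) 0).1
        else (L.getD (j + k - 1) 0).1) = T i k := by
    intro k hk i hi
    rw [Finset.mem_Icc] at hk
    rw [Finset.mem_range] at hi
    have hm : (m k fun l => (L.getD (i + l) 0).1) =
        m.onWord (((L.drop i).take k).map Prod.fst) := by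
      refine m.apply_eq_onWord ?_ fun l hl hl' => ?_
      · simp
        omega
      · have : i + l < L.length := by omega
        simp [this]
    rw [wordSign_eq L (by omega), hm]
    refine congrArg _ (f.apply_eq_onWord ?_ fun j hj hj' => ?_)
    · simp
      omega
    · rcases Nat.lt_trichotomy j i with h | h | h
      · have h2 : j < L.length := by omega
        simp [h, h2]
      · subst h
        have h2 : j ≤ L.length := by omega
        simp [h2]
      · obtain ⟨t, rfl⟩ : ∃ t, j = i + 1 + t := ⟨j - (i + 1), by omega⟩
        have h2 : min i L.length = i := by omega
        have h4 : i + k + t < L.length := by omega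
        rw [if_neg (by simp only; omega), if_neg (by simp only; omega),
          List.getElem_append_right (by simp; omega)]
        simp [h2, show i + 1 + t - i = t + 1 by omega,
          show i + 1 + t + k - 1 = i + k + t by omega, h4]
  have h2 : f.compCoder m n (fun i => (L.getD i 0).1) (fun i => (L.getD i 0).2) =
      ∑ k ∈ Finset.Icc 1 n, ∑ i ∈ Finset.range (n - k + 1), T i k :=
    Finset.sum_congr rfl fun k hk => Finset.sum_congr rfl fun i hi => h1 k hk i hi
  have h3 : ∀ i, T i 0 = 0 := fun i => by
    simp only [T, List.take_zero, List.map_nil, onWord_nil]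
    rw [← insertMap_apply, map_zero, smul_zero]
  rw [h2, splitSum_eq_sum_range, Finset.sum_comm' (t' := Finset.range (n + 1))
    (s' := fun i => Finset.Icc 1 (n - i))]
  · refine Finset.sum_congr rfl fun i _ => ?_
    rw [splitSum_eq_sum_range, Finset.smul_sum, List.length_drop, Finset.sum_range_succ' _ (n - i)]
    have h4 := h3 i
    simp only [T] at h4
    rw [h4, add_zero, Finset.range_eq_Ico, Finset.sum_Ico_add' (fun k => T i k) 0 (n - i) 1]
    refine Finset.sum_congr ?_ fun _ _ => rfl
    ext k
    simp only [Finset.mem_Icc, Finset.mem_Ico]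
    omega
  · intro k i
    simp only [Finset.mem_Icc, Finset.mem_range]
    omega

end BarMap

/-! ### Coalgebra maps on power series -/

namespace BarMap

section Sign

variable {α : Type*}

theorem wordSign_cons (x : α × ℤ) (l : List (α × ℤ)) :
    wordSign (x :: l) = (x.2 + 1).negOnePow * wordSign l := by
  simp [wordSign, Int.negOnePow_add]

theorem wordSign_append (l l' : List (α × ℤ)) :
    wordSign (l ++ l') = wordSign l * wordSign l' := by
  simp [wordSign, Int.negOnePow_add]

theorem wordSign_map {β : ℕ → ℤ} (hβ : ∀ n, Odd (β n)) (b : ℕ → α) (l : List ℕ) :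
    wordSign (l.map fun j => (b j, β j)) = 1 := by
  induction l with
  | nil => simp [wordSign]
  | cons j l ih =>
    rw [List.map_cons, wordSign_cons, ih, Int.negOnePow_even _ (hβ j).add_one, one_mul]

theorem map_fst_map {β : ℕ → ℤ} (b : ℕ → α) (l : List ℕ) :
    (l.map fun j => (b j, β j)).map Prod.fst = l.map b := by
  simp

end Sign

variable {R M N P : Type*} [CommRing R] [AddCommGroup M] [Module R M] [AddCommGroup N] [Module R N]
  [AddCommGroup P] [Module R P]

/-- For `b(t) = ∑ bₙ tⁿ` without constant term, the coefficient of `tⁿ` in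
`∑ₖ f[b(t)|…|b(t)]`. -/
noncomputable def push (f : BarMap R M N) (b : ℕ → M) (n : ℕ) : N :=
  ∑ l ∈ compWords n, f.onWord (l.map b)

/-- The coefficient of `tⁿ` in `∑ f[b(t)|…|b(t)|c(t)|b'(t)|…|b'(t)]`, where `b(t)` and `b'(t)` have
no constant term. -/
noncomputable def insertSum (f : BarMap R M N) (b c b' : ℕ → M) (n : ℕ) : N :=
  triSum n fun p j r => f.onWord (p.map b ++ c j :: r.map b')

theorem push_zero (f : BarMap R M N) (b : ℕ → M) : f.push b 0 = 0 := by
  simp [push, compWords_zero, onWord_nil]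

/-- For `b(t) = f(t)` with `bₙ = fₙ[x|…|x]`, pushing forward along `g` is composition with `g`. -/
theorem push_apply_const (g : BarMap R N P) (f : BarMap R M N) (x : M) (n : ℕ) :
    g.push (fun n => f n fun _ => x) n = g.comp f n fun _ => x := by
  rw [push, comp_apply, ← sum_composition]
  refine Finset.sum_congr rfl fun c _ => ?_
  refine (g.apply_eq_onWord (by simp [Composition.length]) fun i hi hi' => ?_).symm
  rw [List.getElem_map]
  rfl

/-- The sequence `b`, as a coalgebra map from the tensor coalgebra on one generator. -/
noncomputable def ofSeq (R : Type*) {M : Type*} [CommRing R] [AddCommGroup M] [Module R M]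
    (b : ℕ → M) (hb : b 0 = 0) : BarMap R R M where
  comps n := (MultilinearMap.mkPiAlgebra R (Fin n) R).smulRight (b n)
  comps_zero := by
    ext
    simp [hb]

theorem ofSeq_apply_one (b : ℕ → M) (hb : b 0 = 0) (n : ℕ) :
    (ofSeq R b hb n fun _ => 1) = b n := by
  simp [ofSeq]

theorem push_push (g : BarMap R N P) (f : BarMap R M N) (b : ℕ → M) (hb : b 0 = 0) (n : ℕ) :
    g.push (f.push b) n = (g.comp f).push b n := by
  have h1 : b = fun n => ofSeq R b hb n fun _ => 1 := funext fun n => (ofSeq_apply_one b hb n).symm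
  rw [h1, push_apply_const, comp_assoc, ← push_apply_const]
  congr 1
  funext k
  rw [push_apply_const]

theorem getD_mem {ℳ : ℤ → AddSubgroup M} {L : List (M × ℤ)} (hL : ∀ x ∈ L, x.1 ∈ ℳ x.2) (i : ℕ) :
    (L.getD i 0).1 ∈ ℳ (L.getD i 0).2 := by
  rcases Nat.lt_or_ge i L.length with h | h
  · rw [List.getD_eq_getElem _ _ h]
    exact hL _ (List.getElem_mem h)
  · rw [List.getD_eq_default _ _ h]
    exact zero_mem _

theorem sum_insertMap (f : BarMap R M N) (l r : List M) {ι : Type*} (s : Finset ι) (x : ι → M) :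
    f.onWord (l ++ (∑ i ∈ s, x i) :: r) = ∑ i ∈ s, f.onWord (l ++ x i :: r) := by
  simp only [← insertMap_apply, map_sum]

theorem onWord_push (f : BarMap R M N) (m : BarMap R M M) (l r : List M) (b : ℕ → M) (n : ℕ) :
    f.onWord (l ++ m.push b n :: r) =
      ∑ q ∈ compWords n, f.onWord (l ++ m.onWord (q.map b) :: r) :=
  f.sum_insertMap l r _ _

theorem onWord_triSum (f : BarMap R M N) (l r : List M) (n : ℕ) (F : List ℕ → ℕ → List ℕ → M) :
    f.onWord (l ++ triSum n F :: r) = triSum n fun p j q => f.onWord (l ++ F p j q :: r) := by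
  simp only [← insertMap_apply, triSum, map_sum]

/-- Summed over all words in `b`, which has even degree in the suspension, the composite `f ∘ m` is
`∑ f[b|…|b|∑ m[b|…|b]|b|…|b]`. -/
theorem sum_compCoder (f : BarMap R M N) (m : BarMap R M M) {β : ℕ → ℤ} (hβ : ∀ n, Odd (β n))
    (b : ℕ → M) (n : ℕ) :
    ∑ l ∈ compWords n, f.compCoder m (l.map fun j => (b j, β j)).length
      (fun i => ((l.map fun j => (b j, β j)).getD i 0).1)
      (fun i => ((l.map fun j => (b j, β j)).getD i 0).2) = f.insertSum b (m.push b) b n := by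
  have h : ∀ l ∈ compWords n, f.compCoder m (l.map fun j => (b j, β j)).length
      (fun i => ((l.map fun j => (b j, β j)).getD i 0).1)
      (fun i => ((l.map fun j => (b j, β j)).getD i 0).2) =
      splitSum l fun p l' => splitSum l' fun q r =>
        f.onWord (p.map b ++ m.onWord (q.map b) :: r.map b) := by
    intro l _
    simp only [compCoder_eq_splitSum, splitSum_map, wordSign_map hβ, one_smul, map_fst_map]
  rw [Finset.sum_congr rfl h, sum_compWords_split_split, insertSum, triSum]
  simp only [onWord_push]

end BarMap

open BarMap

/-! ### Curvature -/

section Relations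

variable {R M N : Type u} [CommRing R] [AddCommGroup M] [Module R M] [AddCommGroup N] [Module R N]
  {ℳ : ℤ → AddSubgroup M} {𝒩 : ℤ → AddSubgroup N}

/-- The Bianchi identity for the curvature `m.push b` of `b`. -/
theorem insertSum_push_self (X : UnitalAInf R ℳ) {b : ℕ → M} {β : ℕ → ℤ} (hβ : ∀ n, Odd (β n))
    (hb : ∀ n, b n ∈ ℳ (β n)) (n : ℕ) : X.m.insertSum b (X.m.push b) b n = 0 := by
  rw [← sum_compCoder X.m X.m hβ b n]
  refine Finset.sum_eq_zero fun l _ => X.sq_zero _ _ _ (getD_mem fun x hx => ?_)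
  obtain ⟨j, _, rfl⟩ := List.mem_map.1 hx
  exact hb j

/-- The curvature of the push-forward of `b` under a morphism. -/
theorem push_push_morphism {A : UnitalAInf R ℳ} {C : UnitalAInf R 𝒩} {f : BarMap R M N}
    (hf : IsAInfMorphism A C f) {b : ℕ → M} {β : ℕ → ℤ} (hβ : ∀ n, Odd (β n))
    (hb : ∀ n, b n ∈ ℳ (β n)) (hb0 : b 0 = 0) (n : ℕ) :
    C.m.push (f.push b) n = f.insertSum b (A.m.push b) b n := by
  rw [push_push C.m f b hb0, ← sum_compCoder f A.m hβ b n, push]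
  refine Finset.sum_congr rfl fun l _ => ?_
  rw [← hf.comm _ _ _ (getD_mem fun x hx => ?_)]
  · refine (apply_eq_onWord _ (by simp) fun i hi hi' => ?_).symm
    have : i < l.length := by simpa using hi
    simp [this]
  · obtain ⟨j, _, rfl⟩ := List.mem_map.1 hx
    exact hb j

/-- The part of the identity `m ∘ m = 0`, summed over the words `b₀ ⋯ b₀ c b₁ ⋯ b₁`, in which the
inner operation is applied to letters `b₀` only. -/
noncomputable def leftCurvatureSum (m : BarMap R M M) (b₀ W c b₁ : ℕ → M) (n : ℕ) : M :=
  ∑ x ∈ Finset.HasAntidiagonal.antidiagonal n, ∑ y ∈ Finset.HasAntidiagonal.antidiagonal x.2,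
    ∑ v ∈ compWords y.2, triSum x.1 fun p i q =>
      m.onWord (p.map b₀ ++ W i :: (q.map b₀ ++ c y.1 :: v.map b₁))

/-- The part of the identity `m ∘ m = 0`, summed over the words `b₀ ⋯ b₀ c b₁ ⋯ b₁`, in which the
inner operation is applied to letters `b₁` only. -/
noncomputable def rightCurvatureSum (m : BarMap R M M) (b₀ c b₁ W : ℕ → M) (n : ℕ) : M :=
  ∑ x ∈ Finset.HasAntidiagonal.antidiagonal n, ∑ u ∈ compWords x.1,
    ∑ y ∈ Finset.HasAntidiagonal.antidiagonal x.2, triSum y.2 fun p i q =>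
      m.onWord (u.map b₀ ++ c y.1 :: p.map b₁ ++ W i :: q.map b₁)

/-- The identity `m ∘ m = 0` on the word `b₀ ⋯ b₀ c b₁ ⋯ b₁`. The inner operation is applied before
`c`, to a piece containing `c`, or after `c`; in the last case the sign is `-1`, because `c` has odd
degree in the suspension. -/
theorem word_relation (X : UnitalAInf R ℳ) {b₀ c b₁ : ℕ → M} {β γ : ℕ → ℤ}
    (hβ : ∀ n, Odd (β n)) (hγ : ∀ n, Even (γ n)) (hb₀ : ∀ n, b₀ n ∈ ℳ (β n))
    (hc : ∀ n, c n ∈ ℳ (γ n)) (hb₁ : ∀ n, b₁ n ∈ ℳ (β n)) (u : List ℕ) (j : ℕ) (v : List ℕ) :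
    (splitSum u fun p l' => splitSum l' fun q r =>
        X.m.onWord (p.map b₀ ++ X.m.onWord (q.map b₀) :: (r.map b₀ ++ c j :: v.map b₁))) +
      (splitSum u fun p q => splitSum v fun r s =>
        X.m.onWord (p.map b₀ ++ X.m.onWord (q.map b₀ ++ c j :: r.map b₁) :: s.map b₁)) -
      (splitSum v fun p l' => splitSum l' fun q r =>
        X.m.onWord (u.map b₀ ++ c j :: p.map b₁ ++ X.m.onWord (q.map b₁) :: r.map b₁)) = 0 := by
  let L : List (M × ℤ) := (u.map fun j => (b₀ j, β j)) ++ (c j, γ j) :: v.map fun j => (b₁ j, β j)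
  have h : X.m.compCoder X.m L.length (fun i => (L.getD i 0).1) (fun i => (L.getD i 0).2) = 0 :=
    X.sq_zero _ _ _ (getD_mem fun x hx => ?_)
  · simp only [L] at h
    rw [compCoder_eq_splitSum] at h
    simp only [splitSum_append_cons, splitSum_map, wordSign_append, wordSign_cons,
      wordSign_map hβ, one_mul, mul_one, one_smul, List.map_append, List.map_cons, map_fst_map,
      splitSum_add, Int.negOnePow_odd _ (hγ j).add_one, Units.neg_smul, splitSum_neg] at h
    rw [← h, sub_eq_add_neg]
  · rw [List.mem_append, List.mem_cons] at hx
    rcases hx with hx | rfl | hx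
    · obtain ⟨j, _, rfl⟩ := List.mem_map.1 hx
      exact hb₀ j
    · exact hc j
    · obtain ⟨j, _, rfl⟩ := List.mem_map.1 hx
      exact hb₁ j

/-- The operation `c ↦ ∑ m[b₀|…|b₀|c|b₁|…|b₁]` squares to the difference of the actions of the
curvatures of `b₀` and `b₁`. -/
theorem insertSum_insertSum (X : UnitalAInf R ℳ) {b₀ c b₁ : ℕ → M} {β γ : ℕ → ℤ}
    (hβ : ∀ n, Odd (β n)) (hγ : ∀ n, Even (γ n)) (hb₀ : ∀ n, b₀ n ∈ ℳ (β n))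
    (hc : ∀ n, c n ∈ ℳ (γ n)) (hb₁ : ∀ n, b₁ n ∈ ℳ (β n)) (n : ℕ) :
    leftCurvatureSum X.m b₀ (X.m.push b₀) c b₁ n +
      X.m.insertSum b₀ (X.m.insertSum b₀ c b₁) b₁ n -
      rightCurvatureSum X.m b₀ c b₁ (X.m.push b₁) n = 0 := by
  have h := (triSum_congr (n := n) fun u j v _ =>
    word_relation X hβ hγ hb₀ hc hb₁ u j v).trans (triSum_zero n)
  rw [triSum_sub, triSum_add, triSum_splitSum_splitSum n fun p q j r s =>
    X.m.onWord (p.map b₀ ++ X.m.onWord (q.map b₀ ++ c j :: r.map b₁) :: s.map b₁)] at h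
  refine (congrArg₂ (· - ·) (congrArg₂ (· + ·) ?_ ?_) ?_).trans h
  · rw [leftCurvatureSum, triSum]
    refine Finset.sum_congr rfl fun x _ => ?_
    refine Eq.trans (Finset.sum_congr rfl fun y _ => ?_) Finset.sum_comm
    refine Eq.trans (Finset.sum_congr rfl fun v _ => ?_) Finset.sum_comm
    rw [sum_compWords_split_split x.1 fun p q r => X.m.onWord (p.map b₀ ++
      X.m.onWord (q.map b₀) :: (r.map b₀ ++ c y.1 :: v.map b₁)), triSum]
    simp only [onWord_push]
  · rw [insertSum]
    refine triSum_congr fun p i s _ => ?_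
    rw [insertSum, onWord_triSum]
  · rw [rightCurvatureSum, triSum]
    refine Finset.sum_congr rfl fun x _ => Finset.sum_congr rfl fun u _ =>
      Finset.sum_congr rfl fun y _ => ?_
    rw [sum_compWords_split_split y.2 fun p q r => X.m.onWord (u.map b₀ ++ c y.1 :: p.map b₁ ++
      X.m.onWord (q.map b₁) :: r.map b₁), triSum]
    simp only [onWord_push]

end Relations

/-! ### Sums over words with few letters -/

section SumLemmas

variable {G : Type*} [AddCommGroup G]

theorem sum_antidiagonal_compWords_left {n : ℕ} {g : ℕ × ℕ → List ℕ → G}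
    (h : ∀ x p, p ≠ [] → g x p = 0) :
    ∑ x ∈ Finset.HasAntidiagonal.antidiagonal n, ∑ p ∈ compWords x.1, g x p = g (0, n) [] := by
  rw [Finset.sum_eq_single (0, n)]
  · simp only [compWords_zero, Finset.sum_singleton]
  · intro x hx hne
    refine Finset.sum_eq_zero fun p hp => h _ _ ?_
    rintro rfl
    rw [Finset.HasAntidiagonal.mem_antidiagonal] at hx
    have := nil_mem_compWords.1 hp
    exact hne (Prod.ext this (by simp only; omega))
  · intro h
    simp at h

theorem sum_antidiagonal_compWords_right {n : ℕ} {g : ℕ × ℕ → List ℕ → G}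
    (h : ∀ x p, p ≠ [] → g x p = 0) :
    ∑ x ∈ Finset.HasAntidiagonal.antidiagonal n, ∑ p ∈ compWords x.2, g x p = g (n, 0) [] := by
  rw [Finset.sum_eq_single (n, 0)]
  · simp only [compWords_zero, Finset.sum_singleton]
  · intro x hx hne
    refine Finset.sum_eq_zero fun p hp => h _ _ ?_
    rintro rfl
    rw [Finset.HasAntidiagonal.mem_antidiagonal] at hx
    have := nil_mem_compWords.1 hp
    exact hne (Prod.ext (by simp only; omega) this)
  · intro h
    simp at h

theorem triSum_eq_add {n : ℕ} {F : List ℕ → ℕ → List ℕ → G}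
    (h : ∀ p j r, p ≠ [] → r ≠ [] → F p j r = 0) (h0 : ∀ j, F [] j [] = 0) :
    triSum n F = (∑ x ∈ Finset.HasAntidiagonal.antidiagonal n, ∑ r ∈ compWords x.2, F [] x.1 r) +
      ∑ x ∈ Finset.HasAntidiagonal.antidiagonal n, ∑ p ∈ compWords x.1, F p x.2 [] := by
  have h1 : triSum n F = triSum n (fun p j r => if p = [] then F p j r else 0) +
      triSum n fun p j r => if r = [] then F p j r else 0 := by
    rw [← triSum_add]
    refine triSum_congr fun p j r _ => ?_
    split_ifs with hp hr hr
    · rw [hp, hr, h0, add_zero]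
    · rw [add_zero]
    · rw [zero_add]
    · rw [h p j r hp hr, add_zero]
  rw [h1]
  refine congrArg₂ (· + ·) ?_ ?_
  · rw [triSum, sum_antidiagonal_compWords_left]
    · simp
    · intro x p hp
      simp [hp]
  · rw [triSum]
    refine Finset.sum_congr rfl fun x _ => Finset.sum_congr rfl fun p _ => ?_
    rw [sum_antidiagonal_compWords_right]
    · simp
    · intro y r hr
      simp [hr]

end SumLemmas

/-! ### Degrees and units -/

section Unit

theorem BarMap.sum_map_degree {α : Type*} (b : ℕ → α) (κ : ℤ) (l : List ℕ) :
    ((l.map fun j => (b j, (j : ℤ) * κ - 1)).map fun x => x.2 + 1).sum = (l.sum : ℤ) * κ := by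
  induction l with
  | nil => simp
  | cons j l ih =>
    simp only [List.map_cons, List.sum_cons, ih]
    push_cast
    ring

variable {R M N : Type u} [CommRing R] [AddCommGroup M] [Module R M] [AddCommGroup N] [Module R N]
  {ℳ : ℤ → AddSubgroup M} {𝒩 : ℤ → AddSubgroup N}

namespace BarMap

theorem onWord_smul (f : BarMap R M N) (l r : List M) (a : R) (x : M) :
    f.onWord (l ++ a • x :: r) = a • f.onWord (l ++ x :: r) := by
  simp only [← insertMap_apply, map_smul]

theorem onWord_add (f : BarMap R M N) (l r : List M) (x y : M) :
    f.onWord (l ++ (x + y) :: r) = f.onWord (l ++ x :: r) + f.onWord (l ++ y :: r) := by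
  simp only [← insertMap_apply, map_add]

theorem onWord_zero (f : BarMap R M N) (l r : List M) : f.onWord (l ++ 0 :: r) = 0 := by
  simp only [← insertMap_apply, map_zero]

theorem insertSum_add (f : BarMap R M N) (b c c' b' : ℕ → M) (n : ℕ) :
    f.insertSum b (fun i => c i + c' i) b' n = f.insertSum b c b' n + f.insertSum b c' b' n := by
  simp only [insertSum, onWord_add, triSum_add]

theorem insertSum_of_lt (f : BarMap R M N) {b c b' : ℕ → M} {n : ℕ} (hc : ∀ i < n, c i = 0) :
    f.insertSum b c b' n = f.onWord [c n] := by
  rw [insertSum, triSum_of_lt]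
  · rfl
  · intro p j r hj
    rw [hc j hj, onWord_zero]

theorem HasDegree.onWord {f : BarMap R M N} {p : ℤ} (hf : f.HasDegree ℳ 𝒩 p) {L : List (M × ℤ)}
    (hL : ∀ x ∈ L, x.1 ∈ ℳ x.2) :
    f.onWord (L.map Prod.fst) ∈ 𝒩 ((L.map fun x => x.2 + 1).sum + p - 1) := by
  have h := hf (L.map Prod.fst).length (fun i => (L.map Prod.fst)[i])
    (fun i => (L[i]'(by simpa using i.2)).2) fun i => by
      simp only [Fin.getElem_fin, List.getElem_map]
      exact hL _ (List.getElem_mem _)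
  have e : (L.map fun x => x.2 + 1).sum =
      ∑ i : Fin (L.map Prod.fst).length, ((L[i]'(by simpa using i.2)).2 + 1) := by
    rw [Fin.sum_univ_def]
    congr 1
    refine List.ext_getElem (by simp) fun i h1 h2 => ?_
    simp
  rw [e]
  exact h

theorem push_mem {f : BarMap R M N} {p : ℤ} (hf : f.HasDegree ℳ 𝒩 p) {b : ℕ → M} {κ : ℤ}
    (hb : ∀ n : ℕ, b n ∈ ℳ (n * κ - 1)) (n : ℕ) : f.push b n ∈ 𝒩 (n * κ + p - 1) := by
  refine sum_mem fun l hl => ?_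
  have h := hf.onWord (L := l.map fun j => (b j, (j : ℤ) * κ - 1)) fun x hx => by
    obtain ⟨j, _, rfl⟩ := List.mem_map.1 hx
    exact hb j
  rwa [sum_map_degree, map_fst_map, (mem_compWords.1 hl).2] at h

theorem insertSum_mem {f : BarMap R M N} {p : ℤ} (hf : f.HasDegree ℳ 𝒩 p) {b c b' : ℕ → M} {κ : ℤ}
    (hb : ∀ n : ℕ, b n ∈ ℳ (n * κ - 1)) (hc : ∀ n : ℕ, c n ∈ ℳ (n * κ))
    (hb' : ∀ n : ℕ, b' n ∈ ℳ (n * κ - 1)) (n : ℕ) : f.insertSum b c b' n ∈ 𝒩 (n * κ + p) := by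
  rw [insertSum, triSum]
  refine sum_mem fun x hx => sum_mem fun l hl => sum_mem fun y hy => sum_mem fun r hr => ?_
  have h := hf.onWord (L := (l.map fun j => (b j, (j : ℤ) * κ - 1)) ++ (c y.1, (y.1 : ℤ) * κ) ::
    r.map fun j => (b' j, (j : ℤ) * κ - 1)) fun x hx => by
      rw [List.mem_append, List.mem_cons] at hx
      rcases hx with hx | rfl | hx
      · obtain ⟨j, _, rfl⟩ := List.mem_map.1 hx
        exact hb j
      · exact hc y.1
      · obtain ⟨j, _, rfl⟩ := List.mem_map.1 hx
        exact hb' j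
  rw [List.map_append, List.map_cons, List.map_append, List.map_cons, map_fst_map, map_fst_map,
    List.sum_append, List.sum_cons, sum_map_degree, sum_map_degree, (mem_compWords.1 hl).2,
    (mem_compWords.1 hr).2] at h
  convert h using 2
  rw [Finset.HasAntidiagonal.mem_antidiagonal] at hx hy
  rw [← hx, ← hy]
  push_cast
  ring

end BarMap

namespace UnitalAInf

variable (X : UnitalAInf R ℳ)

theorem onWord_one_eq_zero {l r : List M} (h : l.length + r.length ≠ 1) :
    X.m.onWord (l ++ X.one :: r) = 0 := by
  refine X.map_one _ ?_ _ ⟨⟨l.length, by simp⟩, by simp⟩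
  rw [List.length_append, List.length_cons]
  omega

theorem onWord_one_left (x : M) : X.m.onWord [X.one, x] = x := by
  rw [onWord_pair, X.one_left]

theorem onWord_one_right {j : ℤ} (hj : Even j) {x : M} (hx : x ∈ ℳ j) :
    X.m.onWord [x, X.one] = x := by
  have h := X.one_right j x hx
  rwa [Int.negOnePow_even _ hj, one_smul, ← onWord_pair] at h

theorem onWord_one_right_odd {j : ℤ} (hj : Odd j) {x : M} (hx : x ∈ ℳ j) :
    X.m.onWord [x, X.one] = -x := by
  have h := X.one_right j x hx
  rw [Int.negOnePow_odd _ hj, Units.neg_smul, one_smul, ← onWord_pair] at h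
  rw [← h, neg_neg, h]

theorem onWord_singleton_one : X.m.onWord [X.one] = 0 :=
  X.onWord_one_eq_zero (l := []) (r := []) (by simp)

/-- The unit contributes nothing to the Bianchi identity, since `m₂[1|b] + m₂[b|1] = 0`. -/
theorem insertSum_smul_one {b : ℕ → M} {β : ℕ → ℤ} (hβ : ∀ n, Odd (β n))
    (hb : ∀ n, b n ∈ ℳ (β n)) (v : ℕ → R) (n : ℕ) :
    X.m.insertSum b (fun i => v i • X.one) b n = 0 := by
  have hF : ∀ (p : List ℕ) (j : ℕ) (r : List ℕ), p.length + r.length ≠ 1 →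
      X.m.onWord (p.map b ++ v j • X.one :: r.map b) = 0 := fun p j r h => by
    rw [onWord_smul, X.onWord_one_eq_zero (by simpa using h), smul_zero]
  rw [insertSum, triSum_eq_add]
  · rw [← Finset.Nat.sum_antidiagonal_swap, ← Finset.sum_add_distrib]
    refine Finset.sum_eq_zero fun x _ => ?_
    simp only [Prod.fst_swap, Prod.snd_swap]
    rw [← Finset.sum_add_distrib]
    refine Finset.sum_eq_zero fun l _ => ?_
    by_cases hl : l.length = 1
    · obtain ⟨j, rfl⟩ := List.length_eq_one_iff.1 hl
      rw [onWord_smul, onWord_smul, ← smul_add]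
      change v x.2 • (X.m.onWord [X.one, b j] + X.m.onWord [b j, X.one]) = 0
      rw [X.onWord_one_left, X.onWord_one_right_odd (hβ j) (hb j), add_neg_cancel, smul_zero]
    · rw [hF [] _ l (by simpa using hl), hF l _ [] (by simpa using hl), add_zero]
  · intro p j r hp hr
    refine hF p j r ?_
    have := List.length_pos_iff.2 hp
    have := List.length_pos_iff.2 hr
    omega
  · intro j
    exact hF [] j [] (by simp)

theorem leftCurvatureSum_smul_one (b₀ c b₁ : ℕ → M) (v : ℕ → R) (n : ℕ) :
    leftCurvatureSum X.m b₀ (fun i => v i • X.one) c b₁ n =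
      ∑ x ∈ Finset.HasAntidiagonal.antidiagonal n, v x.1 • c x.2 := by
  rw [leftCurvatureSum]
  refine Finset.sum_congr rfl fun x _ => ?_
  have hF : ∀ (p q w : List ℕ) (i j : ℕ), p ≠ [] ∨ q ≠ [] ∨ w ≠ [] →
      X.m.onWord (p.map b₀ ++ v i • X.one :: (q.map b₀ ++ c j :: w.map b₁)) = 0 := by
    intro p q w i j h
    rw [onWord_smul, X.onWord_one_eq_zero, smul_zero]
    simp only [List.length_map, List.length_append, List.length_cons]
    have h1 := List.length_pos_iff (l := p)
    have h2 := List.length_pos_iff (l := q)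
    have h3 := List.length_pos_iff (l := w)
    rw [← h1, ← h2, ← h3] at h
    omega
  rw [sum_antidiagonal_compWords_right, triSum_eq_single]
  · change X.m.onWord ([] ++ v x.1 • X.one :: [c x.2]) = _
    rw [onWord_smul]
    exact congrArg _ (X.onWord_one_left _)
  · intro p j q h
    exact hF _ _ _ _ _ (by tauto)
  · intro y w hw
    rw [triSum_congr fun p i q _ => hF p q w i y.1 (Or.inr (Or.inr hw)), triSum_zero]

theorem rightCurvatureSum_smul_one {b₀ c b₁ : ℕ → M} {γ : ℕ → ℤ} (hγ : ∀ n, Even (γ n))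
    (hc : ∀ n, c n ∈ ℳ (γ n)) (v : ℕ → R) (n : ℕ) :
    rightCurvatureSum X.m b₀ c b₁ (fun i => v i • X.one) n =
      ∑ x ∈ Finset.HasAntidiagonal.antidiagonal n, v x.1 • c x.2 := by
  have hF : ∀ (p q w : List ℕ) (i j : ℕ), p ≠ [] ∨ q ≠ [] ∨ w ≠ [] →
      X.m.onWord (w.map b₀ ++ c j :: p.map b₁ ++ v i • X.one :: q.map b₁) = 0 := by
    intro p q w i j h
    rw [onWord_smul, X.onWord_one_eq_zero, smul_zero]
    simp only [List.length_map, List.length_append, List.length_cons]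
    have h1 := List.length_pos_iff (l := p)
    have h2 := List.length_pos_iff (l := q)
    have h3 := List.length_pos_iff (l := w)
    rw [← h1, ← h2, ← h3] at h
    omega
  rw [rightCurvatureSum, sum_antidiagonal_compWords_left, ← Finset.Nat.sum_antidiagonal_swap]
  · refine Finset.sum_congr rfl fun x _ => ?_
    rw [triSum_eq_single]
    · change X.m.onWord ([c x.2] ++ v x.1 • X.one :: []) = _
      rw [onWord_smul]
      exact congrArg _ (X.onWord_one_right (hγ _) (hc _))
    · intro p j q h
      exact hF _ _ _ _ _ (by tauto)
  · intro x w hw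
    refine Finset.sum_eq_zero fun y _ => ?_
    rw [triSum_congr fun p i q _ => hF p q w i y.1 (Or.inr (Or.inr hw)), triSum_zero]

end UnitalAInf

theorem leftCurvatureSum_add (m : BarMap R M M) (b₀ W W' c b₁ : ℕ → M) (n : ℕ) :
    leftCurvatureSum m b₀ (fun i => W i + W' i) c b₁ n =
      leftCurvatureSum m b₀ W c b₁ n + leftCurvatureSum m b₀ W' c b₁ n := by
  simp only [leftCurvatureSum, onWord_add, triSum_add, Finset.sum_add_distrib]

/-- If `W` is divisible by `tⁿ`, only its leading coefficient and that of `c` contribute. -/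
theorem leftCurvatureSum_of_lt (m : BarMap R M M) {b₀ W c b₁ : ℕ → M} {n : ℕ}
    (hW : ∀ i < n, W i = 0) : leftCurvatureSum m b₀ W c b₁ n = m.onWord [W n, c 0] := by
  rw [leftCurvatureSum, Finset.sum_eq_single (n, 0)]
  · simp only [Finset.Nat.antidiagonal_zero, Finset.sum_singleton, compWords_zero]
    rw [triSum_of_lt]
    · rfl
    · intro p i q hi
      rw [hW i hi, onWord_zero]
  · intro x hx hne
    rw [Finset.HasAntidiagonal.mem_antidiagonal] at hx
    have hlt : x.1 < n := by
      by_contra hlt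
      exact hne (Prod.ext (by simp only; omega) (by simp only; omega))
    refine Finset.sum_eq_zero fun y _ => Finset.sum_eq_zero fun w _ => ?_
    refine (triSum_congr fun p i q hpq => ?_).trans (triSum_zero _)
    rw [hW i (by omega), onWord_zero]
  · intro h
    simp at h

end Unit

/-! ### Homogeneous components -/

section Homogeneous

variable {M N : Type*} [AddCommGroup M] [AddCommGroup N] {ℳ : ℤ → AddSubgroup M}
  {𝒩 : ℤ → AddSubgroup N}

/-- The projection of an internally graded group to its component of degree `k`. -/
noncomputable def component (hM : DirectSum.IsInternal ℳ) (k : ℤ) : M →+ M :=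
  (ℳ k).subtype.comp ((DFinsupp.evalAddMonoidHom k).comp
    (AddEquiv.ofBijective (DirectSum.coeAddMonoidHom ℳ) hM).symm.toAddMonoidHom)

theorem component_mem (hM : DirectSum.IsInternal ℳ) (k : ℤ) (x : M) : component hM k x ∈ ℳ k :=
  SetLike.coe_mem _

theorem component_of_mem (hM : DirectSum.IsInternal ℳ) {j k : ℤ} {x : M} (hx : x ∈ ℳ j) :
    component hM k x = if j = k then x else 0 := by
  have h : (AddEquiv.ofBijective (DirectSum.coeAddMonoidHom ℳ) hM).symm x =
      DirectSum.of (fun i => ℳ i) j ⟨x, hx⟩ := by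
    rw [AddEquiv.symm_apply_eq]
    exact (DirectSum.coeAddMonoidHom_of ℳ j ⟨x, hx⟩).symm
  change (((AddEquiv.ofBijective (DirectSum.coeAddMonoidHom ℳ) hM).symm x) k : M) = _
  rw [h]
  split_ifs with hjk
  · subst hjk
    rw [DirectSum.of_eq_same]
  · rw [DirectSum.of_eq_of_ne _ _ _ (Ne.symm hjk)]
    rfl

theorem addMonoidHom_ext_homogeneous (hM : DirectSum.IsInternal ℳ) {φ ψ : M →+ N}
    (h : ∀ k, ∀ x ∈ ℳ k, φ x = ψ x) : φ = ψ := by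
  ext x
  obtain ⟨y, rfl⟩ := hM.2 x
  induction y using DirectSum.induction_on with
  | zero => simp
  | of i y =>
    rw [DirectSum.coeAddMonoidHom_of]
    exact h i _ y.2
  | add y z hy hz => rw [map_add, map_add, map_add, hy, hz]

theorem map_component (hM : DirectSum.IsInternal ℳ) (hN : DirectSum.IsInternal 𝒩) {φ : M →+ N}
    {s : ℤ} (hφ : ∀ k, ∀ x ∈ ℳ k, φ x ∈ 𝒩 (k + s)) (k : ℤ) (x : M) :
    φ (component hM k x) = component hN (k + s) (φ x) := by
  have h : φ.comp (component hM k) = (component hN (k + s)).comp φ := by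
    refine addMonoidHom_ext_homogeneous hM fun j x hx => ?_
    rw [AddMonoidHom.comp_apply, AddMonoidHom.comp_apply, component_of_mem hM hx,
      component_of_mem hN (hφ j x hx)]
    by_cases hjk : j = k
    · simp [hjk]
    · rw [if_neg hjk, if_neg (by omega), map_zero]
  exact DFunLike.congr_fun h x

end Homogeneous

/-! ### Obstructions -/

section Lift

variable {R M N : Type u} [CommRing R] [AddCommGroup M] [Module R M] [AddCommGroup N] [Module R N]
  {ℳ : ℤ → AddSubgroup M} {𝒩 : ℤ → AddSubgroup N}

/-- The linear component `f₁`. -/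
noncomputable def BarMap.lin (f : BarMap R M N) : M →ₗ[R] N := f.insertMap [] []

theorem BarMap.lin_eq_onWord (f : BarMap R M N) (x : M) : f.lin x = f.onWord [x] :=
  f.insertMap_apply [] [] x

theorem BarMap.lin_apply (f : BarMap R M N) (x : M) : f.lin x = f 1 fun _ => x := by
  rw [lin_eq_onWord, onWord_singleton]

theorem UnitalAInf.d_eq_lin (A : UnitalAInf R ℳ) (x : M) : A.d x = A.m.lin x :=
  (A.m.lin_apply x).symm

theorem BarMap.HasDegree.lin_mem {f : BarMap R M N} {p : ℤ} (hf : f.HasDegree ℳ 𝒩 p) (k : ℤ) (x : M)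
    (hx : x ∈ ℳ k) : f.lin x ∈ 𝒩 (k + p) := by
  have h := hf 1 (fun _ => x) (fun _ => k) fun _ => hx
  rw [lin_apply]
  convert h using 2
  simp
  ring

variable {A : UnitalAInf R ℳ} {C : UnitalAInf R 𝒩} {f : BarMap R M N}

theorem IsAInfMorphism.lin_comm (hM : DirectSum.IsInternal ℳ) (hf : IsAInfMorphism A C f) (x : M) :
    f.lin (A.m.lin x) = C.m.lin (f.lin x) := by
  have h : (f.lin ∘ₗ A.m.lin).toAddMonoidHom = (C.m.lin ∘ₗ f.lin).toAddMonoidHom := by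
    refine addMonoidHom_ext_homogeneous hM fun k x hx => ?_
    have h := hf.comm 1 (fun _ => x) (fun _ => k) fun _ => hx
    rw [← push_apply_const] at h
    rw [push, compWords_one, Finset.sum_singleton] at h
    change f.lin (A.m.lin x) = C.m.lin (f.lin x)
    rw [lin_eq_onWord C.m, lin_apply f x]
    refine Eq.trans ?_ h.symm
    simp only [compCoder, Finset.Icc_self, Finset.sum_singleton, Nat.sub_self, zero_add,
      Finset.sum_range_one, Finset.range_zero, Finset.sum_empty, Int.negOnePow_zero, one_smul]
    rw [lin_apply, lin_apply]
    refine f.congr rfl fun i hi hi' => ?_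
    obtain rfl : i = 0 := by omega
    rfl
  exact DFunLike.congr_fun h x

namespace BarMap

theorem push_congr (f : BarMap R M N) {b b' : ℕ → M} {n : ℕ} (h : ∀ i ≤ n, b' i = b i) :
    f.push b' n = f.push b n :=
  Finset.sum_congr rfl fun l hl => by
    rw [map_congr_of_lt (n := n + 1) (fun i hi => h i (by omega)) fun i hi =>
      Nat.lt_succ_of_le (le_of_mem_compWords hl i hi)]

/-- Changing `bₙ` changes the coefficient of `tⁿ` in `∑ f[b|…|b]` by `f₁` of the change. -/
theorem push_of_agree (f : BarMap R M N) {b b' : ℕ → M} {n : ℕ} (hn : 0 < n)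
    (h : ∀ i < n, b' i = b i) : f.push b' n = f.push b n + f.lin (b' n - b n) := by
  have hmem : [n] ∈ compWords n := by simp [mem_compWords, hn]
  rw [← sub_eq_iff_eq_add', push, push, ← Finset.sum_sub_distrib, Finset.sum_eq_single [n]]
  · rw [map_sub, lin_eq_onWord, lin_eq_onWord]
    rfl
  · intro l hl hne
    rw [map_congr_of_lt h (lt_of_mem_compWords hl hne), sub_self]
  · exact fun h => (h hmem).elim

theorem insertSum_congr (f : BarMap R M N) {b b' c c' b₁ : ℕ → M} {n : ℕ}
    (h : ∀ i ≤ n, b' i = b i) (hc : ∀ i ≤ n, c' i = c i) :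
    f.insertSum b' c' b₁ n = f.insertSum b c b₁ n := by
  refine triSum_congr fun p j r hs => ?_
  rw [hc j (by omega), map_congr_of_lt (n := n + 1) (fun i hi => h i (by omega)) fun i hi => ?_]
  have := List.le_sum_of_mem hi
  omega

/-- The effect on the coefficient of `tⁿ` of changing `bₙ` and `cₙ`. -/
theorem insertSum_of_agree (f : BarMap R M N) {b b' c c' b₁ : ℕ → M} {n : ℕ} (hn : 0 < n)
    (h : ∀ i < n, b' i = b i) (hc : ∀ i < n, c' i = c i) :
    f.insertSum b' c' b₁ n = f.insertSum b c b₁ n + f.lin (c' n - c n) +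
      (f.onWord [b' n, c 0] - f.onWord [b n, c 0]) := by
  have h1 : f.insertSum b c' b₁ n - f.insertSum b c b₁ n = f.lin (c' n - c n) := by
    rw [insertSum, insertSum, ← triSum_sub, triSum_of_lt]
    · rw [map_sub, lin_eq_onWord, lin_eq_onWord]
      rfl
    · intro p j r hj
      rw [hc j hj, sub_self]
  have h2 : f.insertSum b' c' b₁ n - f.insertSum b c' b₁ n =
      f.onWord [b' n, c 0] - f.onWord [b n, c 0] := by
    rw [insertSum, insertSum, ← triSum_sub, triSum_eq_of_left hn]
    · rw [← hc 0 hn]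
      rfl
    · intro p hp hne
      rw [map_congr_of_lt h (lt_of_mem_compWords hp hne), sub_self]
    · intro p j r hp
      rw [map_congr_of_lt h hp, sub_self]
  rw [← h1, ← h2]
  abel

end BarMap

theorem insertSum_smul_one_morphism (hf : f.IsNormalized A.one C.one) (b : ℕ → M) (v : ℕ → R)
    (n : ℕ) : f.insertSum b (fun i => v i • A.one) b n = v n • C.one := by
  rw [insertSum, triSum_eq_single]
  · change f.onWord ([] ++ v n • A.one :: []) = _
    rw [onWord_smul, List.nil_append, onWord_singleton, hf.1]
  · intro p j r h
    rw [onWord_smul, onWord, hf.2, smul_zero]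
    · have h1 := List.length_pos_iff (l := p)
      have h2 := List.length_pos_iff (l := r)
      rw [← h1, ← h2] at h
      simp only [List.length_append, List.length_cons, List.length_map]
      omega
    · exact ⟨⟨p.length, by simp⟩, by simp⟩

section Step

variable {κ : ℤ} {b : ℕ → M} {v : ℕ → R} {n : ℕ}

/-- The first obstruction to a solution of `∑ m[b|…|b] = v(t)·1` is a cycle. -/
theorem d_curvature (hκ : Even κ) (hb : ∀ n : ℕ, b n ∈ ℳ (n * κ - 1))
    (hW : ∀ i < n, A.m.push b i = v i • A.one) :
    A.m.lin (A.m.push b n - v n • A.one) = 0 := by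
  have hβ : ∀ n : ℕ, Odd ((n : ℤ) * κ - 1) := fun n => (hκ.mul_left _).sub_odd odd_one
  have h := insertSum_push_self A hβ hb n
  have h1 : A.m.push b = fun i => v i • A.one + (A.m.push b i - v i • A.one) := by
    funext i
    abel
  rw [h1, insertSum_add, A.insertSum_smul_one hβ hb, zero_add, insertSum_of_lt] at h
  · rw [lin_eq_onWord, h]
  · intro i hi
    rw [hW i hi, sub_self]

/-- The push-forward of a solution modulo `tⁿ` is a solution modulo `tⁿ`, and its obstruction is the
image under `f₁` of the obstruction. -/
theorem push_push_eq (hκ : Even κ) (hf : IsAInfMorphism A C f)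
    (hb : ∀ n : ℕ, b n ∈ ℳ (n * κ - 1)) (hb0 : b 0 = 0)
    (hW : ∀ i < n, A.m.push b i = v i • A.one) :
    C.m.push (f.push b) n = v n • C.one + f.lin (A.m.push b n - v n • A.one) := by
  have hβ : ∀ n : ℕ, Odd ((n : ℤ) * κ - 1) := fun n => (hκ.mul_left _).sub_odd odd_one
  rw [push_push_morphism hf hβ hb hb0]
  have h1 : A.m.push b = fun i => v i • A.one + (A.m.push b i - v i • A.one) := by
    funext i
    abel
  conv_lhs => rw [h1]
  rw [insertSum_add, insertSum_smul_one_morphism hf.unital, insertSum_of_lt, lin_eq_onWord]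
  intro i hi
  rw [hW i hi, sub_self]

theorem smul_mem_grading {𝒜 : ℤ → AddSubgroup R} (hsm : ∀ (i j : ℤ), ∀ r ∈ 𝒜 i, ∀ x ∈ ℳ j,
    r • x ∈ ℳ (i + j)) (hv : ∀ n : ℕ, v n ∈ 𝒜 (n * κ + -2)) (n : ℕ) :
    v n • A.one ∈ ℳ (n * κ - 2) := by
  have := hsm _ _ _ (hv n) _ A.one_mem
  rwa [add_zero, ← sub_eq_add_neg] at this

/-- The image under `f₁` of the obstruction for `b` bounds, up to sign, the obstruction for a closed
morphism from `f_* b` to a solution `b₁`. -/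
theorem lin_curvature (hκ : Even κ) (hf : IsAInfMorphism A C f) (hb : ∀ n : ℕ, b n ∈ ℳ (n * κ - 1))
    (hb0 : b 0 = 0) (hv : ∀ n : ℕ, v n • A.one ∈ ℳ (n * κ - 2))
    (hW : ∀ i < n, A.m.push b i = v i • A.one) {c b₁ : ℕ → N}
    (hc : ∀ n : ℕ, c n ∈ 𝒩 (n * κ)) (hc0 : c 0 = C.one) (hb₁ : ∀ n : ℕ, b₁ n ∈ 𝒩 (n * κ - 1))
    (hW₁ : ∀ i, C.m.push b₁ i = v i • C.one)
    (hE : ∀ i < n, C.m.insertSum (f.push b) c b₁ i = 0) :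
    f.lin (A.m.push b n - v n • A.one) + C.m.lin (C.m.insertSum (f.push b) c b₁ n) = 0 := by
  have hβ : ∀ n : ℕ, Odd ((n : ℤ) * κ - 1) := fun n => (hκ.mul_left _).sub_odd odd_one
  have hγ : ∀ n : ℕ, Even ((n : ℤ) * κ) := fun n => hκ.mul_left _
  have hfb : ∀ n : ℕ, f.push b n ∈ 𝒩 (n * κ - 1) := fun n => by
    have := push_mem hf.degree hb n
    rwa [add_zero] at this
  have h := insertSum_insertSum C hβ hγ hfb hc hb₁ n
  have hV : ∀ i ≤ n, C.m.push (f.push b) i - v i • C.one =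
      f.lin (A.m.push b i - v i • A.one) := by
    intro i hi
    rw [push_push_eq (n := i) hκ hf hb hb0 fun j hj => hW j (by omega), add_sub_cancel_left]
  have h1 : C.m.push (f.push b) =
      fun i => v i • C.one + (C.m.push (f.push b) i - v i • C.one) := by
    funext i
    abel
  have h2 : C.m.push b₁ = fun i => v i • C.one := funext hW₁
  rw [h1, h2, leftCurvatureSum_add, C.leftCurvatureSum_smul_one,
    C.rightCurvatureSum_smul_one hγ hc, leftCurvatureSum_of_lt, hV n le_rfl, hc0,
    insertSum_of_lt _ hE, ← lin_eq_onWord] at h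
  · have hdeg : f.lin (A.m.push b n - v n • A.one) ∈ 𝒩 (n * κ - 2 + 0) := by
      refine hf.degree.lin_mem _ _ (sub_mem ?_ (hv n))
      have := push_mem A.degree hb n
      rwa [show (n * κ + -1 - 1 : ℤ) = n * κ - 2 by ring] at this
    rw [C.onWord_one_right (by simpa using (hγ n).sub even_two) hdeg] at h
    rw [← h]
    abel
  · intro i hi
    rw [hV i hi.le, hW i hi, sub_self, map_zero]

/-- Acyclicity of the mapping cone of a weak equivalence, in homogeneous form. -/
theorem IsWeakEquivalence.exists_cone_boundary (hM : DirectSum.IsInternal ℳ)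
    (hN : DirectSum.IsInternal 𝒩) (hf : IsWeakEquivalence A C f) {k : ℤ} {o : M} {ε : N}
    (ho : o ∈ ℳ (k - 1)) (hε : ε ∈ 𝒩 k) (hdo : A.m.lin o = 0) (hoε : f.lin o + C.m.lin ε = 0) :
    ∃ ζ ∈ ℳ k, ∃ η ∈ 𝒩 (k + 1), A.m.lin ζ = -o ∧ ε + C.m.lin η - f.lin ζ = 0 := by
  have hcomm := hf.toIsAInfMorphism.lin_comm hM
  obtain ⟨z, hz⟩ := hf.injective o (by rw [A.d_eq_lin, hdo]) ⟨-ε, by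
    rw [C.d_eq_lin, map_neg, ← lin_apply]
    exact (eq_neg_of_add_eq_zero_left hoε).symm⟩
  rw [A.d_eq_lin] at hz
  obtain ⟨x, hx, w, hw⟩ := hf.surjective (ε + f.lin z) (by
    rw [C.d_eq_lin, map_add, ← hcomm, hz, add_comm]
    exact hoε)
  rw [A.d_eq_lin] at hx
  rw [C.d_eq_lin, ← lin_apply] at hw
  have hA : ∀ (j : ℤ) (y : M), A.m.lin (component hM j y) = component hM (j + -1) (A.m.lin y) :=
    map_component (φ := A.m.lin.toAddMonoidHom) hM hM fun j y hy => A.degree.lin_mem j y hy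
  have hC : ∀ (j : ℤ) (y : N), C.m.lin (component hN j y) = component hN (j + -1) (C.m.lin y) :=
    map_component (φ := C.m.lin.toAddMonoidHom) hN hN fun j y hy => C.degree.lin_mem j y hy
  have hF : ∀ (j : ℤ) (y : M), f.lin (component hM j y) = component hN (j + 0) (f.lin y) :=
    map_component (φ := f.lin.toAddMonoidHom) hM hN fun j y hy => hf.degree.lin_mem j y hy
  refine ⟨component hM k (x - z), component_mem _ _ _, component hN (k + 1) w,
    component_mem _ _ _, ?_, ?_⟩
  · rw [hA, map_sub, hx, hz, zero_sub, map_neg, component_of_mem hM ho,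
      if_pos (sub_eq_add_neg k 1)]
  · rw [hC, hF, hw, add_neg_cancel_right, add_zero]
    rw [map_sub (component hN k), map_add (component hN k), map_sub f.lin,
      map_sub (component hN k), component_of_mem hN hε, if_pos rfl]
    abel

end Step

end Lift

/-! ### Lifting weak Maurer–Cartan elements -/

section Solve

variable {R M N : Type u} [CommRing R] [AddCommGroup M] [Module R M] [AddCommGroup N] [Module R N]
  {ℳ : ℤ → AddSubgroup M} {𝒩 : ℤ → AddSubgroup N}

/-- `b(t) = ∑ bₙ tⁿ` is a weak Maurer–Cartan element with potential `v(t) = ∑ vₙ tⁿ`, that is,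
`∑ₖ mₖ[b(t)|…|b(t)] = v(t)·1`. Here `|t| = -κ`, and `b(t)` has degree `-1`, so degree `0` in the
suspension. -/
structure IsWeakMaurerCartan (X : UnitalAInf R ℳ) (κ : ℤ) (v : ℕ → R) (b : ℕ → M) : Prop where
  zero : b 0 = 0
  mem : ∀ n : ℕ, b n ∈ ℳ (n * κ - 1)
  push_eq : ∀ n, X.m.push b n = v n • X.one

/-- Modulo `tⁿ`, `b` is a weak Maurer–Cartan element with potential `v` and `c` is a closed morphism
from `f_* b` to `b₁` with leading coefficient `1`. -/
structure IsLiftUpTo (A : UnitalAInf R ℳ) (C : UnitalAInf R 𝒩) (f : BarMap R M N) (κ : ℤ)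
    (v : ℕ → R) (b₁ : ℕ → N) (n : ℕ) (b : ℕ → M) (c : ℕ → N) : Prop where
  zero : b 0 = 0
  one : c 0 = C.one
  mem : ∀ n : ℕ, b n ∈ ℳ (n * κ - 1)
  mem' : ∀ n : ℕ, c n ∈ 𝒩 (n * κ)
  push_eq : ∀ i < n, A.m.push b i = v i • A.one
  closed : ∀ i < n, C.m.insertSum (f.push b) c b₁ i = 0

variable {A : UnitalAInf R ℳ} {C : UnitalAInf R 𝒩} {f : BarMap R M N} {κ : ℤ} {v : ℕ → R}
  {b₁ : ℕ → N}

theorem IsWeakMaurerCartan.push (hκ : Even κ) (hf : IsAInfMorphism A C f) {b : ℕ → M}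
    (hb : IsWeakMaurerCartan A κ v b) : IsWeakMaurerCartan C κ v (f.push b) where
  zero := f.push_zero b
  mem n := by
    have := push_mem hf.degree hb.mem n
    rwa [add_zero] at this
  push_eq n := by
    rw [push_push_eq hκ hf hb.mem hb.zero fun i _ => hb.push_eq i, hb.push_eq, sub_self, map_zero,
      add_zero]

/-- A lift modulo `tⁿ` extends to a lift modulo `tⁿ⁺¹`. The obstructions for `b` and `c` form a
cycle of the mapping cone of `f₁`, so they are removed by adding suitable `ζ` to `bₙ` and `η` to
`cₙ`. -/
theorem IsLiftUpTo.exists_succ (hκ : Even κ) (hM : DirectSum.IsInternal ℳ)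
    (hN : DirectSum.IsInternal 𝒩) (hf : IsWeakEquivalence A C f)
    (hv : ∀ n : ℕ, v n • A.one ∈ ℳ (n * κ - 2)) (hb₁ : IsWeakMaurerCartan C κ v b₁) {n : ℕ}
    (hn : 0 < n) {b : ℕ → M} {c : ℕ → N} (h : IsLiftUpTo A C f κ v b₁ n b c) :
    ∃ b' c', IsLiftUpTo A C f κ v b₁ (n + 1) b' c' ∧ (∀ i < n, b' i = b i) ∧
      ∀ i < n, c' i = c i := by
  have hodd : Odd ((n : ℤ) * κ - 1) := (hκ.mul_left _).sub_odd odd_one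
  have hfb : ∀ {b : ℕ → M}, (∀ n : ℕ, b n ∈ ℳ (n * κ - 1)) → f.push b n ∈ 𝒩 (n * κ - 1) :=
    fun hb => by
      have := push_mem hf.degree hb n
      rwa [add_zero] at this
  have ho : A.m.push b n - v n • A.one ∈ ℳ (n * κ - 1 - 1) := by
    have h1 := push_mem A.degree h.mem n
    rw [show (n * κ + -1 - 1 : ℤ) = n * κ - 1 - 1 by ring] at h1
    have h2 := hv n
    rw [show (n * κ - 2 : ℤ) = n * κ - 1 - 1 by ring] at h2
    exact sub_mem h1 h2
  have hε : C.m.insertSum (f.push b) c b₁ n ∈ 𝒩 (n * κ - 1) :=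
    insertSum_mem C.degree (fun n => by
      have := push_mem hf.degree h.mem n
      rwa [add_zero] at this) h.mem' hb₁.mem n
  obtain ⟨ζ, hζ, η, hη, h1, h2⟩ := hf.exists_cone_boundary hM hN ho hε
    (d_curvature hκ h.mem h.push_eq)
    (lin_curvature hκ hf.toIsAInfMorphism h.mem h.zero hv h.push_eq h.mem' h.one hb₁.mem
      hb₁.push_eq h.closed)
  rw [sub_add_cancel] at hη
  let b' := Function.update b n (b n + ζ)
  let c' := Function.update c n (c n + η)
  have hb' : ∀ i < n, b' i = b i := fun i hi => Function.update_of_ne hi.ne _ _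
  have hc' : ∀ i < n, c' i = c i := fun i hi => Function.update_of_ne hi.ne _ _
  have hbn : b' n = b n + ζ := Function.update_self _ _ _
  have hcn : c' n = c n + η := Function.update_self _ _ _
  have hmem : ∀ i : ℕ, b' i ∈ ℳ (i * κ - 1) := fun i => by
    obtain rfl | hi := eq_or_ne i n
    · rw [hbn]
      exact add_mem (h.mem _) hζ
    · rw [show b' i = b i from Function.update_of_ne hi _ _]
      exact h.mem i
  have hpush : ∀ i < n, f.push b' i = f.push b i := fun i hi =>
    push_congr _ fun j hj => hb' j (by omega)
  refine ⟨b', c', ⟨?_, ?_, hmem, ?_, ?_, ?_⟩, hb', hc'⟩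
  · rw [hb' 0 hn, h.zero]
  · rw [hc' 0 hn, h.one]
  · intro i
    obtain rfl | hi := eq_or_ne i n
    · rw [hcn]
      exact add_mem (h.mem' _) hη
    · rw [show c' i = c i from Function.update_of_ne hi _ _]
      exact h.mem' i
  · intro i hi
    obtain rfl | hi' := eq_or_ne i n
    · rw [push_of_agree _ hn hb', hbn, add_sub_cancel_left, h1]
      abel
    · rw [push_congr _ fun j hj => hb' j (by omega), h.push_eq i (by omega)]
  · intro i hi
    obtain rfl | hi' := eq_or_ne i n
    · rw [insertSum_of_agree _ hn hpush hc', hcn, h.one,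
        C.onWord_one_right_odd hodd (hfb hmem), C.onWord_one_right_odd hodd (hfb h.mem),
        push_of_agree _ hn hb', hbn, add_sub_cancel_left, add_sub_cancel_left, ← h2]
      abel
    · rw [insertSum_congr _ (fun j hj => hpush j (by omega)) fun j hj => hc' j (by omega),
        h.closed i (by omega)]

/-- Weak Maurer–Cartan elements lift through a weak equivalence, up to homotopy and with the same
potential. -/
theorem IsWeakMaurerCartan.exists_lift (hκ : Even κ) (hM : DirectSum.IsInternal ℳ)
    (hN : DirectSum.IsInternal 𝒩) (hf : IsWeakEquivalence A C f) (hv0 : v 0 = 0)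
    (hv : ∀ n : ℕ, v n • A.one ∈ ℳ (n * κ - 2)) (hb₁ : IsWeakMaurerCartan C κ v b₁) :
    ∃ b, IsWeakMaurerCartan A κ v b ∧ ∃ w, f.lin (b 1) = b₁ 1 + C.m.lin w := by
  let T : ℕ → Type u := fun n =>
    {S : (ℕ → M) × (ℕ → N) // IsLiftUpTo A C f κ v b₁ (n + 1) S.1 S.2}
  -- Modulo `t` the lift is `b = 0`, `c = 1`.
  have start : IsLiftUpTo A C f κ v b₁ 1 0 (Pi.single 0 C.one) := by
    refine ⟨rfl, Pi.single_eq_same _ _, fun n => zero_mem _, fun n => ?_, fun i hi => ?_,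
      fun i hi => ?_⟩
    · obtain rfl | hn := eq_or_ne n 0
      · rw [Pi.single_eq_same]
        simpa using C.one_mem
      · rw [Pi.single_eq_of_ne hn]
        exact zero_mem _
    · obtain rfl : i = 0 := by omega
      rw [push_zero, hv0, zero_smul]
    · obtain rfl : i = 0 := by omega
      rw [insertSum_of_lt _ (by simp), Pi.single_eq_same, C.onWord_singleton_one]
  have step : ∀ n (S : T n), ∃ S' : T (n + 1), (∀ i < n + 1, S'.1.1 i = S.1.1 i) ∧
      ∀ i < n + 1, S'.1.2 i = S.1.2 i := by
    intro n S
    obtain ⟨b', c', h, h1, h2⟩ := S.2.exists_succ hκ hM hN hf hv hb₁ n.succ_pos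
    exact ⟨⟨(b', c'), h⟩, h1, h2⟩
  choose next hnext using step
  let S : ∀ n, T n := fun n => Nat.rec ⟨(0, Pi.single 0 C.one), start⟩ (fun n S => next n S) n
  have hS : ∀ n i, (S (i + n)).1.1 i = (S i).1.1 i ∧ (S (i + n)).1.2 i = (S i).1.2 i := by
    intro n i
    induction n with
    | zero => exact ⟨rfl, rfl⟩
    | succ n ih =>
      have h := hnext (i + n) (S (i + n))
      exact ⟨(h.1 i (by omega)).trans ih.1, (h.2 i (by omega)).trans ih.2⟩
  let b : ℕ → M := fun n => (S n).1.1 n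
  let c : ℕ → N := fun n => (S n).1.2 n
  have hb : ∀ n, ∀ i ≤ n, b i = (S n).1.1 i := fun n i hi => by
    have := (hS (n - i) i).1
    rw [Nat.add_sub_cancel' hi] at this
    exact this.symm
  have hc : ∀ n, ∀ i ≤ n, c i = (S n).1.2 i := fun n i hi => by
    have := (hS (n - i) i).2
    rw [Nat.add_sub_cancel' hi] at this
    exact this.symm
  refine ⟨b, ⟨(S 0).2.zero, fun n => (S n).2.mem n, fun n => ?_⟩, c 1, ?_⟩
  · rw [push_congr _ (hb n), (S n).2.push_eq n (by omega)]
  -- The coefficient of `t` in the closedness of `c` says that `c 1` is a homotopy from `b₁ 1` to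
  -- `f₁ (b 1)`.
  · have h1 : C.m.insertSum (f.push b) c b₁ 1 = 0 := by
      rw [insertSum_congr _ (fun j hj => push_congr f fun i hi => hb 1 i (by omega)) (hc 1),
        (S 1).2.closed 1 (by omega)]
    have hc0 : c 0 = C.one := (S 0).2.one
    have hdeg : f.lin (b 1) ∈ 𝒩 (((1 : ℕ) : ℤ) * κ - 1 + 0) :=
      hf.degree.lin_mem _ _ ((S 1).2.mem 1)
    have h2 : C.m.insertSum (f.push b) c b₁ 1 = b₁ 1 + C.m.lin (c 1) - f.lin (b 1) := by
      have h3 : f.push b 1 = f.lin (b 1) := by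
        simp [BarMap.push, compWords_one, lin_eq_onWord]
      have h4 := C.onWord_one_right_odd (by simpa using hκ.sub_odd odd_one) hdeg
      rw [insertSum, triSum, Finset.Nat.antidiagonal_succ]
      simp only [Finset.sum_cons, Finset.Nat.antidiagonal_zero, Finset.map_singleton,
        Finset.sum_singleton, compWords_zero, Finset.Nat.antidiagonal_succ, compWords_one,
        Function.Embedding.prodMap, Function.Embedding.coeFn_mk, Prod.map_apply,
        Function.Embedding.refl_apply, List.map_nil, List.map_cons, List.nil_append,
        List.cons_append, Nat.succ_eq_add_one, zero_add, hc0, h3, h4, C.onWord_one_left]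
      rw [lin_eq_onWord C.m]
      abel
    rw [h1] at h2
    exact (sub_eq_zero.1 h2.symm).symm

end Solve

/-! ### Comparison with two-cell complexes -/

section Homology

variable {R M N : Type u} [CommRing R] [AddCommGroup M] [Module R M] [AddCommGroup N] [Module R N]
  {ℳ : ℤ → AddSubgroup M} {𝒩 : ℤ → AddSubgroup N}

theorem IsWeakMaurerCartan.lin_eq {X : UnitalAInf R ℳ} {κ : ℤ} {v : ℕ → R} {b : ℕ → M}
    (h : IsWeakMaurerCartan X κ v b) : X.m.lin (b 1) = v 1 • X.one := by
  rw [← h.push_eq 1]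
  simp [BarMap.push, compWords_one, lin_eq_onWord]

/-- For an element `x` with `d x = v • 1`, the map from the two-cell complex with differential
`y ↦ v • 1` to `X` that sends `y` to `x` and `1` to `1` is injective and surjective on homology:
cycles of the two-cell complex are `(r, s)` with `v * s = 0`, and boundaries are `(v * t, 0)`. -/
def IsCellQuasiIso (X : UnitalAInf R ℳ) (v : R) (x : M) : Prop :=
  (∀ r s : R, v * s = 0 → (∃ w, X.m.lin w = r • X.one + s • x) → s = 0 ∧ ∃ t, r = v * t) ∧
    ∀ z, X.m.lin z = 0 → ∃ r s : R, v * s = 0 ∧ ∃ w, X.m.lin w = r • X.one + s • x - z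

variable {A : UnitalAInf R ℳ} {C : UnitalAInf R 𝒩} {f : BarMap R M N} {v : R} {x : M}

theorem UnitalAInf.lin_add_smul_eq_zero (X : UnitalAInf R ℳ) (hx : X.m.lin x = v • X.one)
    (r : R) {s : R} (hs : v * s = 0) : X.m.lin (r • X.one + s • x) = 0 := by
  rw [map_add, map_smul, map_smul, hx, lin_eq_onWord, X.onWord_singleton_one, smul_zero, zero_add,
    smul_smul, mul_comm, hs, zero_smul]

theorem IsAInfMorphism.lin_one (hf : IsAInfMorphism A C f) : f.lin A.one = C.one := by
  rw [lin_apply, hf.unital.1]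

theorem IsWeakEquivalence.lin_injective (hf : IsWeakEquivalence A C f) {z : M}
    (hz : A.m.lin z = 0) {w : N} (hw : C.m.lin w = f.lin z) : ∃ w', A.m.lin w' = z := by
  obtain ⟨w', hw'⟩ := hf.injective z (by rw [A.d_eq_lin, hz])
    ⟨w, by rw [C.d_eq_lin, hw, lin_apply]⟩
  exact ⟨w', by rw [← A.d_eq_lin, hw']⟩

theorem IsWeakEquivalence.lin_surjective (hf : IsWeakEquivalence A C f) {z : N}
    (hz : C.m.lin z = 0) : ∃ z', A.m.lin z' = 0 ∧ ∃ w, C.m.lin w = f.lin z' - z := by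
  obtain ⟨z', h, w, hw⟩ := hf.surjective z (by rw [C.d_eq_lin, hz])
  exact ⟨z', by rw [← A.d_eq_lin, h], w, by rw [← C.d_eq_lin, hw, lin_apply]⟩

theorem IsCellQuasiIso.push (hM : DirectSum.IsInternal ℳ) (hf : IsWeakEquivalence A C f)
    (hx : A.m.lin x = v • A.one) (h : IsCellQuasiIso A v x) : IsCellQuasiIso C v (f.lin x) := by
  refine ⟨fun r s hs ⟨w, hw⟩ => ?_, fun z hz => ?_⟩
  · refine h.1 r s hs (hf.lin_injective (A.lin_add_smul_eq_zero hx r hs) (w := w) ?_)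
    rw [hw, map_add, map_smul, map_smul, hf.lin_one]
  · obtain ⟨z', hz', w, hw⟩ := hf.lin_surjective hz
    obtain ⟨r, s, hs, w', hw'⟩ := h.2 z' hz'
    refine ⟨r, s, hs, f.lin w' + w, ?_⟩
    rw [map_add, hw, ← hf.lin_comm hM, hw', map_sub, map_add, map_smul, map_smul, hf.lin_one]
    abel

/-- The element `x` may be replaced by one whose image is homologous to `y`. -/
theorem IsCellQuasiIso.lift (hM : DirectSum.IsInternal ℳ) (hf : IsWeakEquivalence A C f)
    (hx : A.m.lin x = v • A.one) {y w₀ : N} (hy : f.lin x = y + C.m.lin w₀)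
    (h : IsCellQuasiIso C v y) : IsCellQuasiIso A v x := by
  refine ⟨fun r s hs ⟨w, hw⟩ => ?_, fun z hz => ?_⟩
  · refine h.1 r s hs ⟨f.lin w - s • w₀, ?_⟩
    rw [map_sub, ← hf.lin_comm hM, hw, map_add, map_smul, map_smul, map_smul, hf.lin_one, hy,
      smul_add]
    abel
  · obtain ⟨r, s, hs, w, hw⟩ := h.2 (f.lin z) (by rw [← hf.lin_comm hM, hz, map_zero])
    refine ⟨r, s, hs, hf.lin_injective ?_ (w := w + s • w₀) ?_⟩
    · rw [map_sub, A.lin_add_smul_eq_zero hx r hs, hz, sub_zero]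
    · rw [map_add, hw, map_sub, map_add, map_smul, map_smul, map_smul, hf.lin_one, hy, smul_add]
      abel

end Homology

/-! ### Weak equivalence classes and orbits -/

section Orbits

variable {R : Type u} [CommRing R] {𝒜 : ℤ → AddSubgroup R}

/-- `X` contains a weak Maurer–Cartan element `b` with potential `u` whose leading coefficient,
together with the unit, exhibits `X` as quasi-isomorphic to a two-cell complex. For a Moore algebra
this says that its characteristic series is `u` up to a change of variable, and it is invariant
under weak equivalence. -/
def Realizes (u : PowerSeries R) (d : ℤ) (X : AInfAlgebra 𝒜) : Prop :=
  ∃ b, IsWeakMaurerCartan X.str (d + 2) (fun n => PowerSeries.coeff n u) b ∧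
    IsCellQuasiIso X.str (PowerSeries.coeff 1 u) (b 1)

variable {u : PowerSeries R} {d : ℤ}

theorem Realizes.iff_of_isWeakEquivalence (hd : Even d) (hu0 : PowerSeries.constantCoeff u = 0)
    (hu : SeriesHasDegree 𝒜 (d + 2) (-2) u) {X Y : AInfAlgebra 𝒜}
    {f : BarMap R X.carrier Y.carrier} (hf : IsWeakEquivalence X.str Y.str f) :
    Realizes u d X ↔ Realizes u d Y := by
  have hκ : Even (d + 2) := hd.add even_two
  constructor
  · rintro ⟨b, hb, h⟩
    refine ⟨f.push b, hb.push hκ hf.toIsAInfMorphism, ?_⟩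
    have h1 : f.push b 1 = f.lin (b 1) := by
      simp [BarMap.push, compWords_one, lin_eq_onWord]
    rw [h1]
    exact h.push X.isInternal hf hb.lin_eq
  · rintro ⟨b₁, hb₁, h⟩
    obtain ⟨b, hb, w, hw⟩ := hb₁.exists_lift hκ X.isInternal Y.isInternal hf
      (by simpa using hu0) fun n => smul_mem_grading X.smul_mem hu n
    exact ⟨b, hb, h.lift X.isInternal hf hb.lin_eq hw⟩

theorem Realizes.iff_of_weaklyEquivalent (hd : Even d) (hu0 : PowerSeries.constantCoeff u = 0)
    (hu : SeriesHasDegree 𝒜 (d + 2) (-2) u) {X Y : AInfAlgebra 𝒜} (h : WeaklyEquivalent X Y) :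
    Realizes u d X ↔ Realizes u d Y := by
  induction h with
  | rel X Y h =>
    obtain ⟨f, hf⟩ := h
    exact Realizes.iff_of_isWeakEquivalence hd hu0 hu hf
  | refl => rfl
  | symm _ _ _ ih => exact ih.symm
  | trans _ _ _ _ _ ih ih' => exact ih.trans ih'

theorem isCellQuasiIso_mooreY {X : UnitalAInf R (mooreGrading 𝒜 d)} {c : R}
    (hX : ∀ x, X.m.lin x = (c * x.2, 0)) (h1 : X.one = (1, 0)) : IsCellQuasiIso X c mooreY := by
  refine ⟨fun r s _ ⟨w, hw⟩ => ?_, fun z hz => ?_⟩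
  · rw [hX, h1] at hw
    have h2 := congrArg Prod.fst hw
    have h3 := congrArg Prod.snd hw
    simp only [mooreY, Prod.fst_add, Prod.snd_add, Prod.smul_fst, Prod.smul_snd, smul_eq_mul,
      mul_one, mul_zero, add_zero, zero_add] at h2 h3
    exact ⟨h3.symm, w.2, h2.symm⟩
  · rw [hX] at hz
    refine ⟨z.1, z.2, congrArg Prod.fst hz, 0, ?_⟩
    rw [map_zero, h1]
    ext <;> simp [mooreY]

/-- A quasi-isomorphism of two-cell complexes with `1 ↦ 1` and `y ↦ p y` has `p` invertible. -/
theorem isUnit_of_isCellQuasiIso {X : UnitalAInf R (mooreGrading 𝒜 d)} {c p v : R}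
    (hX : ∀ x, X.m.lin x = (c * x.2, 0)) (h1 : X.one = (1, 0)) (hv : v = c * p)
    (h : IsCellQuasiIso X v (0, p)) : IsUnit p := by
  obtain ⟨-, t, ht⟩ := h.1 c 0 (mul_zero _) ⟨mooreY, by
    rw [hX, h1]
    ext <;> simp [mooreY]⟩
  -- Since `c = v t`, the element `y - t • (0, p)` is a cycle, homologous to `r • 1 + s • (0, p)`.
  obtain ⟨r, s, -, w, hw⟩ := h.2 (mooreY - t • (0, p)) (by
    rw [hX]
    refine Prod.ext ?_ rfl
    simp only [mooreY, Prod.snd_sub, Prod.smul_snd, smul_eq_mul, Prod.fst_zero]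
    linear_combination ht + t * hv)
  rw [hX, h1] at hw
  have h2 := congrArg Prod.snd hw
  simp only [mooreY, Prod.snd_sub, Prod.snd_add, Prod.smul_snd, smul_eq_mul, mul_zero,
    zero_add] at h2
  refine IsUnit.of_mul_eq_one (s + t) ?_
  linear_combination -h2

variable [GradedRing 𝒜]

theorem moore_lin (hR : ∀ i, Odd i → 𝒜 i = ⊥) (hd : Even d) (A : MooreAlgebra 𝒜 d) (x : R × R) :
    A.1.m.lin x = (PowerSeries.coeff 1 (charSeries A).1 * x.2, 0) := by
  rw [lin_apply, moore_m_eq hR hd, mooreBar_apply]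
  simp [unitMul]

theorem autBar_lin {φ : PowerSeries R} {hφ : PowerSeries.constantCoeff φ = 0} (x : R × R) :
    (autBar φ hφ).lin x = (x.1, PowerSeries.coeff 1 φ * x.2) := by
  rw [lin_apply, autBar_apply, unitId_one]
  simp

theorem Realizes.charSeries (hR : ∀ i, Odd i → 𝒜 i = ⊥) (hd : Even d) (A : MooreAlgebra 𝒜 d) :
    Realizes (charSeries A).1 d (A.toAInfAlgebra hR) := by
  refine ⟨fun n => BarMap.id R (R × R) n fun _ => mooreY, ⟨?_, fun n => ?_, fun n => ?_⟩, ?_⟩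
  · rfl
  · have h := HasDegree.one (R := R) (ℳ := mooreGrading 𝒜 d) n (fun _ => mooreY) (fun _ => d + 1)
      fun _ => mooreY_mem
    have e : (∑ _i : Fin n, (d + 1 + 1) + 0 - 1 : ℤ) = n * (d + 2) - 1 := by
      simp only [Finset.sum_const, Finset.card_univ, Fintype.card_fin, nsmul_eq_mul]
      ring
    rwa [e] at h
  · change A.1.m.push _ n = _ • A.1.one
    rw [push_apply_const, comp_id, moore_m_mooreY hR hd, A.2]
    exact Prod.ext (mul_one _).symm (mul_zero _).symm
  · exact isCellQuasiIso_mooreY (moore_lin hR hd A) A.2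

/-- A weak Maurer–Cartan element of a Moore algebra has the form `φ(t)[y]`, and its potential is
`u(φ(t))`; the condition on homology makes `φ₁` invertible. -/
theorem Realizes.exists_subst (hR : ∀ i, Odd i → 𝒜 i = ⊥) (hd : Even d) {C : MooreAlgebra 𝒜 d}
    (h : Realizes u d (C.toAInfAlgebra hR)) :
    ∃ φ : SeriesGroup 𝒜 d, u = (MooreAInf.charSeries C).1.subst φ.1 := by
  obtain ⟨b, ⟨hb0, hmem, hpush⟩, hcell⟩ : ∃ b : ℕ → R × R,
    IsWeakMaurerCartan C.1 (d + 2) (fun n => PowerSeries.coeff n u) b ∧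
      IsCellQuasiIso C.1 (PowerSeries.coeff 1 u) (b 1) := h
  let φ : PowerSeries R := PowerSeries.mk fun n => (b n).2
  have hφ0 : PowerSeries.constantCoeff φ = 0 := by
    rw [← PowerSeries.coeff_zero_eq_constantCoeff_apply, PowerSeries.coeff_mk, hb0]
    rfl
  have hb : b = fun n => autBar φ hφ0 n fun _ => mooreY := by
    funext n
    rw [autBar_mooreY, PowerSeries.coeff_mk]
    refine Prod.ext ?_ rfl
    rcases mooreGrading_cases hR hd (hmem n) with ⟨h, _⟩ | ⟨_, h⟩
    · exact (Int.not_even_iff_odd.2 (((hd.add even_two).mul_left _).sub_odd odd_one) h).elim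
    · exact h
  have hφd : SeriesHasDegree 𝒜 (d + 2) (-(d + 2)) φ := fun n => by
    have := (hmem n).2
    rw [PowerSeries.coeff_mk]
    rwa [show (n * (d + 2) - 1 - (d + 1) : ℤ) = n * (d + 2) + -(d + 2) by ring] at this
  have hb1 : b 1 = (0, PowerSeries.coeff 1 φ) := by
    rw [hb]
    exact autBar_mooreY 1
  have hsub : u = (MooreAInf.charSeries C).1.subst φ := by
    ext n
    have h := hpush n
    rw [hb, push_apply_const, C.2] at h
    have h1 := congrArg Prod.fst h
    cases n with
    | zero =>
      rw [PowerSeries.coeff_zero_eq_constantCoeff_apply,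
        PowerSeries.coeff_zero_eq_constantCoeff_apply,
        constantCoeff_subst' (MooreAInf.charSeries C).2.1 hφ0,
        ← PowerSeries.coeff_zero_eq_constantCoeff_apply]
      rw [BarMap.comps_zero] at h1
      simpa using h1.symm
    | succ n =>
      rw [moore_m_eq hR hd, mooreBar_comp_autBar n fun _ => mooreY] at h1
      simp only [unitMul_mooreY] at h1
      simpa [mooreY] using h1.symm
  have hu1 : PowerSeries.coeff 1 u =
      PowerSeries.coeff 1 (MooreAInf.charSeries C).1 * PowerSeries.coeff 1 φ := by
    rw [hsub, coeff_one_subst (MooreAInf.charSeries C).2.1 hφ0]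
  rw [hb1] at hcell
  exact ⟨⟨φ, hφ0, isUnit_of_isCellQuasiIso (moore_lin hR hd C) C.2 hu1 hcell, hφd⟩, hsub⟩

theorem coeff_one_charSeries {φ : SeriesGroup 𝒜 d} {A B : MooreAlgebra 𝒜 d}
    (h : charSeries B = MulOpposite.op φ • charSeries A) :
    PowerSeries.coeff 1 (charSeries B).1 =
      PowerSeries.coeff 1 (charSeries A).1 * PowerSeries.coeff 1 φ.1 := by
  rw [h]
  exact coeff_one_subst (charSeries A).2.1 φ.2.1

/-- The linear part `1 ↦ 1`, `y ↦ φ₁ y` is an isomorphism of complexes. -/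
theorem autBar_isWeakEquivalence (hR : ∀ i, Odd i → 𝒜 i = ⊥) (hd : Even d) (φ : SeriesGroup 𝒜 d)
    (A B : MooreAlgebra 𝒜 d) (h : charSeries B = MulOpposite.op φ • charSeries A) :
    IsWeakEquivalence B.1 A.1 (autBar φ.1 φ.2.1) where
  toIsAInfMorphism := (autBar_isAInfMorphism_iff hR hd φ A B).2 h
  injective x hx := by
    rintro ⟨y, hy⟩
    obtain ⟨a, ha⟩ := φ.2.2.1.exists_right_inv
    have hB := coeff_one_charSeries h
    rw [A.1.d_eq_lin, ← lin_apply, autBar_lin, moore_lin hR hd] at hy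
    obtain ⟨h1, h2⟩ := Prod.mk.inj hy
    have h3 : x.2 = 0 := φ.2.2.1.mul_left_cancel (by rw [← h2, mul_zero])
    refine ⟨(0, a * y.2), ?_⟩
    rw [B.1.d_eq_lin, moore_lin hR hd, hB]
    refine Prod.ext ?_ h3.symm
    rw [← h1]
    linear_combination (PowerSeries.coeff 1 (charSeries A).1 * y.2) * ha
  surjective y hy := by
    obtain ⟨a, ha⟩ := φ.2.2.1.exists_right_inv
    have hB := coeff_one_charSeries h
    rw [A.1.d_eq_lin, moore_lin hR hd] at hy
    have h1 : PowerSeries.coeff 1 (charSeries A).1 * y.2 = 0 := congrArg Prod.fst hy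
    refine ⟨(y.1, a * y.2), ?_, 0, ?_⟩
    · rw [B.1.d_eq_lin, moore_lin hR hd, hB]
      refine Prod.ext ?_ rfl
      change _ = (0 : R)
      linear_combination (PowerSeries.coeff 1 (charSeries A).1 * y.2) * ha + h1
    · rw [A.1.d_eq_lin, map_zero, ← lin_apply, autBar_lin]
      refine Prod.ext (by simp) ?_
      change (0 : R) = PowerSeries.coeff 1 φ.1 * (a * y.2) - y.2
      linear_combination -y.2 * ha

/-- Moore algebras are weakly equivalent if and only if their characteristic series differ by a
change of variable. -/
theorem mooreSetoid_iff (hR : ∀ i, Odd i → 𝒜 i = ⊥) (hd : Even d) (A B : MooreAlgebra 𝒜 d) :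
    (mooreSetoid d hR).r A B ↔
      MulAction.orbitRel (SeriesGroup 𝒜 d)ᵐᵒᵖ (CharSeries 𝒜 d) (charSeries A) (charSeries B) := by
  rw [MulAction.orbitRel_apply]
  constructor
  · intro h
    obtain ⟨φ, hφ⟩ := Realizes.exists_subst hR hd
      ((Realizes.iff_of_weaklyEquivalent hd (charSeries A).2.1 (charSeries A).2.2 h).1
        (Realizes.charSeries hR hd A))
    exact ⟨MulOpposite.op φ, Subtype.ext hφ.symm⟩
  · rintro ⟨φ, hφ⟩
    exact .rel _ _ ⟨autBar φ.unop.1 φ.unop.2.1,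
      autBar_isWeakEquivalence hR hd φ.unop B A hφ.symm⟩

end Orbits

end MooreAInf

theorem mainTheorem3 {R : Type u} [CommRing R] (𝒜 : ℤ → AddSubgroup R) [GradedRing 𝒜]
    (hR : ∀ i, Odd i → 𝒜 i = ⊥) (d : ℤ) (hd : Even d) :
    (∀ (A : MooreAlgebra 𝒜 d) (n : ℕ),
      A.1.m n (fun _ => mooreY) =
        (PowerSeries.coeff n (charSeries A).1, 0)) ∧
    Function.Bijective (charSeries : MooreAlgebra 𝒜 d → _) ∧
    (∃ Φ : BarMap.normalizedAut R (mooreGrading 𝒜 d) (1, 0) ≃*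
        SeriesGroup 𝒜 d,
      (∀ f (n : ℕ), f.1.val.val n (fun _ => mooreY) =
        (0, PowerSeries.coeff n (Φ f).1)) ∧
      (∀ f (A B : MooreAlgebra 𝒜 d), IsAInfMorphism B.1 A.1 f.1.val.val ↔
        charSeries B = MulOpposite.op (Φ f) • charSeries A)) ∧
    (∀ (f : SeriesGroup 𝒜 d) (u : CharSeries 𝒜 d),
      (MulOpposite.op f • u).1 = u.1.subst f.1) ∧
    (∃ e : Quotient (mooreSetoid d hR) ≃
        MulAction.orbitRel.Quotient (SeriesGroup 𝒜 d)ᵐᵒᵖ (CharSeries 𝒜 d),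
      ∀ A : MooreAlgebra 𝒜 d,
        e (Quotient.mk _ A) = Quotient.mk _ (charSeries A)) := by
  refine ⟨moore_m_mooreY hR hd, charSeries_bijective hR hd,
    ⟨autEquivSeries hR hd, fun f n => ?_, fun f A B => ?_⟩, fun _ _ => rfl,
    Quotient.congr (Equiv.ofBijective charSeries (charSeries_bijective hR hd))
      (mooreSetoid_iff hR hd), fun _ => rfl⟩
  · rw [val_eq_autBar hR hd, autBar_mooreY]
  · rw [val_eq_autBar hR hd, autBar_isAInfMorphism_iff hR hd]
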